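/- **Setting and notation.** $\|\cdot\|$ is the Euclidean norm of vectors and the spectral norm of matrices, $\|\cdot\|_F$ the Frobenius norm, $\operatorname{cond}(H)=\|H\|\,\|H^{-1}\|$, $\mathbb S^n$ the real symmetric $n\times n$ matrices. Let $\operatorname{vec}$ be column stacking, $\Psi_n$ the $n^2\times\frac12n(n+1)$ matrix with columns $\operatorname{vec}(e_ie_i^T)$ and $\frac1{\sqrt2}\operatorname{vec}(e_ie_j^T+e_je_i^T)$ $(j<i)$, $\operatorname{svec}(X)=\Psi_n^T\operatorname{vec}(X)$, and $A\otimes_sB=\frac12\Psi_n^T(A\otimes B+B\otimes A)\Psi_r$ for $A,B\in\mathbb R^{n\times r}$. Let $\mathbf A\in\mathbb R^{m\times n(n+1)/2}$ $(m\ge1)$ have linearly independent rows, $\tilde b\in\mathbb R^m$, $\tilde C\in\mathbb S^n$, $c=\operatorname{svec}(\tilde C)$, $\epsilon>0$, $0<\mu\le1$, and suppose the following. * *Assumption 1.* $W=X^{1/2}(X^{1/2}SX^{1/2})^{-1/2}X^{1/2}$, where $X,S\succ0$ satisfy $\|\frac1\mu X^{1/2}SX^{1/2}-I\|\le\delta$,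 $\|X-X^\star\|\le L\mu$, $\|S-S^\star\|\le L$ for some $X^\star,S^\star\succeq0$ with $X^\star S^\star=0$ and $\chi_1^{-1}I\preceq X^\star+S^\star\preceq I$; here $L\ge1$, $0\le\delta<1$, $\chi_1>0$. * *Assumption 2.* $X^\star=U^\star U^{\star T}$ with $U^\star\in\mathbb R^{n\times\operatorname{rank}(X^\star)}$, and for some $\chi_2\ge1$, $\|(\mathbf A\mathbf A^T)^{-1/2}\mathbf A\operatorname{svec}(U^\star V^T+VU^{\star T})\|\ge\chi_2^{-1}\|U^\star V^T+VU^{\star T}\|_F$ for all $V$. Let $\operatorname{rank}(X^\star)\le r<n$, and let $W=Q\Lambda Q^T+Q_\perp\Lambda_\perp Q_\perp^T$ be an orthonormal eigendecomposition with the top $r$ eigenvalues in $\Lambda$ and the bottom $n-r$ in $\Lambda_\perp$. Put $\tau=\frac12\lambda_{r+1}(W)$, $E=QQ^T+\tau^{-1}Q_\perp\Lambda_\perp Q_\perp^T$, $\mathbf E=E\otimes_sE$, $\mathbf Q=[Q\otimes_sQ,\ \sqrt2\,\Psi_n^T(Q\otimes Q_\perp)]$, $\mathbf\Sigma=\operatorname{diag}(\Lambda\otimes_s\Lambda-\tau^2I,\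 (\Lambda-\tau I)\otimes\Lambda_\perp)^{-1}$, and $$M=\begin{bmatrix}\mathbf A\mathbf E\mathbf A^T&\mathbf A\mathbf Q\\ \mathbf Q^T\mathbf A^T&-\tau^2\mathbf\Sigma\end{bmatrix},\qquad f=\begin{bmatrix}\tilde b+\tau^2\mathbf A\mathbf Ec\\ \tau^2\mathbf Q^Tc\end{bmatrix}.$$ Let $(u_k,v_k)$ be the $k$-th unpreconditioned MINRES iterate for $Mz=f$ started at $0$, that is, the minimizer of $\|Mz-f\|$ over $z\in\operatorname{span}\{f,Mf,\dots,M^{k-1}f\}$, and recover $\Delta y_k=\tau^{-2}u_k$ and $\Delta X_k\in\mathbb S^n$ with $\operatorname{svec}(\Delta X_k)=\mathbf E(\mathbf A^Tu_k-\tau^2c)+\mathbf Qv_k$. **Iteration bound.** The iterates are uniquely defined for every $k$, and there is an absolute constant $K$ (independent of all data above, including $m,n,r$) such that $$\left\|\begin{bmatrix}-(W\otimes_sW)^{-1}&\mathbf A^T\\ \mathbf A&0\end{bmatrix}\begin{bmatrix}\operatorname{svec}(\Delta X_k)\\ \Delta y_k\end{bmatrix}-\begin{bmatrix}\operatorname{svec}(\tilde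 C)\\ \tilde b\end{bmatrix}\right\|\le\epsilon$$ holds for every $$k\ \ge\ K\cdot\sigma\cdot\operatorname{cond}(\mathbf A\mathbf A^T)\cdot L^{20}(1-\delta)^{-19}\chi_1^2\chi_2^6\cdot\log\left(2+\frac{L^4\,\|f\|}{\mu\,\epsilon\,(1-\delta)^4}\right),\qquad \sigma=\max\left\{1,\ \lambda_{\min}(\mathbf A\mathbf A^T),\ \frac1{\lambda_{\max}(\mathbf A\mathbf A^T)}\right\}.$$ Here $\sigma=1$ when $\mathbf A$ is scaled so that $\lambda_{\min}(\mathbf A\mathbf A^T)\le1\le\lambda_{\max}(\mathbf A\mathbf A^T)$, and $\|f\|$ is the initial residual. In particular the dependence on $1/\mu$ is only logarithmic. **Cost.** Consider a real random-access machine with unit-cost arithmetic ($+,-,\times,\div,\sqrt{\ }$), comparisons, branches and loops, with subroutines for $X\mapsto\mathbf A\operatorname{svec}(X)$, for $y\mapsto\mathbf A^Ty$ and for the eigendecomposition of an $n\times n$ symmetric matrix. There is a single program that, given $n,m,r,k$ with $0\le r<n$ and $k\ge1$ and any $W\succ0$, $\tilde b$, $\tilde C$ and $\mathbf A$ with linearly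 independent rows, computes $\Delta X_k,\Delta y_k$ (for the eigendecomposition of $W$ that the subroutine returns). If every subroutine call takes at most $O(n^3)$ time and $O(n^2)$ scratch storage, then the program runs in $O(n^3k)$ time and $O(n^2)$ storage, where the hidden constants of the conclusion depend only on those of the hypothesis. -/

import Mathlib

open scoped Matrix Kronecker Matrix.Norms.L2Operator MatrixOrder

noncomputable section

namespace NewtonKKT

/-! ### Norms, condition numbers, square roots

Matrices carry the spectral norm (the `L2Operator` norm opened above). -/

/-- Euclidean norm of a real vector. -/
def vnorm {ι : Type*} [Fintype ι] (v : ι → ℝ) : ℝ := ‖WithLp.toLp 2 v‖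

/-- Frobenius norm of a real matrix. -/
def frob {p q : ℕ} (X : Matrix (Fin p) (Fin q) ℝ) : ℝ := vnorm X.vec

/-- Spectral condition number `‖H‖ * ‖H⁻¹‖` of an invertible matrix. -/
def cond {ι : Type*} [Fintype ι] [DecidableEq ι] (H : Matrix ι ι ℝ) : ℝ := ‖H‖ * ‖H⁻¹‖

/-- The positive semidefinite square root of a positive semidefinite matrix. -/
def msqrt {ι : Type*} [Fintype ι] [DecidableEq ι] (H : Matrix ι ι ℝ) : Matrix ι ι ℝ := CFC.sqrt H

/-! ### Symmetric vectorization and symmetric Kronecker product -/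

/-- Index set of `svec`: positions `(i, j)` with `j ≤ i` in the lower triangle. It has
`n * (n + 1) / 2` elements. -/
abbrev SIdx (n : ℕ) : Type := {p : Fin n × Fin n // p.2 ≤ p.1}

/-- The basis matrix `Ψ` of vectorized symmetric matrices: the column of `(i, i)` is
`vec (e_i e_iᵀ)`, the column of `(i, j)` with `j < i` is `vec (e_i e_jᵀ + e_j e_iᵀ) / √2`. -/
def Psi (n : ℕ) : Matrix (Fin n × Fin n) (SIdx n) ℝ :=
  Matrix.of fun q p =>
    if p.1.1 = p.1.2 then (if q = p.1 then 1 else 0)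
    else (if q = p.1 ∨ q = p.1.swap then 1 / √2 else 0)

/-- `svec X = Ψᵀ vec X`. -/
def svec {n : ℕ} (X : Matrix (Fin n) (Fin n) ℝ) : SIdx n → ℝ := (Psi n)ᵀ *ᵥ X.vec

/-- The symmetric matrix `X` with `vec X = Ψ x`, the inverse of `svec`. -/
def smat {n : ℕ} (x : SIdx n → ℝ) : Matrix (Fin n) (Fin n) ℝ :=
  Matrix.of fun i j => (Psi n *ᵥ x) (j, i)

/-- Symmetric Kronecker product `½ Ψₙᵀ (A ⊗ B + B ⊗ A) Ψᵣ`. -/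
def symKron {n r : ℕ} (A B : Matrix (Fin n) (Fin r) ℝ) : Matrix (SIdx n) (SIdx r) ℝ :=
  (1 / 2 : ℝ) • ((Psi n)ᵀ * (A ⊗ₖ B + B ⊗ₖ A) * Psi r)

/-! ### The two assumptions -/

/-- `W` is the Nesterov–Todd scaling point of positive definite `X, S`, which are centered up to
`δ` and close to a strictly complementary pair `Xs, Ss`. -/
structure CenteredScaling {n : ℕ} (W X S Xs Ss : Matrix (Fin n) (Fin n) ℝ)
    (μ L δ χ₁ : ℝ) : Prop where
  posDef_X : X.PosDef
  posDef_S : S.PosDef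
  scaling : W = msqrt X * (msqrt (msqrt X * S * msqrt X))⁻¹ * msqrt X
  centered : ‖(1 / μ) • (msqrt X * S * msqrt X) - 1‖ ≤ δ
  dist_X : ‖X - Xs‖ ≤ L * μ
  dist_S : ‖S - Ss‖ ≤ L
  posSemidef_Xs : Xs.PosSemidef
  posSemidef_Ss : Ss.PosSemidef
  complementary : Xs * Ss = 0
  strict_lower : (Xs + Ss - χ₁⁻¹ • 1).PosSemidef
  strict_upper : (1 - (Xs + Ss)).PosSemidef

/-- Tangent space injectivity of `A` at `Xs = U Uᵀ`, with condition number `χ₂`. -/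
def TangentInjective {m n : ℕ} (A : Matrix (Fin m) (SIdx n) ℝ) (Xs : Matrix (Fin n) (Fin n) ℝ)
    (χ₂ : ℝ) : Prop :=
  1 ≤ χ₂ ∧ ∃ U : Matrix (Fin n) (Fin Xs.rank) ℝ, Xs = U * Uᵀ ∧
    ∀ V : Matrix (Fin n) (Fin Xs.rank) ℝ,
      χ₂⁻¹ * frob (U * Vᵀ + V * Uᵀ) ≤
        vnorm (((msqrt (A * Aᵀ))⁻¹ * A) *ᵥ svec (U * Vᵀ + V * Uᵀ))

/-! ### Eigendecomposition and the low-rank plus well-conditioned splitting -/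

/-- `W = P diag(w) Pᵀ` with `P` orthogonal and `w` in nonincreasing order. -/
structure IsEigendecomp {n : ℕ} (W P : Matrix (Fin n) (Fin n) ℝ) (w : Fin n → ℝ) : Prop where
  orth : Pᵀ * P = 1
  antitone : Antitone w
  eq : W = P * Matrix.diagonal w * Pᵀ

section Splitting

variable {n r : ℕ} (hr : r < n) (P : Matrix (Fin n) (Fin n) ℝ) (w : Fin n → ℝ)

/-- The index of the `j`-th of the bottom `n - r` eigenvalues. -/
def botIdx (j : Fin (n - r)) : Fin n := ⟨r + j, Nat.add_lt_of_lt_sub' j.isLt⟩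

/-- `Q`: eigenvectors of the top `r` eigenvalues. -/
def topVec : Matrix (Fin n) (Fin r) ℝ := P.submatrix id (Fin.castLE hr.le)

/-- `Q_⊥`: eigenvectors of the bottom `n - r` eigenvalues. -/
def botVec : Matrix (Fin n) (Fin (n - r)) ℝ := P.submatrix id botIdx

/-- `Λ`. -/
def topVal : Matrix (Fin r) (Fin r) ℝ := Matrix.diagonal fun i => w (Fin.castLE hr.le i)

/-- `Λ_⊥`. -/
def botVal : Matrix (Fin (n - r)) (Fin (n - r)) ℝ :=
  Matrix.diagonal fun j => w (botIdx j)

/-- `τ = ½ λ_{r+1}(W)` (positions are counted from `0` in `w`). -/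
def tau : ℝ := (1 / 2) * w ⟨r, hr⟩

/-- `E = Q Qᵀ + τ⁻¹ Q_⊥ Λ_⊥ Q_⊥ᵀ`. -/
def Emat : Matrix (Fin n) (Fin n) ℝ :=
  topVec hr P * (topVec hr P)ᵀ +
    (tau hr w)⁻¹ • (botVec (r := r) P * botVal (r := r) w * (botVec (r := r) P)ᵀ)

/-- `𝓔 = E ⊛ E`. -/
def EE : Matrix (SIdx n) (SIdx n) ℝ := symKron (Emat hr P w) (Emat hr P w)

/-- Index set of the second block of unknowns. -/
abbrev VIdx (n r : ℕ) : Type := SIdx r ⊕ (Fin r × Fin (n - r))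

/-- `𝓠 = [Q ⊛ Q, √2 Ψᵀ (Q ⊗ Q_⊥)]`. -/
def QQ : Matrix (SIdx n) (VIdx n r) ℝ :=
  Matrix.fromCols (symKron (topVec hr P) (topVec hr P))
    (√2 • ((Psi n)ᵀ * (topVec hr P ⊗ₖ botVec (r := r) P)))

/-- `Σ = diag(Λ ⊛ Λ - τ² I, (Λ - τ I) ⊗ Λ_⊥)⁻¹`. -/
def Sig : Matrix (VIdx n r) (VIdx n r) ℝ :=
  (Matrix.fromBlocks (symKron (topVal hr w) (topVal hr w) - (tau hr w ^ 2) • 1) 0 0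
    ((topVal hr w - tau hr w • 1) ⊗ₖ botVal (r := r) w))⁻¹

variable {m : ℕ} (A : Matrix (Fin m) (SIdx n) ℝ)

/-- The augmented matrix `[A𝓔Aᵀ, A𝓠; 𝓠ᵀAᵀ, -τ²Σ]`. -/
def augMat : Matrix (Fin m ⊕ VIdx n r) (Fin m ⊕ VIdx n r) ℝ :=
  Matrix.fromBlocks (A * EE hr P w * Aᵀ) (A * QQ hr P) ((QQ hr P)ᵀ * Aᵀ)
    (-((tau hr w ^ 2) • Sig hr w))

/-- The augmented right-hand side `[b + τ²A𝓔 svec C; τ²𝓠ᵀ svec C]`. -/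
def augRhs (b : Fin m → ℝ) (C : Matrix (Fin n) (Fin n) ℝ) : Fin m ⊕ VIdx n r → ℝ :=
  Sum.elim (b + (tau hr w ^ 2) • ((A * EE hr P w) *ᵥ svec C))
    ((tau hr w ^ 2) • ((QQ hr P)ᵀ *ᵥ svec C))

/-- Recovered `Δy = τ⁻² u` from `z = (u, v)`. -/
def recoverY (z : Fin m ⊕ VIdx n r → ℝ) : Fin m → ℝ := ((tau hr w ^ 2)⁻¹) • (z ∘ Sum.inl)

/-- Recovered `ΔX`, with `svec ΔX = 𝓔 (Aᵀ u - τ² svec C) + 𝓠 v`, from `z = (u, v)`. -/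
def recoverX (C : Matrix (Fin n) (Fin n) ℝ) (z : Fin m ⊕ VIdx n r → ℝ) :
    Matrix (Fin n) (Fin n) ℝ :=
  smat (EE hr P w *ᵥ (Aᵀ *ᵥ (z ∘ Sum.inl) - (tau hr w ^ 2) • svec C) + QQ hr P *ᵥ (z ∘ Sum.inr))

end Splitting

/-- Norm of the residual of the Newton KKT equations at `(ΔX, Δy)`. -/
def newtResidual {m n : ℕ} (W : Matrix (Fin n) (Fin n) ℝ) (A : Matrix (Fin m) (SIdx n) ℝ)
    (b : Fin m → ℝ) (C : Matrix (Fin n) (Fin n) ℝ) (dX : Matrix (Fin n) (Fin n) ℝ)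
    (dy : Fin m → ℝ) : ℝ :=
  vnorm (Matrix.fromBlocks (-(symKron W W)⁻¹) Aᵀ A 0 *ᵥ Sum.elim (svec dX) dy -
    Sum.elim (svec C) b)

/-! ### MINRES -/

/-- `z` is a `k`-th MINRES iterate for `M z = f` with identity preconditioner and initial point
`0`: it minimizes the residual over `span {f, M f, …, M^(k-1) f}`. -/
def IsMinres {ι : Type*} [Fintype ι] [DecidableEq ι] (M : Matrix ι ι ℝ) (f : ι → ℝ) (k : ℕ)
    (z : ι → ℝ) : Prop :=
  z ∈ Submodule.span ℝ {y | ∃ j < k, y = (M ^ j) *ᵥ f} ∧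
    ∀ y ∈ Submodule.span ℝ {y | ∃ j < k, y = (M ^ j) *ᵥ f},
      vnorm (M *ᵥ z - f) ≤ vnorm (M *ᵥ y - f)

/-! ### A real random-access machine with a step count

Programs are built from unit-cost arithmetic on real memory cells, `for` loops and branches. The
memory consists of arrays `0, 1, 2, …` of real cells. Natural numbers occur only as loop counters
and size parameters, and in the index expressions made of them. -/

/-- Index expressions over the size parameters and loop counters. -/
inductive IExp where
  | const (c : ℕ)
  | var (v : ℕ)
  | add (i j : IExp)
  | sub (i j : IExp)
  | mul (i j : IExp)

/-- Value of an index expression (`sub` is truncated subtraction). -/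
def IExp.eval (ρ : ℕ → ℕ) : IExp → ℕ
  | const c => c
  | var v => ρ v
  | add i j => i.eval ρ + j.eval ρ
  | sub i j => i.eval ρ - j.eval ρ
  | mul i j => i.eval ρ * j.eval ρ

/-- A reference to the cell at position `off` of the array `arr`. -/
structure Ref where
  arr : ℕ
  off : IExp

/-- The cell that a reference denotes. -/
def Ref.cell (ρ : ℕ → ℕ) (x : Ref) : ℕ × ℕ := (x.arr, x.off.eval ρ)

/-- Binary operations on reals; division by zero returns zero. -/
inductive BinOp where
  | add
  | sub
  | mul
  | div

/-- Value of a binary operation. -/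
def BinOp.eval : BinOp → ℝ → ℝ → ℝ
  | add, x, y => x + y
  | sub, x, y => x - y
  | mul, x, y => x * y
  | div, x, y => x / y

/-- Programs. `callA`, `callAT` and `callEig` invoke subroutines for `X ↦ A svec X`, for
`y ↦ Aᵀ y`, and for the eigendecomposition of a symmetric matrix. -/
inductive Prog where
  | const (d : Ref) (q : ℚ)
  | binop (op : BinOp) (d x y : Ref)
  | sqrt (d x : Ref)
  | seq (p₁ p₂ : Prog)
  | loop (v : ℕ) (count : IExp) (body : Prog)
  | ifLe (x y : Ref) (p₁ p₂ : Prog)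
  | ifIdxLt (i j : IExp) (p₁ p₂ : Prog)
  | callA (src dst : ℕ)
  | callAT (src dst : ℕ)
  | callEig (src vecs vals : ℕ)

/-- Contents of the memory: array name, position, value. -/
abbrev Mem : Type := ℕ → ℕ → ℝ

/-- Write one cell. -/
def Mem.set (M : Mem) (c : ℕ × ℕ) (x : ℝ) : Mem := Function.update M c.1 (Function.update (M c.1) c.2 x)

/-- Read the first `m` cells of an array. -/
def Mem.getVec (M : Mem) (m a : ℕ) : Fin m → ℝ := fun i => M a i

/-- Write the first `m` cells of an array. -/
def Mem.setVec {m : ℕ} (M : Mem) (a : ℕ) (x : Fin m → ℝ) : Mem :=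
  Function.update M a fun o => if h : o < m then x ⟨o, h⟩ else M a o

/-- Read an `n × n` matrix stored by rows. -/
def Mem.getMat (M : Mem) (n a : ℕ) : Matrix (Fin n) (Fin n) ℝ :=
  Matrix.of fun i j => M a (i * n + j)

/-- Write an `n × n` matrix by rows. -/
def Mem.setMat {n : ℕ} (M : Mem) (a : ℕ) (X : Matrix (Fin n) (Fin n) ℝ) : Mem :=
  M.setVec a fun o : Fin (n * n) => X o.divNat o.modNat

/-- The first `s` cells of array `a`. -/
def cells (a s : ℕ) : Finset (ℕ × ℕ) := {a} ×ˢ Finset.range s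

/-- The subroutines available to a program: products with `A` and `Aᵀ` and an eigensolver for
symmetric matrices, with the time charged for one call and the scratch storage they share. -/
structure Subroutines (m n : ℕ) where
  A : Matrix (Fin m) (SIdx n) ℝ
  eig : Matrix (Fin n) (Fin n) ℝ → Matrix (Fin n) (Fin n) ℝ × (Fin n → ℝ)
  eig_spec : ∀ H : Matrix (Fin n) (Fin n) ℝ, H.IsSymm → IsEigendecomp H (eig H).1 (eig H).2
  timeA : ℕ
  timeAT : ℕ
  timeEig : ℕ
  scratch : ℕ

/-- Result of a run: final memory, elapsed time, and the set of all cells read or written. -/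
structure Outcome where
  mem : Mem
  time : ℕ
  used : Finset (ℕ × ℕ)

/-- Execution of a program with index environment `ρ` on memory `M`. Every arithmetic operation,
test and loop iteration takes one unit of time; a subroutine call takes its charge. Vectors are
passed to subroutines in the first `m` (or `n`) cells of an array, symmetric matrices as
`n × n` arrays by rows. -/
def Prog.run {m n : ℕ} (Θ : Subroutines m n) : Prog → (ℕ → ℕ) → Mem → Outcome
  | .const d q, ρ, M => ⟨M.set (d.cell ρ) (q : ℝ), 1, {d.cell ρ}⟩
  | .binop op d x y, ρ, M =>
      ⟨M.set (d.cell ρ) (op.eval (M (x.cell ρ).1 (x.cell ρ).2) (M (y.cell ρ).1 (y.cell ρ).2)), 1,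
        {d.cell ρ, x.cell ρ, y.cell ρ}⟩
  | .sqrt d x, ρ, M =>
      ⟨M.set (d.cell ρ) (√(M (x.cell ρ).1 (x.cell ρ).2)), 1, {d.cell ρ, x.cell ρ}⟩
  | .seq p₁ p₂, ρ, M =>
      let o₁ := p₁.run Θ ρ M
      let o₂ := p₂.run Θ ρ o₁.mem
      ⟨o₂.mem, o₁.time + o₂.time, o₁.used ∪ o₂.used⟩
  | .loop v count body, ρ, M =>
      Nat.rec (motive := fun _ => Outcome) ⟨M, 1, ∅⟩
        (fun i o =>
          let o' := body.run Θ (Function.update ρ v i) o.mem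
          ⟨o'.mem, o.time + o'.time + 1, o.used ∪ o'.used⟩)
        (count.eval ρ)
  | .ifLe x y p₁ p₂, ρ, M =>
      let o := open Classical in
        if M (x.cell ρ).1 (x.cell ρ).2 ≤ M (y.cell ρ).1 (y.cell ρ).2 then p₁.run Θ ρ M
        else p₂.run Θ ρ M
      ⟨o.mem, o.time + 1, o.used ∪ {x.cell ρ, y.cell ρ}⟩
  | .ifIdxLt i j p₁ p₂, ρ, M =>
      let o := if i.eval ρ < j.eval ρ then p₁.run Θ ρ M else p₂.run Θ ρ M
      ⟨o.mem, o.time + 1, o.used⟩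
  | .callA src dst, _, M =>
      ⟨M.setVec dst (Θ.A *ᵥ svec (M.getMat n src)), Θ.timeA + 1, cells src (n * n) ∪ cells dst m⟩
  | .callAT src dst, _, M =>
      ⟨M.setMat dst (smat (Θ.Aᵀ *ᵥ M.getVec m src)), Θ.timeAT + 1,
        cells src m ∪ cells dst (n * n)⟩
  | .callEig src vecs vals, _, M =>
      ⟨(M.setMat vecs (Θ.eig (M.getMat n src)).1).setVec vals (Θ.eig (M.getMat n src)).2,
        Θ.timeEig + 1, cells src (n * n) ∪ cells vecs (n * n) ∪ cells vals n⟩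

/-- Initial memory: `W`, `b`, `C` in arrays `0`, `1`, `2`, all other cells zero. -/
def inputMem {m n : ℕ} (W : Matrix (Fin n) (Fin n) ℝ) (b : Fin m → ℝ)
    (C : Matrix (Fin n) (Fin n) ℝ) : Mem :=
  Mem.setMat (Mem.setVec (Mem.setMat (fun _ _ => 0) 0 W) 1 b) 2 C

/-- Initial index environment: variables `0, 1, 2, 3` hold `n, m, r, k`. -/
def inputIdx (n m r k : ℕ) : ℕ → ℕ
  | 0 => n
  | 1 => m
  | 2 => r
  | 3 => k
  | _ => 0

/-- Storage of a run: number of distinct cells used (inputs and outputs included), plus the scratch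
space of the subroutines. The loop counters, whose number is fixed by the program, are not counted. -/
def storage {m n : ℕ} (Θ : Subroutines m n) (o : Outcome) : ℕ := o.used.card + Θ.scratch

end NewtonKKT

end

noncomputable section

namespace NewtonKKT

/-! ### Symmetric vectorization -/

section SymVec

variable {n r : ℕ}

/-! Everything becomes diagonal in the eigenbasis of W. The matrix 𝐏 = `symKron P P` is orthogonal
and acts on symmetric matrices as X ↦ P X Pᵀ. Put g i = τ on the top r positions and g i = w i on
the others. In the coordinates given by 𝐏, W ⊗ₛ W is diagonal with entries w i * w j, 𝓔 is diagonal
with entries g i * g j / τ², 𝓠 embeds the positions with at least one index among the top r, and Σ⁻¹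
has the entries w i * w j - g i * g j there. These weights vanish at all other positions, so W ⊗ₛ W
= τ²𝓔 + 𝓠Σ⁻¹𝓠ᵀ. Eliminating v exactly would return the Newton equations; inexactly, the Newton
residual is at most max(1, τ⁻²) times the augmented residual (`newtResidual_le`).

The augmented matrix is well conditioned independently of μ. Centering gives √((1-δ)μ) W ≤ X. With W
S W = X and S bounded, all eigenvalues of W are at least of order √μ; as X⋆ has rank at most r,
λ_{r+1}(W) is at most of order √μ. Hence τ ≤ Γ w i for all i, with Γ = L²/(1-δ)
(`CenteredScaling.tau_le`), so the entries of 𝓔 lie in [Γ⁻², 4] and those of τ²Σ in (0, Γ].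

For the lower bound (`CenteredScaling.vnorm_le_augMat`), pairing M(u, v) with (u, -v) cancels the
coupling and leaves the sum of the 𝓔-energy of Aᵀu and the τ²Σ-energy of v. The first controls u.
For v, tangent space injectivity bounds 𝓠v by its image under (AAᵀ)^(-1/2)A, read off from the first
block of the equations, and by its compression to the kernel of X⋆ (`TangentInjective.frob_le`).
That compression is controlled by the second energy, because W is only of order √μ on this kernel
(`CenteredScaling.frob_compression_le`).

MINRES is realized by conjugate directions with a three-term recurrence, and its residual is
compared with a Chebyshev polynomial in M² (`IsMinres.residual_le`). The rate depends on cond(M)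
only; μ enters through the factor τ⁻², inside the logarithm.

For the cost, the second block is stored as a symmetric n × n matrix in the eigenbasis. Applying 𝐏
or its transpose then takes two n × n products, and everything else in an iteration is a subroutine
call, an entrywise loop or an inner product. The predicate `Cheap` records O(n³) time within a fixed
pool of cells and is closed under composition. -/

/-- The position in the lower triangle of the unordered pair `{i, j}`. -/
def lowIdx (i j : Fin n) : SIdx n := ⟨(max i j, min i j), min_le_max⟩

/-- Each position of the full square meets exactly one column of `Psi`, that of its unordered index
pair, so the sum has a single term. -/
theorem Psi_mulVec_apply (x : SIdx n → ℝ) (i j : Fin n) :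
    (Psi n *ᵥ x) (i, j) = (if i = j then 1 else 1 / √2) * x (lowIdx i j) := by
  rw [Matrix.mulVec, dotProduct, Finset.sum_eq_single (lowIdx i j)]
  · congr 1
    rcases lt_trichotomy i j with h | h | h
    · have : (lowIdx i j).1 = (j, i) := by simp [lowIdx, h.le]
      simp [Psi, this, h.ne, h.ne']
    · subst h; simp [Psi, lowIdx]
    · have : (lowIdx i j).1 = (i, j) := by simp [lowIdx, h.le]
      simp [Psi, this, h.ne']
  · rintro ⟨⟨a, b⟩, hab⟩ - hne
    have hne' : ¬ (a = max i j ∧ b = min i j) := by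
      intro h; exact hne (Subtype.ext (Prod.ext h.1 h.2))
    simp only [Psi, Matrix.of_apply, Prod.mk.injEq, Prod.swap_prod_mk, mul_eq_zero]
    left
    have hab' : b ≤ a := hab
    split_ifs with h1 h2 h3
    · exfalso; obtain ⟨rfl, rfl⟩ := h2; subst h1; simp at hne'
    · rfl
    · exfalso
      rcases h3 with ⟨rfl, rfl⟩ | ⟨rfl, rfl⟩
      · simp [hab'] at hne'
      · simp [hab'] at hne'
    · rfl
  · simp

theorem smat_apply (x : SIdx n → ℝ) (i j : Fin n) :
    smat x i j = (if i = j then 1 else 1 / √2) * x (lowIdx i j) := by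
  rw [smat, Matrix.of_apply, Psi_mulVec_apply]
  simp [lowIdx, max_comm, min_comm, eq_comm]

theorem smat_symm (x : SIdx n → ℝ) (i j : Fin n) : smat x i j = smat x j i := by
  rw [smat_apply, smat_apply]
  simp [lowIdx, max_comm, min_comm, eq_comm]

theorem smat_transpose (x : SIdx n → ℝ) : (smat x)ᵀ = smat x := by
  ext i j; exact smat_symm x j i

theorem vec_smat (x : SIdx n → ℝ) : (smat x).vec = Psi n *ᵥ x := by
  ext ⟨i, j⟩; rfl

/-- The columns of `Psi` are orthonormal and span the vectorized symmetric matrices, so encoding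
followed by decoding is the orthogonal projection onto symmetric matrices. -/
theorem smat_svec (X : Matrix (Fin n) (Fin n) ℝ) :
    smat (svec X) = (1 / 2 : ℝ) • (X + Xᵀ) := by
  have key : ∀ p : SIdx n, svec X p =
      if p.1.1 = p.1.2 then X p.1.1 p.1.1 else (1 / √2) * (X p.1.1 p.1.2 + X p.1.2 p.1.1) := by
    rintro ⟨⟨a, b⟩, hab⟩
    simp only [svec, Matrix.mulVec, dotProduct, Matrix.transpose_apply, Psi, Matrix.of_apply,
      Matrix.vec]
    split_ifs with h
    · subst h; simp
    · have hne : ((a, b) : Fin n × Fin n) ≠ (b, a) := by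
        intro e; exact h (Prod.ext_iff.1 e).1
      have : ∀ q : Fin n × Fin n, (if q = (a, b) ∨ q = (a, b).swap then 1 / √2 else (0:ℝ)) *
          X q.2 q.1 = (if q = (a, b) then (1 / √2) * X q.2 q.1 else 0) +
            (if q = (b, a) then (1 / √2) * X q.2 q.1 else 0) := by
        intro q
        by_cases h1 : q = (a, b)
        · subst h1; simp [hne]
        · by_cases h2 : q = (b, a)
          · subst h2; simp [hne.symm]
          · simp [h1, h2]
      simp_rw [this, Finset.sum_add_distrib, Finset.sum_ite_eq' Finset.univ]
      simp; ring
  ext i j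
  rw [smat_apply, key]
  rcases lt_trichotomy i j with h | h | h
  · simp [lowIdx, h.le, h.ne, h.ne']
    rw [← mul_assoc, ← mul_inv, Real.mul_self_sqrt (by norm_num)]; ring
  · subst h; simp [lowIdx]; ring
  · simp [lowIdx, h.le, h.ne']
    rw [← mul_assoc, ← mul_inv, Real.mul_self_sqrt (by norm_num)]

theorem smat_svec_of_isSymm {X : Matrix (Fin n) (Fin n) ℝ} (h : X.IsSymm) :
    smat (svec X) = X := by
  rw [smat_svec, h.eq, ← two_smul ℝ X, smul_smul]; norm_num

theorem smat_injective : Function.Injective (smat (n := n)) := by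
  intro x y h
  ext ⟨⟨a, b⟩, hab⟩
  have hab' : b ≤ a := hab
  have h1 := congrFun (congrFun h a) b
  rw [smat_apply, smat_apply] at h1
  have e : lowIdx a b = ⟨(a, b), hab⟩ := Subtype.ext (by simp [lowIdx, hab'])
  rw [e] at h1
  refine mul_left_cancel₀ ?_ h1
  split_ifs <;> positivity

theorem smat_isSymm (x : SIdx n → ℝ) : (smat x).IsSymm := smat_transpose x

theorem svec_smat (x : SIdx n → ℝ) : svec (smat x) = x :=
  smat_injective (smat_svec_of_isSymm (smat_isSymm x))

theorem svec_transpose (X : Matrix (Fin n) (Fin n) ℝ) : svec Xᵀ = svec X := by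
  apply smat_injective
  rw [smat_svec, smat_svec, Matrix.transpose_transpose, add_comm]

theorem svec_add (X Y : Matrix (Fin n) (Fin n) ℝ) : svec (X + Y) = svec X + svec Y := by
  simp [svec, Matrix.vec_add, Matrix.mulVec_add]

theorem svec_smul (c : ℝ) (X : Matrix (Fin n) (Fin n) ℝ) : svec (c • X) = c • svec X := by
  simp [svec, Matrix.vec_smul, Matrix.mulVec_smul]

theorem smat_add (x y : SIdx n → ℝ) : smat (x + y) = smat x + smat y := by
  ext i j; simp [smat, Matrix.mulVec_add]

theorem smat_smul (c : ℝ) (x : SIdx n → ℝ) : smat (c • x) = c • smat x := by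
  ext i j; simp [smat, Matrix.mulVec_smul]

theorem smat_sub (x y : SIdx n → ℝ) : smat (x - y) = smat x - smat y := by
  ext i j; simp [smat, Matrix.mulVec_sub]

theorem Psi_transpose_mulVec_Psi_mulVec (x : SIdx n → ℝ) : (Psi n)ᵀ *ᵥ (Psi n *ᵥ x) = x := by
  rw [← vec_smat]; exact svec_smat x

/-- The weights 1/√2 make the decoding an isometry for the Frobenius inner product. The conditioning
estimates and the storage format of the machine both rely on this. -/
theorem dotProduct_vec_smat (x y : SIdx n → ℝ) : (smat x).vec ⬝ᵥ (smat y).vec = x ⬝ᵥ y := by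
  rw [vec_smat, vec_smat, dotProduct_comm, Matrix.dotProduct_mulVec, ← Matrix.mulVec_transpose,
    Psi_transpose_mulVec_Psi_mulVec, dotProduct_comm]

/-- This replaces the algebra of symmetric Kronecker products by congruences X ↦ A X Aᵀ. Products,
identities and diagonal forms are then checked on matrices. -/
theorem symKron_self_mulVec (A : Matrix (Fin n) (Fin r) ℝ) (x : SIdx r → ℝ) :
    symKron A A *ᵥ x = svec (A * smat x * Aᵀ) := by
  rw [symKron, svec, ← Matrix.kronecker_mulVec_vec, vec_smat, ← two_smul ℝ (A ⊗ₖ A)]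
  simp [Matrix.mulVec_mulVec, Matrix.mul_assoc]

theorem smat_symKron_self_mulVec (A : Matrix (Fin n) (Fin r) ℝ) (x : SIdx r → ℝ) :
    smat (symKron A A *ᵥ x) = A * smat x * Aᵀ := by
  rw [symKron_self_mulVec, smat_svec_of_isSymm]
  simp [Matrix.IsSymm, smat_transpose, Matrix.mul_assoc]

theorem symKron_transpose (A : Matrix (Fin n) (Fin r) ℝ) :
    (symKron A A)ᵀ = symKron Aᵀ Aᵀ := by
  simp [symKron, Matrix.mul_assoc, Matrix.kroneckerMap_transpose]

theorem matrix_ext_of_smat_mulVec {ι : Type*} [Fintype ι] {A B : Matrix (SIdx n) ι ℝ}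
    (h : ∀ x, smat (A *ᵥ x) = smat (B *ᵥ x)) : A = B := by
  classical
  exact Matrix.ext_of_mulVec_single fun i => smat_injective (h _)

theorem symKron_mul {p : ℕ} (A : Matrix (Fin n) (Fin r) ℝ) (B : Matrix (Fin r) (Fin p) ℝ) :
    symKron (A * B) (A * B) = symKron A A * symKron B B := by
  refine matrix_ext_of_smat_mulVec fun x => ?_
  rw [← Matrix.mulVec_mulVec]
  simp only [smat_symKron_self_mulVec, Matrix.transpose_mul, Matrix.mul_assoc]

theorem symKron_diagonal (d : Fin n → ℝ) :
    symKron (Matrix.diagonal d) (Matrix.diagonal d) =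
      Matrix.diagonal fun p : SIdx n => d p.1.1 * d p.1.2 := by
  refine matrix_ext_of_smat_mulVec fun x => ?_
  rw [smat_symKron_self_mulVec, Matrix.diagonal_transpose]
  ext i j
  rw [Matrix.mul_diagonal, Matrix.diagonal_mul, smat_apply, smat_apply, Matrix.mulVec_diagonal]
  have : d (lowIdx i j).1.1 * d (lowIdx i j).1.2 = d i * d j := by
    rcases le_total i j with h | h <;> simp [lowIdx, h, mul_comm]
  rw [this]; ring

theorem symKron_one : symKron (1 : Matrix (Fin n) (Fin n) ℝ) 1 = 1 := by
  rw [← Matrix.diagonal_one, symKron_diagonal]; simp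

theorem smat_diagonal_mulVec (d : Fin n → Fin n → ℝ) (hd : ∀ i j, d i j = d j i)
    (x : SIdx n → ℝ) (i j : Fin n) :
    smat (fun p => d p.1.1 p.1.2 * x p) i j = d i j * smat x i j := by
  rw [smat_apply, smat_apply]
  have : d (lowIdx i j).1.1 (lowIdx i j).1.2 = d i j := by
    rcases le_total i j with h | h <;> simp [lowIdx, h, hd]
  rw [this]; ring

/-- Needed to compute single columns of `symKron P P`. On the diagonal the two matrix units
coincide, hence the factor 1/2 in place of 1/√2. -/
theorem smat_single (p : SIdx n) :
    smat (Pi.single p 1) = (if p.1.1 = p.1.2 then 1 / 2 else 1 / √2 : ℝ) •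
      (Matrix.single p.1.1 p.1.2 1 + Matrix.single p.1.2 p.1.1 1) := by
  obtain ⟨⟨a, b⟩, hab⟩ := p
  have hab' : b ≤ a := hab
  ext i j
  rw [smat_apply, Pi.single_apply]
  have e : (lowIdx i j = (⟨(a, b), hab⟩ : SIdx n)) ↔ (i = a ∧ j = b) ∨ (i = b ∧ j = a) := by
    rw [Subtype.ext_iff, Prod.ext_iff]
    simp only [lowIdx]
    rcases le_total i j with h | h
    · simp only [h, max_eq_right, min_eq_left]
      constructor
      · rintro ⟨rfl, rfl⟩; right; simp
      · rintro (⟨rfl, rfl⟩ | ⟨rfl, rfl⟩)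
        · have := le_antisymm h hab'; subst this; simp
        · simp
    · simp only [h, max_eq_left, min_eq_right]
      constructor
      · rintro ⟨rfl, rfl⟩; left; simp
      · rintro (⟨rfl, rfl⟩ | ⟨rfl, rfl⟩)
        · simp
        · have := le_antisymm h hab'; subst this; simp
  simp only [e, Matrix.smul_apply, Matrix.add_apply, Matrix.single_apply, smul_eq_mul]
  by_cases hd : a = b
  · subst hd
    by_cases h1 : i = a ∧ j = a
    · obtain ⟨rfl, rfl⟩ := h1
      norm_num
    · have h1' : ¬ (a = i ∧ a = j) := fun h => h1 ⟨h.1.symm, h.2.symm⟩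
      simp [h1, h1']
  · by_cases h1 : i = a ∧ j = b
    · obtain ⟨rfl, rfl⟩ := h1
      have : j ≠ i := fun h => hd h.symm
      simp [hd, this]
    · by_cases h2 : i = b ∧ j = a
      · obtain ⟨rfl, rfl⟩ := h2
        simp [hd, Ne.symm hd]
      · have h1' : ¬ (a = i ∧ b = j) := fun h => h1 ⟨h.1.symm, h.2.symm⟩
        have h2' : ¬ (b = i ∧ a = j) := fun h => h2 ⟨h.1.symm, h.2.symm⟩
        simp [h1, h2, h1', h2']

end SymVec

/-! ### The splitting in the eigenbasis -/

section Rotated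

variable {n r : ℕ}

theorem sum_top_add_sum_bot {α : Type*} [AddCommMonoid α] (hr : r < n) (f : Fin n → α) :
    ∑ k, f k = ∑ i : Fin r, f (Fin.castLE hr.le i) + ∑ j : Fin (n - r), f (botIdx j) := by
  rw [← Equiv.sum_comp (finSumFinEquiv.trans (finCongr (by omega : r + (n - r) = n))) f,
    Fintype.sum_sum_type]
  rfl

/-- `τ` on the top `r` positions and the eigenvalue on the others. -/
def gval (hr : r < n) (w : Fin n → ℝ) (i : Fin n) : ℝ := if (i : ℕ) < r then tau hr w else w i

/-- The weight `w i * w j - g i * g j`, the inverse of the entry of `Σ` at `(i, j)`. -/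
def swt (hr : r < n) (w : Fin n → ℝ) (i j : Fin n) : ℝ := w i * w j - gval hr w i * gval hr w j

/-- The position of an unknown of the second block in the lower triangle. -/
def vemb (hr : r < n) : VIdx n r → SIdx n
  | .inl p => ⟨(Fin.castLE hr.le p.1.1, Fin.castLE hr.le p.1.2), p.2⟩
  | .inr p => ⟨(botIdx p.2, Fin.castLE hr.le p.1), by
      show (p.1 : ℕ) ≤ r + p.2
      omega⟩

theorem swt_comm (hr : r < n) (w : Fin n → ℝ) (i j : Fin n) : swt hr w i j = swt hr w j i := by
  simp only [swt]; ring

theorem vemb_injective (hr : r < n) : Function.Injective (vemb hr) := by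
  rintro (⟨⟨a, b⟩, h⟩ | ⟨a, b⟩) (⟨⟨a', b'⟩, h'⟩ | ⟨a', b'⟩) e <;>
    simp only [vemb, Subtype.mk.injEq, Prod.mk.injEq, Fin.ext_iff, botIdx, Fin.val_castLE] at e
  · have h1 : a = a' := Fin.ext e.1
    have h2 : b = b' := Fin.ext e.2
    subst h1; subst h2; rfl
  · omega
  · omega
  · have h1 : a = a' := Fin.ext e.2
    have h2 : b = b' := Fin.ext (by omega)
    subst h1; subst h2; rfl

/-- Since the second index is the smaller one, the condition says that at least one of the two
indices is among the top r. -/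
theorem mem_range_vemb_iff (hr : r < n) (p : SIdx n) :
    p ∈ Set.range (vemb hr) ↔ (p.1.2 : ℕ) < r := by
  constructor
  · rintro ⟨(q | q), rfl⟩ <;> simp [vemb]
  · obtain ⟨⟨a, b⟩, hab⟩ := p
    intro hb
    simp only at hb
    by_cases ha : (a : ℕ) < r
    · exact ⟨.inl ⟨(⟨a, ha⟩, ⟨b, hb⟩), hab⟩, rfl⟩
    · refine ⟨.inr (⟨b, hb⟩, ⟨a - r, by omega⟩), Subtype.ext (Prod.ext (Fin.ext ?_) rfl)⟩
      simp only [vemb, botIdx]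
      omega

/-- If the smaller index is at least r, so is the other, and g equals w at both. This makes the
weights a mask for the second block. -/
theorem swt_of_notMem_range (hr : r < n) (w : Fin n → ℝ) (p : SIdx n)
    (hp : p ∉ Set.range (vemb hr)) : swt hr w p.1.1 p.1.2 = 0 := by
  rw [mem_range_vemb_iff] at hp
  have : (p.1.2 : ℕ) ≤ p.1.1 := p.2
  simp [swt, gval, hp, show ¬ (p.1.1 : ℕ) < r by omega]

variable (hr : r < n) {P : Matrix (Fin n) (Fin n) ℝ} {w : Fin n → ℝ}

theorem tau_pos (hpos : ∀ i, 0 < w i) : 0 < tau hr w := by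
  have := hpos ⟨r, hr⟩
  rw [tau]; linarith

theorem gval_pos (hpos : ∀ i, 0 < w i) (i : Fin n) : 0 < gval hr w i := by
  rw [gval]; split_ifs
  · exact tau_pos hr hpos
  · exact hpos i

theorem gval_le (hpos : ∀ i, 0 < w i) (hw : Antitone w) (i : Fin n) :
    gval hr w i ≤ 2 * tau hr w := by
  rw [gval]; split_ifs with h
  · have := tau_pos hr hpos; linarith
  · have : w i ≤ w ⟨r, hr⟩ := hw (by rw [Fin.le_def]; simpa using h)
    rw [tau]; linarith

theorem two_mul_tau_le (hw : Antitone w) {i : Fin n} (hi : (i : ℕ) < r) :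
    2 * tau hr w ≤ w i := by
  have : w ⟨r, hr⟩ ≤ w i := hw (by rw [Fin.le_def]; simpa using hi.le)
  rw [tau]; linarith

theorem gval_le_self (hpos : ∀ i, 0 < w i) (hw : Antitone w) (i : Fin n) :
    gval hr w i ≤ w i := by
  rw [gval]; split_ifs with h
  · have := tau_pos hr hpos
    have := two_mul_tau_le hr hw h
    linarith
  · exact le_rfl

/-- On the second block, the weight is at least half of the product of the eigenvalues. -/
theorem mul_le_two_mul_swt (hpos : ∀ i, 0 < w i) (hw : Antitone w) (i j : Fin n)
    (hj : (j : ℕ) < r) : w i * w j ≤ 2 * swt hr w i j := by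
  have h1 := gval_le_self hr hpos hw i
  have h2 := two_mul_tau_le hr hw hj
  have h3 : gval hr w j = tau hr w := by simp [gval, hj]
  have h4 := tau_pos hr hpos
  -- The index j belongs to the top, so g j = τ is at most half of w j, while g i ≤ w i; the
  -- subtracted product is thus at most half of w i * w j.
  have := mul_le_mul h1 h2 (by linarith) (hpos i).le
  rw [swt, h3]; linarith

theorem swt_vemb_pos (hpos : ∀ i, 0 < w i) (hw : Antitone w) (q : VIdx n r) :
    0 < swt hr w (vemb hr q).1.1 (vemb hr q).1.2 := by
  have := mul_le_two_mul_swt hr hpos hw (vemb hr q).1.1 (vemb hr q).1.2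
    ((mem_range_vemb_iff hr _).1 ⟨q, rfl⟩)
  have := mul_pos (hpos (vemb hr q).1.1) (hpos (vemb hr q).1.2)
  linarith

theorem Emat_eq (hpos : ∀ i, 0 < w i) :
    Emat hr P w = P * Matrix.diagonal (fun i => gval hr w i / tau hr w) * Pᵀ := by
  have ht := (tau_pos hr hpos).ne'
  ext i j
  rw [Emat, Matrix.add_apply, Matrix.smul_apply, Matrix.mul_apply, Matrix.mul_apply,
    Matrix.mul_apply]
  simp only [botVal, Matrix.mul_diagonal, Matrix.transpose_apply, topVec, botVec,
    Matrix.submatrix_apply, id]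
  rw [sum_top_add_sum_bot hr, smul_eq_mul, Finset.mul_sum]
  congr 1 <;> refine Finset.sum_congr rfl fun k _ => ?_
  · simp [gval, div_self ht]
  · simp [gval, botIdx]; ring

theorem EE_eq (hpos : ∀ i, 0 < w i) :
    EE hr P w = symKron P P * Matrix.diagonal (fun p : SIdx n =>
      gval hr w p.1.1 * gval hr w p.1.2 / tau hr w ^ 2) * (symKron P P)ᵀ := by
  rw [EE, Emat_eq hr hpos, symKron_mul, symKron_mul, symKron_diagonal, symKron_transpose]
  congr 3
  ext p
  rw [div_mul_div_comm, sq]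

theorem IsEigendecomp.symKron_eq {W : Matrix (Fin n) (Fin n) ℝ} (h : IsEigendecomp W P w) :
    symKron W W = symKron P P * Matrix.diagonal (fun p : SIdx n => w p.1.1 * w p.1.2) *
      (symKron P P)ᵀ := by
  rw [h.eq, symKron_mul, symKron_mul, symKron_diagonal, symKron_transpose]

theorem symKron_transpose_mul_self (h : Pᵀ * P = 1) : (symKron P P)ᵀ * symKron P P = 1 := by
  rw [symKron_transpose, ← symKron_mul, h, symKron_one]

theorem symKron_mul_transpose_self (h : Pᵀ * P = 1) : symKron P P * (symKron P P)ᵀ = 1 :=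
  mul_eq_one_comm.1 (symKron_transpose_mul_self h)

theorem apply_eq_mulVec_single {l k : Type*} [Fintype k] [DecidableEq k]
    (M : Matrix l k ℝ) (i : l) (j : k) : M i j = (M *ᵥ Pi.single j 1) i := by simp

theorem mul_single_mul_transpose {l k : Type*} [Fintype k] [DecidableEq k]
    (B : Matrix l k ℝ) (i j : k) :
    B * Matrix.single i j (1 : ℝ) * Bᵀ = Matrix.of fun a b => B a i * B b j := by
  ext a b
  simp [Matrix.mul_apply, Matrix.single_apply, ite_and]

/-- Both blocks of 𝓠 consist of columns of the one orthogonal matrix `symKron P P`: pairs of top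
indices give the first block, mixed pairs the second. -/
theorem QQ_eq : QQ hr P = (symKron P P).submatrix id (vemb hr) := by
  have e1 : ∀ q, ∀ p, symKron P P q p =
      svec ((if p.1.1 = p.1.2 then 1 / 2 else 1 / √2 : ℝ) •
        (Matrix.of (fun a b => P a p.1.1 * P b p.1.2) +
          Matrix.of (fun a b => P a p.1.2 * P b p.1.1))) q := by
    intro q p
    rw [apply_eq_mulVec_single (symKron _ _), symKron_self_mulVec, smat_single, Matrix.mul_smul,
      Matrix.smul_mul, Matrix.mul_add, Matrix.add_mul, mul_single_mul_transpose,
      mul_single_mul_transpose]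
  ext q (p | p)
  · rw [QQ, Matrix.fromCols_apply_inl, Matrix.submatrix_apply, id, e1,
      apply_eq_mulVec_single (symKron _ _), symKron_self_mulVec, smat_single, Matrix.mul_smul,
      Matrix.smul_mul, Matrix.mul_add, Matrix.add_mul, mul_single_mul_transpose,
      mul_single_mul_transpose]
    simp [vemb, topVec]
  · rw [QQ, Matrix.fromCols_apply_inr, Matrix.submatrix_apply, id, e1]
    have hne : (vemb hr (.inr p) : SIdx n).1.1 ≠ (vemb hr (.inr p) : SIdx n).1.2 := by
      simp only [vemb, botIdx, ne_eq, Fin.ext_iff, Fin.val_castLE]; omega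
    rw [if_neg hne]
    have e2 : ((Psi n)ᵀ * (topVec hr P ⊗ₖ botVec (r := r) P)) q p =
        svec (Matrix.of fun a b => botVec (r := r) P a p.2 * topVec hr P b p.1) q := by
      rw [Matrix.mul_apply, svec, Matrix.mulVec, dotProduct]
      refine Finset.sum_congr rfl fun k _ => ?_
      simp [Matrix.vec, mul_comm]
    have e3 : Matrix.of (fun a b => P a (vemb hr (.inr p)).1.2 * P b (vemb hr (.inr p)).1.1) =
        (Matrix.of (fun a b => P a (vemb hr (.inr p)).1.1 * P b (vemb hr (.inr p)).1.2))ᵀ := by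
      ext a b; simp [mul_comm]
    -- A mixed Kronecker column is the `svec` of a nonsymmetric rank-one matrix, which has the same
    -- `svec` as its transpose. The symmetric sum therefore contributes a factor 2, and 2/√2 is the
    -- prescribed √2.
    have e4 : √2 = 1 / √2 * 2 := by
      rw [one_div, inv_mul_eq_div, Real.div_sqrt]
    rw [Matrix.smul_apply, e2, e3, svec_smul, svec_add, svec_transpose, ← two_smul ℝ,
      smul_smul, ← e4]
    rfl

/-- The blocks under the inverse are diagonal with the weights as entries. Their positivity on the
second block makes the inverse a genuine one. -/
theorem Sig_eq (hpos : ∀ i, 0 < w i) (hw : Antitone w) :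
    Sig hr w = Matrix.diagonal fun q : VIdx n r =>
      (swt hr w (vemb hr q).1.1 (vemb hr q).1.2)⁻¹ := by
  have : Matrix.fromBlocks (symKron (topVal hr w) (topVal hr w) - (tau hr w ^ 2) • 1) 0 0
      ((topVal hr w - tau hr w • 1) ⊗ₖ botVal (r := r) w) =
      Matrix.diagonal fun q : VIdx n r => swt hr w (vemb hr q).1.1 (vemb hr q).1.2 := by
    rw [topVal, botVal, symKron_diagonal, Matrix.smul_one_eq_diagonal,
      Matrix.smul_one_eq_diagonal, Matrix.diagonal_sub, Matrix.diagonal_sub,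
      Matrix.diagonal_kronecker_diagonal, Matrix.fromBlocks_diagonal]
    congr 1
    ext (q | q)
    · simp [swt, vemb, gval, sq]
    · simp [swt, vemb, gval, botIdx]; ring
  rw [Sig, this]
  refine Matrix.inv_eq_right_inv ?_
  rw [Matrix.diagonal_mul_diagonal, ← Matrix.diagonal_one]
  congr 1
  ext q
  exact mul_inv_cancel₀ (swt_vemb_pos hr hpos hw q).ne'

end Rotated

/-! ### Euclidean norm and inner product -/

section Norm

variable {ι κ : Type*} [Fintype ι] [Fintype κ]

theorem vnorm_nonneg (x : ι → ℝ) : 0 ≤ vnorm x := norm_nonneg _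

theorem vnorm_sq (x : ι → ℝ) : vnorm x ^ 2 = x ⬝ᵥ x := by
  rw [vnorm, EuclideanSpace.norm_sq_eq]; simp [dotProduct, sq]

theorem vnorm_smul (c : ℝ) (x : ι → ℝ) : vnorm (c • x) = |c| * vnorm x := by
  simp [vnorm, norm_smul]

theorem vnorm_add_le (x y : ι → ℝ) : vnorm (x + y) ≤ vnorm x + vnorm y :=
  norm_add_le (WithLp.toLp 2 x) (WithLp.toLp 2 y)

theorem vnorm_sub_le (x y : ι → ℝ) : vnorm (x - y) ≤ vnorm x + vnorm y :=
  norm_sub_le (WithLp.toLp 2 x) (WithLp.toLp 2 y)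

theorem vnorm_neg (x : ι → ℝ) : vnorm (-x) = vnorm x := norm_neg (WithLp.toLp 2 x)

theorem vnorm_eq_zero {x : ι → ℝ} : vnorm x = 0 ↔ x = 0 := by simp [vnorm]

theorem dotProduct_le_vnorm_mul_vnorm (x y : ι → ℝ) : x ⬝ᵥ y ≤ vnorm x * vnorm y := by
  have := real_inner_le_norm (WithLp.toLp 2 y) (WithLp.toLp 2 x)
  rw [mul_comm]
  simpa [vnorm, EuclideanSpace.inner_eq_star_dotProduct] using this

theorem vnorm_mulVec_le [DecidableEq κ] (B : Matrix ι κ ℝ) (x : κ → ℝ) :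
    vnorm (B *ᵥ x) ≤ ‖B‖ * vnorm x :=
  Matrix.l2_opNorm_mulVec B (WithLp.toLp 2 x)

theorem vnorm_le_of_sq_le {x : ι → ℝ} {y : κ → ℝ} (h : x ⬝ᵥ x ≤ y ⬝ᵥ y) :
    vnorm x ≤ vnorm y := by
  rw [← vnorm_sq, ← vnorm_sq] at h
  exact le_of_sq_le_sq h (vnorm_nonneg _)

theorem dotProduct_mulVec_comm {M : Matrix ι ι ℝ} (hM : M.IsSymm) (x y : ι → ℝ) :
    (M *ᵥ x) ⬝ᵥ y = x ⬝ᵥ (M *ᵥ y) := by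
  rw [Matrix.dotProduct_mulVec, ← Matrix.mulVec_transpose, hM.eq]

theorem mulVec_dotProduct (B : Matrix ι κ ℝ) (x : κ → ℝ) (y : ι → ℝ) :
    (B *ᵥ x) ⬝ᵥ y = x ⬝ᵥ (Bᵀ *ᵥ y) := by
  rw [Matrix.dotProduct_mulVec, Matrix.vecMul_transpose]

end Norm

/-! ### Minimal residual iterates by a three-term recurrence -/

section Minres

variable {ι : Type*} [Fintype ι]

/-- State of the minimal residual recurrence: the iterate `z`, the current and the previous search
direction `p`, `p'`, their images `q`, `q'`, and the squared norm `ν` of `q'`. -/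
structure DirState (ι : Type*) where
  z : ι → ℝ
  p : ι → ℝ
  q : ι → ℝ
  p' : ι → ℝ
  q' : ι → ℝ
  ν : ℝ

/-- One step of the recurrence. -/
def dirStep (M : Matrix ι ι ℝ) (f : ι → ℝ) (s : DirState ι) : DirState ι where
  z := s.z + (f ⬝ᵥ s.q / (s.q ⬝ᵥ s.q)) • s.p
  p := s.q - ((M *ᵥ s.q) ⬝ᵥ s.q / (s.q ⬝ᵥ s.q)) • s.p - (s.q ⬝ᵥ s.q / s.ν) • s.p'
  q := M *ᵥ s.q - ((M *ᵥ s.q) ⬝ᵥ s.q / (s.q ⬝ᵥ s.q)) • s.q - (s.q ⬝ᵥ s.q / s.ν) • s.q'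
  p' := s.p
  q' := s.q
  ν := s.q ⬝ᵥ s.q

/-- The recurrence, started at `z = 0`. -/
def dirState (M : Matrix ι ι ℝ) (f : ι → ℝ) : ℕ → DirState ι
  | 0 => ⟨0, f, M *ᵥ f, 0, 0, 0⟩
  | k + 1 => dirStep M f (dirState M f k)

variable (M : Matrix ι ι ℝ) (f : ι → ℝ)

/-- Directions and images obey the same linear recurrence, so a step needs a single product with M,
that of M and q. -/
theorem dirState_q (k : ℕ) : (dirState M f k).q = M *ᵥ (dirState M f k).p ∧
    (dirState M f k).q' = M *ᵥ (dirState M f k).p' := by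
  induction k with
  | zero => simp [dirState]
  | succ k ih => simp [dirState, dirStep, Matrix.mulVec_sub, Matrix.mulVec_smul, ← ih.1, ← ih.2]

theorem dirState_recurrence (k : ℕ) : M *ᵥ (dirState M f k).q = (dirState M f (k + 1)).q +
    ((M *ᵥ (dirState M f k).q) ⬝ᵥ (dirState M f k).q /
      ((dirState M f k).q ⬝ᵥ (dirState M f k).q)) • (dirState M f k).q +
    ((dirState M f k).q ⬝ᵥ (dirState M f k).q / (dirState M f k).ν) • (dirState M f k).q' := by
  simp only [dirState, dirStep]
  abel

theorem dirState_ν (k : ℕ) :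
    (dirState M f k).ν = (dirState M f k).q' ⬝ᵥ (dirState M f k).q' := by
  cases k <;> simp [dirState, dirStep]

/-- The Lanczos argument: by symmetry M can be moved from one image onto an earlier one, and there
it only reaches the two neighbouring images. Only the last two images then need explicit
orthogonalization, and the coefficients of the step do this. -/
theorem dirState_orthogonal (hM : M.IsSymm) (k : ℕ) :
    ∀ i < k, (dirState M f k).q ⬝ᵥ (dirState M f i).q = 0 := by
  induction k using Nat.strong_induction_on with
  | _ k ih =>
  -- After breakdown the quotients are 0 / 0 = 0; this alternative keeps the orthogonality proof
  -- valid in that case too.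
  have hself : ∀ x : ι → ℝ, ∀ c : ℝ, c - c / (x ⬝ᵥ x) * (x ⬝ᵥ x) = 0 ∨ x = 0 := by
    intro x c
    by_cases hx : x ⬝ᵥ x = 0
    · exact .inr (dotProduct_self_eq_zero.1 hx)
    · left; field_simp; ring
  intro i hi
  obtain ⟨k, rfl⟩ : ∃ k', k = k' + 1 := ⟨k - 1, by omega⟩
  have hq : (dirState M f (k + 1)).q = M *ᵥ (dirState M f k).q -
    ((M *ᵥ (dirState M f k).q) ⬝ᵥ (dirState M f k).q /
      ((dirState M f k).q ⬝ᵥ (dirState M f k).q)) • (dirState M f k).q -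
    ((dirState M f k).q ⬝ᵥ (dirState M f k).q / (dirState M f k).ν) • (dirState M f k).q' := rfl
  have hprev : ∀ l ≤ k, ∀ j, (∀ i < j, (dirState M f l).q ⬝ᵥ (dirState M f i).q = 0) →
      (dirState M f l).q ⬝ᵥ (dirState M f j).q' = 0 := by
    intro l _ j h
    cases j with
    | zero => simp [dirState]
    | succ j => exact h j (by omega)
  rw [hq, sub_dotProduct, sub_dotProduct, smul_dotProduct, smul_dotProduct, smul_eq_mul,
    smul_eq_mul]
  rcases Nat.lt_succ_iff_lt_or_eq.1 hi with h | h
  · rw [ih k (by omega) i h, mul_zero, sub_zero, dotProduct_mulVec_comm hM,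
      dirState_recurrence, dotProduct_add, dotProduct_add, dotProduct_smul, dotProduct_smul,
      ih k (by omega) i h, smul_zero, add_zero,
      hprev k le_rfl i (fun j hj => ih k (by omega) j (by omega)), smul_zero, add_zero]
    rcases Nat.lt_or_ge (i + 1) k with h' | h'
    · rw [ih k (by omega) (i + 1) h', dotProduct_comm]
      obtain ⟨k, rfl⟩ : ∃ k', k = k' + 1 := ⟨k - 1, by omega⟩
      have : (dirState M f (k + 1)).q' = (dirState M f k).q := rfl
      rw [this, dotProduct_comm, ih k (by omega) i (by omega)]; simp
    · obtain rfl : k = i + 1 := by omega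
      have h1 : (dirState M f (i + 1)).q' = (dirState M f i).q := rfl
      rw [dirState_ν, h1]
      rcases hself (dirState M f i).q
        ((dirState M f (i + 1)).q ⬝ᵥ (dirState M f (i + 1)).q) with h2 | h2
      · exact h2
      -- Breakdown persists: once an image vanishes, every term of the next one does.
      · have : (dirState M f (i + 1)).q = 0 := by
          change (dirStep M f (dirState M f i)).q = 0
          simp [dirStep, h2]
        simp [this]
  · subst h
    have h1 := hprev i le_rfl i (ih i (by omega))
    rw [dotProduct_comm (dirState M f i).q' , h1, mul_zero, sub_zero]
    rcases hself (dirState M f i).q ((M *ᵥ (dirState M f i).q) ⬝ᵥ (dirState M f i).q) with h2 | h2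
    · exact h2
    · simp [h2]

theorem dirState_orthogonal_of_ne (hM : M.IsSymm) {i j : ℕ} (h : i ≠ j) :
    (dirState M f i).q ⬝ᵥ (dirState M f j).q = 0 := by
  rcases lt_or_gt_of_ne h with h | h
  · rw [dotProduct_comm]; exact dirState_orthogonal M f hM j i h
  · exact dirState_orthogonal M f hM i j h

/-- M z is the projection of f onto the span of the earlier images, built one orthogonal component
at a time. The second claim is carried along so that the coefficient computed from f agrees with the
one computed from the residual. -/
theorem dirState_z_orthogonal (hM : M.IsSymm) (k : ℕ) :
    (∀ i < k, (f - M *ᵥ (dirState M f k).z) ⬝ᵥ (dirState M f i).q = 0) ∧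
      ∀ i, k ≤ i → (M *ᵥ (dirState M f k).z) ⬝ᵥ (dirState M f i).q = 0 := by
  induction k with
  | zero => simp [dirState]
  | succ k ih =>
    have hz : M *ᵥ (dirState M f (k + 1)).z = M *ᵥ (dirState M f k).z +
        (f ⬝ᵥ (dirState M f k).q / ((dirState M f k).q ⬝ᵥ (dirState M f k).q)) •
          (dirState M f k).q := by
      rw [(dirState_q M f k).1, ← Matrix.mulVec_smul, ← Matrix.mulVec_add,
        ← (dirState_q M f k).1]; rfl
    rw [hz]
    constructor
    · intro i hi
      rw [← sub_sub, sub_dotProduct, smul_dotProduct]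
      rcases Nat.lt_succ_iff_lt_or_eq.1 hi with h | rfl
      · rw [ih.1 i h, dirState_orthogonal_of_ne M f hM h.ne']; simp
      · rw [sub_dotProduct, ih.2 i le_rfl]
        by_cases hx : (dirState M f i).q ⬝ᵥ (dirState M f i).q = 0
        · rw [dotProduct_self_eq_zero.1 hx]; simp
        · rw [smul_eq_mul]; field_simp; ring
    · intro i hi
      rw [add_dotProduct, smul_dotProduct, ih.2 i (by omega),
        dirState_orthogonal_of_ne M f hM (show k ≠ i by omega)]; simp

/-! ### Krylov spaces and optimality of the recurrence. -/

variable [DecidableEq ι]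

/-- The Krylov space of dimension at most `k`. -/
def krylov (k : ℕ) : Submodule ℝ (ι → ℝ) :=
  Submodule.span ℝ {y | ∃ j < k, y = (M ^ j) *ᵥ f}

theorem krylov_mono {k l : ℕ} (h : k ≤ l) : krylov M f k ≤ krylov M f l :=
  Submodule.span_mono fun _ ⟨j, hj, e⟩ => ⟨j, by omega, e⟩

theorem mulVec_mem_krylov {k : ℕ} {x : ι → ℝ} (hx : x ∈ krylov M f k) :
    M *ᵥ x ∈ krylov M f (k + 1) := by
  have : krylov M f k ≤ (krylov M f (k + 1)).comap M.mulVecLin := by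
    refine Submodule.span_le.2 ?_
    rintro _ ⟨j, hj, rfl⟩
    refine Submodule.subset_span ⟨j + 1, by omega, ?_⟩
    rw [Matrix.mulVecLin_apply, Matrix.mulVec_mulVec, ← pow_succ']
  exact this hx

theorem dirState_mem_krylov (k : ℕ) : (dirState M f k).z ∈ krylov M f k ∧
    (dirState M f k).p ∈ krylov M f (k + 1) ∧ (dirState M f k).p' ∈ krylov M f k := by
  induction k with
  | zero =>
    refine ⟨Submodule.zero_mem _, Submodule.subset_span ⟨0, by omega, ?_⟩, Submodule.zero_mem _⟩
    simp [dirState]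
  | succ k ih =>
    refine ⟨Submodule.add_mem _ (krylov_mono M f (by omega) ih.1) (Submodule.smul_mem _ _ ih.2.1),
      Submodule.sub_mem _ (Submodule.sub_mem _ ?_ (Submodule.smul_mem _ _ ?_))
        (Submodule.smul_mem _ _ ?_), ih.2.1⟩
    · rw [(dirState_q M f k).1]; exact mulVec_mem_krylov M f ih.2.1
    · exact krylov_mono M f (by omega) ih.2.1
    · exact krylov_mono M f (by omega) ih.2.2

/-- Solved for M p, the recurrence expresses it by the next, the current and the previous direction.
The directions thus span the Krylov space, even after breakdown. -/
theorem pow_mulVec_mem_span_dirState (k : ℕ) :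
    (M ^ k) *ᵥ f ∈ Submodule.span ℝ {y | ∃ j < k + 1, y = (dirState M f j).p} := by
  have hstep : ∀ k x, x ∈ Submodule.span ℝ {y | ∃ j < k, y = (dirState M f j).p} →
      M *ᵥ x ∈ Submodule.span ℝ {y | ∃ j < k + 1, y = (dirState M f j).p} := by
    intro k x hx
    have : Submodule.span ℝ {y | ∃ j < k, y = (dirState M f j).p} ≤
        (Submodule.span ℝ {y | ∃ j < k + 1, y = (dirState M f j).p}).comap M.mulVecLin := by
      refine Submodule.span_le.2 ?_
      rintro _ ⟨j, hj, rfl⟩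
      have hp : (dirState M f j).q = (dirState M f (j + 1)).p +
        ((M *ᵥ (dirState M f j).q) ⬝ᵥ (dirState M f j).q /
          ((dirState M f j).q ⬝ᵥ (dirState M f j).q)) • (dirState M f j).p +
        ((dirState M f j).q ⬝ᵥ (dirState M f j).q / (dirState M f j).ν) •
          (dirState M f j).p' := by
        simp only [dirState, dirStep]; abel
      rw [SetLike.mem_coe, Submodule.mem_comap, Matrix.mulVecLin_apply]
      rw [← (dirState_q M f j).1, hp]
      refine Submodule.add_mem _ (Submodule.add_mem _ (Submodule.subset_span ⟨j + 1, by omega, rfl⟩)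
        (Submodule.smul_mem _ _ (Submodule.subset_span ⟨j, by omega, rfl⟩)))
        (Submodule.smul_mem _ _ ?_)
      cases j with
      | zero => exact Submodule.zero_mem _
      | succ j => exact Submodule.subset_span ⟨j, by omega, rfl⟩
    exact this hx
  induction k with
  | zero => exact Submodule.subset_span ⟨0, by omega, by simp [dirState]⟩
  | succ k ih =>
    rw [pow_succ', ← Matrix.mulVec_mulVec]
    exact hstep _ _ ih

theorem residual_dotProduct_eq_zero (hM : M.IsSymm) {k : ℕ} {x : ι → ℝ}
    (hx : x ∈ krylov M f k) : (f - M *ᵥ (dirState M f k).z) ⬝ᵥ (M *ᵥ x) = 0 := by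
  have h1 : ∀ x ∈ Submodule.span ℝ {y | ∃ j < k, y = (dirState M f j).p},
      (f - M *ᵥ (dirState M f k).z) ⬝ᵥ (M *ᵥ x) = 0 := by
    intro x hx
    induction hx using Submodule.span_induction with
    | mem x hx =>
      obtain ⟨j, hj, rfl⟩ := hx
      rw [← (dirState_q M f j).1]
      exact (dirState_z_orthogonal M f hM k).1 j hj
    | zero => simp
    | add x y _ _ hx hy => rw [Matrix.mulVec_add, dotProduct_add, hx, hy, add_zero]
    | smul c x _ hx => rw [Matrix.mulVec_smul, dotProduct_smul, hx, smul_zero]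
  have h2 : krylov M f k ≤ Submodule.span ℝ {y | ∃ j < k, y = (dirState M f j).p} := by
    refine Submodule.span_le.2 ?_
    rintro _ ⟨j, hj, rfl⟩
    have : {y | ∃ i < j + 1, y = (dirState M f i).p} ⊆ {y | ∃ j < k, y = (dirState M f j).p} := by
      rintro _ ⟨i, hi, rfl⟩
      exact ⟨i, by omega, rfl⟩
    exact Submodule.span_mono this (pow_mulVec_mem_span_dirState M f j)
  exact h1 x (h2 hx)

/-- Pythagoras, as the residual of the computed iterate is orthogonal to the image of the Krylov
space. It yields optimality, and uniqueness when M is injective. -/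
theorem residual_sq_eq (hM : M.IsSymm) {k : ℕ} {y : ι → ℝ} (hy : y ∈ krylov M f k) :
    vnorm (M *ᵥ y - f) ^ 2 = vnorm (M *ᵥ (dirState M f k).z - f) ^ 2 +
      vnorm (M *ᵥ (y - (dirState M f k).z)) ^ 2 := by
  have h := residual_dotProduct_eq_zero M f hM
    (Submodule.sub_mem _ hy (dirState_mem_krylov M f k).1)
  have e : M *ᵥ y - f = M *ᵥ (y - (dirState M f k).z) - (f - M *ᵥ (dirState M f k).z) := by
    rw [Matrix.mulVec_sub]; abel
  have e2 : M *ᵥ (dirState M f k).z - f = -(f - M *ᵥ (dirState M f k).z) := by abel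
  rw [e2, vnorm_neg, e, vnorm_sq, vnorm_sq, vnorm_sq, sub_dotProduct, dotProduct_sub _ _
    (f - M *ᵥ (dirState M f k).z), dotProduct_sub _ _ (f - M *ᵥ (dirState M f k).z), h,
    dotProduct_comm _ (f - M *ᵥ (dirState M f k).z), h]
  ring

theorem isMinres_dirState (hM : M.IsSymm) (k : ℕ) : IsMinres M f k (dirState M f k).z := by
  refine ⟨(dirState_mem_krylov M f k).1, fun y hy => ?_⟩
  have := residual_sq_eq M f hM hy
  refine le_of_sq_le_sq ?_ (vnorm_nonneg _)
  nlinarith [sq_nonneg (vnorm (M *ᵥ (y - (dirState M f k).z)))]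

theorem existsUnique_isMinres (hM : M.IsSymm) (hinj : ∀ x, M *ᵥ x = 0 → x = 0) (k : ℕ) :
    ∃! z, IsMinres M f k z := by
  refine ⟨_, isMinres_dirState M f hM k, fun y hy => ?_⟩
  have h1 := residual_sq_eq M f hM hy.1
  have h2 := hy.2 _ (dirState_mem_krylov M f k).1
  have h3 : vnorm (M *ᵥ (y - (dirState M f k).z)) ^ 2 ≤ 0 := by
    have := pow_le_pow_left₀ (vnorm_nonneg _) h2 2
    linarith
  have h4 := vnorm_eq_zero.1 (pow_eq_zero_iff two_ne_zero |>.1 (le_antisymm h3 (sq_nonneg _)))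
  exact sub_eq_zero.1 (hinj _ h4)

/-! ### Convergence rate -/

open Polynomial in
theorem aeval_mulVec_mem_krylov {k : ℕ} (p : ℝ[X]) (hp : p.natDegree < k) :
    (aeval M p) *ᵥ f ∈ krylov M f k := by
  rw [aeval_eq_sum_range' hp, Matrix.sum_mulVec]
  refine Submodule.sum_mem _ fun j hj => ?_
  rw [Matrix.smul_mulVec]
  exact Submodule.smul_mem _ _ (Submodule.subset_span ⟨j, Finset.mem_range.1 hj, rfl⟩)

open Polynomial in
theorem dotProduct_aeval_mulVec {v : ι → ℝ} {c : ℝ} (hv : ∀ x, v ⬝ᵥ (M *ᵥ x) = c * (v ⬝ᵥ x))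
    (p : ℝ[X]) (x : ι → ℝ) : v ⬝ᵥ ((aeval M p) *ᵥ x) = p.eval c * (v ⬝ᵥ x) := by
  induction p using Polynomial.induction_on' with
  | add p q hp hq => simp [Matrix.add_mulVec, hp, hq, add_mul]
  | monomial j a =>
    have : ∀ j, v ⬝ᵥ ((M ^ j) *ᵥ x) = c ^ j * (v ⬝ᵥ x) := by
      intro j
      induction j with
      | zero => simp
      | succ j ih => rw [pow_succ', ← Matrix.mulVec_mulVec, hv, ih]; ring
    rw [aeval_monomial, eval_monomial, ← Algebra.smul_def, Matrix.smul_mulVec, dotProduct_smul,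
      this, smul_eq_mul]; ring

-- In an orthonormal eigenbasis of M, p(M) multiplies coordinates by values of p at eigenvalues. The
-- two norm bounds, tested on eigenvectors, confine these to a ≤ |c| ≤ b.
open Polynomial in
theorem vnorm_aeval_mulVec_le (hM : M.IsSymm) {a b C : ℝ} (hC : 0 ≤ C)
    (ha : ∀ x, a * vnorm x ≤ vnorm (M *ᵥ x)) (hb : ∀ x, vnorm (M *ᵥ x) ≤ b * vnorm x)
    (p : ℝ[X]) (hp : ∀ c : ℝ, a ≤ |c| → |c| ≤ b → |p.eval c| ≤ C) :
    vnorm ((aeval M p) *ᵥ f) ≤ C * vnorm f := by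
  have hH : M.IsHermitian := by rw [Matrix.IsHermitian, Matrix.conjTranspose_eq_transpose_of_trivial, hM.eq]
  have hsum : ∀ x : ι → ℝ, vnorm x ^ 2 =
      ∑ i, ((hH.eigenvectorBasis i : ι → ℝ) ⬝ᵥ x) ^ 2 := by
    intro x
    rw [vnorm, ← hH.eigenvectorBasis.sum_sq_norm_inner_right]
    refine Finset.sum_congr rfl fun i _ => ?_
    rw [EuclideanSpace.inner_eq_star_dotProduct, Real.norm_eq_abs, sq_abs, dotProduct_comm]
    simp
  have hv1 : ∀ i, vnorm (hH.eigenvectorBasis i : ι → ℝ) = 1 := fun i =>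
    hH.eigenvectorBasis.orthonormal.1 i
  refine le_of_sq_le_sq ?_ (mul_nonneg hC (vnorm_nonneg _))
  rw [mul_pow, hsum, hsum, Finset.mul_sum]
  refine Finset.sum_le_sum fun i _ => ?_
  have hMv := hH.mulVec_eigenvectorBasis i
  have habs : vnorm (M *ᵥ (hH.eigenvectorBasis i : ι → ℝ)) = |hH.eigenvalues i| := by
    rw [hMv, vnorm_smul, hv1, mul_one]
  rw [dotProduct_aeval_mulVec M (c := hH.eigenvalues i) (fun x => by
    rw [← dotProduct_mulVec_comm hM, hMv, smul_dotProduct, smul_eq_mul]), mul_pow]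
  have h1 := ha (hH.eigenvectorBasis i : ι → ℝ)
  have h2 := hb (hH.eigenvectorBasis i : ι → ℝ)
  rw [habs, hv1, mul_one] at h1 h2
  have := pow_le_pow_left₀ (abs_nonneg _) (hp _ h1 h2) 2
  rw [sq_abs] at this
  exact mul_le_mul_of_nonneg_right this (sq_nonneg _)

open Polynomial in
/-- A polynomial with value one at zero that is small on `[-b, -a] ∪ [a, b]`. -/
theorem exists_polynomial_small {a b : ℝ} (ha : 0 < a) (hab : a ≤ b) (j : ℕ) :
    ∃ p : ℝ[X], p.natDegree ≤ 2 * j ∧ p.eval 0 = 1 ∧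
      ∀ c : ℝ, a ≤ |c| → |c| ≤ b → |p.eval c| ≤ 2 * Real.exp (-(j * (a / b))) := by
  have hb : 0 < b := ha.trans_le hab
  set t := a / b with ht
  have ht0 : 0 < t := div_pos ha hb
  have ht1 : t ≤ 1 := (div_le_one hb).2 hab
  -- It guarantees that cosh t - 2c²/b² is at most 1 as soon as |c| ≥ a, because 2t² = 2a²/b².
  have hcosh : Real.cosh t - 1 ≤ 2 * t ^ 2 := by
    have h1 := Real.cosh_le_exp_half_sq t
    have h2 : |t ^ 2 / 2| ≤ 1 := by rw [abs_of_nonneg (by positivity)]; nlinarith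
    have h3 := Real.abs_exp_sub_one_le h2
    rw [abs_of_nonneg (by positivity : 0 ≤ t ^ 2 / 2)] at h3
    have := (abs_le.1 h3).2
    nlinarith
  have hc : 0 < Real.cosh (j * t) := Real.cosh_pos _
  -- A Chebyshev polynomial in c²: the values c² in [a², b²] are sent into [-1, 1], where T_j is
  -- bounded by 1, and c = 0 is sent to cosh t, where T_j equals cosh(jt) ≥ exp(jt)/2.
  refine ⟨C (Real.cosh (j * t))⁻¹ *
    (Polynomial.Chebyshev.T ℝ j).comp (C (Real.cosh t) - C (2 / b ^ 2) * X ^ 2), ?_, ?_, ?_⟩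
  · refine (natDegree_C_mul_le _ _).trans (natDegree_comp_le.trans ?_)
    rw [Polynomial.Chebyshev.natDegree_T, Int.natAbs_natCast, mul_comm]
    refine Nat.mul_le_mul_right _ ?_
    refine (natDegree_sub_le _ _).trans (max_le (by simp) ?_)
    exact natDegree_C_mul_X_pow_le _ _
  · simp only [eval_mul, eval_C, eval_comp, eval_sub, eval_pow, eval_X]
    rw [zero_pow two_ne_zero, mul_zero, sub_zero, Polynomial.Chebyshev.T_real_cosh]
    push_cast
    exact inv_mul_cancel₀ hc.ne'
  · intro c hc1 hc2
    simp only [eval_mul, eval_C, eval_comp, eval_sub, eval_pow, eval_X]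
    have hx : |Real.cosh t - 2 / b ^ 2 * c ^ 2| ≤ 1 := by
      have h1 : t ^ 2 ≤ c ^ 2 / b ^ 2 := by
        rw [ht, div_pow, ← sq_abs c]
        gcongr
      have h2 : c ^ 2 / b ^ 2 ≤ 1 := by
        rw [← sq_abs c]
        exact (div_le_one (by positivity)).2 (by gcongr)
      have h3 := Real.one_le_cosh t
      have e : 2 / b ^ 2 * c ^ 2 = 2 * (c ^ 2 / b ^ 2) := by ring
      rw [e, abs_le]
      constructor <;> linarith
    have h4 := Polynomial.Chebyshev.abs_eval_T_real_le_one j hx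
    rw [abs_mul, abs_of_pos (inv_pos.2 hc)]
    have h5 : Real.exp (j * t) / 2 ≤ Real.cosh (j * t) := by
      rw [Real.cosh_eq]
      have := Real.exp_pos (-(j * t))
      linarith
    have h6 : (Real.cosh (j * t))⁻¹ ≤ 2 * Real.exp (-(j * t)) := by
      rw [Real.exp_neg, ← div_eq_mul_inv, ← inv_div]
      exact inv_anti₀ (by positivity) h5
    calc _ ≤ (Real.cosh (j * t))⁻¹ * 1 := by gcongr
      _ ≤ _ := by rw [mul_one]; exact h6

open Polynomial in
theorem IsMinres.residual_le (hM : M.IsSymm) {a b : ℝ} (ha0 : 0 < a) (hab : a ≤ b)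
    (ha : ∀ x, a * vnorm x ≤ vnorm (M *ᵥ x)) (hb : ∀ x, vnorm (M *ᵥ x) ≤ b * vnorm x)
    {k : ℕ} {z : ι → ℝ} (hz : IsMinres M f k z) :
    vnorm (M *ᵥ z - f) ≤ 2 * Real.exp (-(((k / 2 : ℕ) : ℝ) * (a / b))) * vnorm f := by
  obtain ⟨p, hdeg, hp0, hp⟩ := exists_polynomial_small ha0 hab (k / 2)
  -- As p(0) = 1, the vector -(p.divX)(M) f is a competitor in the Krylov space, and its residual is
  -- -p(M) f.
  have hsplit : p = 1 + X * p.divX := by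
    have := divX_mul_X_add p
    rw [coeff_zero_eq_eval_zero, hp0, map_one] at this
    conv_lhs => rw [← this]
    ring
  by_cases hk : p.divX.natDegree < k
  · have hmem : -((aeval M p.divX) *ᵥ f) ∈ krylov M f k :=
      Submodule.neg_mem _ (aeval_mulVec_mem_krylov M f _ hk)
    refine (hz.2 _ hmem).trans ?_
    have e : M *ᵥ (-((aeval M p.divX) *ᵥ f)) - f = -((aeval M p) *ᵥ f) := by
      conv_rhs => rw [hsplit]
      simp only [map_add, map_one, map_mul, aeval_X, Matrix.add_mulVec, Matrix.one_mulVec,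
        Matrix.mulVec_neg, Matrix.mulVec_mulVec]
      abel
    rw [e, vnorm_neg]
    exact vnorm_aeval_mulVec_le M f hM (by positivity) ha hb p hp
  -- The degree of p is at most 2⌊k/2⌋ ≤ k, so the division by X fails to bring it below k only when
  -- k = 0.
  · rw [natDegree_divX_eq_natDegree_tsub_one] at hk
    obtain rfl : k = 0 := by omega
    have h0 := hz.2 0 (Submodule.zero_mem _)
    rw [Matrix.mulVec_zero, zero_sub, vnorm_neg] at h0
    have := vnorm_nonneg f
    simp
    linarith

end Minres

/-! ### Square roots and quadratic forms -/

section Spectral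

variable {ι κ : Type*} [Fintype ι] [DecidableEq ι] [Fintype κ] [DecidableEq κ]

theorem msqrt_mul_self {H : Matrix ι ι ℝ} (h : H.PosSemidef) : msqrt H * msqrt H = H :=
  CFC.sqrt_mul_sqrt_self H h.nonneg

theorem msqrt_posSemidef (H : Matrix ι ι ℝ) : (msqrt H).PosSemidef :=
  Matrix.nonneg_iff_posSemidef.1 (CFC.sqrt_nonneg H)

theorem msqrt_transpose (H : Matrix ι ι ℝ) : (msqrt H)ᵀ = msqrt H := by
  have := (msqrt_posSemidef H).isHermitian.eq
  rwa [Matrix.conjTranspose_eq_transpose_of_trivial] at this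

theorem isUnit_msqrt {H : Matrix ι ι ℝ} (h : H.PosDef) : IsUnit (msqrt H) := by
  have h1 : IsUnit (msqrt H * msqrt H) := by rw [msqrt_mul_self h.posSemidef]; exact h.isUnit
  exact isUnit_of_mul_isUnit_left h1

theorem dotProduct_mulVec_le_norm (B : Matrix ι ι ℝ) (x : ι → ℝ) :
    x ⬝ᵥ (B *ᵥ x) ≤ ‖B‖ * (x ⬝ᵥ x) := by
  have h1 := dotProduct_le_vnorm_mul_vnorm x (B *ᵥ x)
  have h2 := mul_le_mul_of_nonneg_left (vnorm_mulVec_le B x) (vnorm_nonneg x)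
  rw [← vnorm_sq]; linarith

theorem neg_norm_le_dotProduct_mulVec (B : Matrix ι ι ℝ) (x : ι → ℝ) :
    -(‖B‖ * (x ⬝ᵥ x)) ≤ x ⬝ᵥ (B *ᵥ x) := by
  have h := dotProduct_mulVec_le_norm (-B) x
  rw [norm_neg, Matrix.neg_mulVec, dotProduct_neg] at h
  linarith

theorem norm_le_of_vnorm_mulVec_le {ι κ : Type*} [Fintype ι] [Fintype κ] [DecidableEq κ]
    {B : Matrix ι κ ℝ} {c : ℝ} (hc : 0 ≤ c)
    (h : ∀ x, vnorm (B *ᵥ x) ≤ c * vnorm x) : ‖B‖ ≤ c := by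
  rw [Matrix.l2_opNorm_def]
  exact ContinuousLinearMap.opNorm_le_bound _ hc fun x => h x.ofLp

theorem norm_transpose (B : Matrix ι κ ℝ) : ‖Bᵀ‖ = ‖B‖ := by
  rw [← Matrix.conjTranspose_eq_transpose_of_trivial, Matrix.l2_opNorm_conjTranspose]

theorem norm_mul_transpose_self (B : Matrix ι κ ℝ) : ‖B * Bᵀ‖ = ‖B‖ ^ 2 := by
  have := Matrix.l2_opNorm_conjTranspose_mul_self Bᵀ
  rwa [Matrix.conjTranspose_eq_transpose_of_trivial, Matrix.transpose_transpose,
    norm_transpose, ← sq] at this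

/-- The inverse of a symmetric matrix `R` with `R² ≥ θ²` is at most `θ⁻¹`. -/
theorem dotProduct_inv_mulVec_le {R : Matrix ι ι ℝ} (hR : R.IsSymm) (hU : IsUnit R) {θ : ℝ}
    (hθ : 0 < θ) (h : ∀ x, θ ^ 2 * (x ⬝ᵥ x) ≤ x ⬝ᵥ ((R * R) *ᵥ x)) (y : ι → ℝ) :
    θ * (y ⬝ᵥ (R⁻¹ *ᵥ y)) ≤ y ⬝ᵥ y := by
  set x := R⁻¹ *ᵥ y
  have hy : R *ᵥ x = y := by
    rw [Matrix.mulVec_mulVec, Matrix.mul_nonsing_inv _ ((Matrix.isUnit_iff_isUnit_det _).1 hU),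
      Matrix.one_mulVec]
  have h1 := h x
  rw [← Matrix.mulVec_mulVec, ← dotProduct_mulVec_comm hR, hy, ← vnorm_sq, ← vnorm_sq,
    ← mul_pow] at h1
  -- For x = R⁻¹ y this reads θ|x| ≤ |y|; Cauchy–Schwarz for y and x finishes.
  have h2 := le_of_sq_le_sq h1 (vnorm_nonneg y)
  have h3 := dotProduct_le_vnorm_mul_vnorm y x
  have h4 := mul_le_mul_of_nonneg_left h2 (vnorm_nonneg y)
  rw [← vnorm_sq]
  nlinarith

end Spectral

/-! ### Eigenvalue bounds for the Nesterov–Todd scaling point. -/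

section Scaling

variable {n r : ℕ} {W X S Xs Ss P : Matrix (Fin n) (Fin n) ℝ} {w : Fin n → ℝ} {μ L δ χ₁ : ℝ}

/-- Centering forces X^(1/2) S X^(1/2) ≥ (1-δ)μ, so its inverse square root is at most
((1-δ)μ)^(-1/2). Congruence with X^(1/2) turns the latter into W and the identity into X. -/
theorem CenteredScaling.dotProduct_le (h : CenteredScaling W X S Xs Ss μ L δ χ₁) (hμ : 0 < μ)
    (hδ : δ < 1) (x : Fin n → ℝ) :
    √((1 - δ) * μ) * (x ⬝ᵥ (W *ᵥ x)) ≤ x ⬝ᵥ (X *ᵥ x) := by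
  have hθ : 0 < (1 - δ) * μ := mul_pos (by linarith) hμ
  set B := msqrt X with hB
  have hBT : Bᵀ = B := msqrt_transpose X
  have hT : (B * S * B).PosDef := by
    have := h.posDef_S.conjTranspose_mul_mul_same (B := B)
      (Matrix.mulVec_injective_of_isUnit (isUnit_msqrt h.posDef_X))
    rwa [Matrix.conjTranspose_eq_transpose_of_trivial, hBT] at this
  have key : ∀ y, √((1 - δ) * μ) * (y ⬝ᵥ ((msqrt (B * S * B))⁻¹ *ᵥ y)) ≤ y ⬝ᵥ y := by
    refine dotProduct_inv_mulVec_le (msqrt_transpose _) (isUnit_msqrt hT) (Real.sqrt_pos.2 hθ)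
      fun y => ?_
    rw [Real.sq_sqrt hθ.le, msqrt_mul_self hT.posSemidef]
    have h1 := neg_norm_le_dotProduct_mulVec ((1 / μ) • (B * S * B) - 1) y
    have h2 := mul_le_mul_of_nonneg_right h.centered (vnorm_sq y ▸ sq_nonneg (vnorm y))
    rw [Matrix.sub_mulVec, Matrix.one_mulVec, dotProduct_sub, Matrix.smul_mulVec,
      dotProduct_smul, smul_eq_mul] at h1
    have h3 : (1 - δ) * (y ⬝ᵥ y) ≤ 1 / μ * (y ⬝ᵥ ((B * S * B) *ᵥ y)) := by linarith
    rw [one_div, inv_mul_eq_div, le_div_iff₀ hμ] at h3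
    linarith
  have := key (B *ᵥ x)
  have e1 : (B *ᵥ x) ⬝ᵥ (B *ᵥ x) = x ⬝ᵥ (X *ᵥ x) := by
    rw [dotProduct_mulVec_comm hBT, Matrix.mulVec_mulVec, msqrt_mul_self h.posDef_X.posSemidef]
  have e2 : (B *ᵥ x) ⬝ᵥ ((msqrt (B * S * B))⁻¹ *ᵥ (B *ᵥ x)) = x ⬝ᵥ (W *ᵥ x) := by
    rw [dotProduct_mulVec_comm hBT, Matrix.mulVec_mulVec, Matrix.mulVec_mulVec, h.scaling,
      Matrix.mul_assoc]
  rwa [e1, e2] at this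

theorem CenteredScaling.mul_mul_eq (h : CenteredScaling W X S Xs Ss μ L δ χ₁) :
    W * S * W = X := by
  set B := msqrt X with hB
  have hBT : Bᵀ = B := msqrt_transpose X
  have hT : (B * S * B).PosDef := by
    have := h.posDef_S.conjTranspose_mul_mul_same (B := B)
      (Matrix.mulVec_injective_of_isUnit (isUnit_msqrt h.posDef_X))
    rwa [Matrix.conjTranspose_eq_transpose_of_trivial, hBT] at this
  have hu := (Matrix.isUnit_iff_isUnit_det _).1 (isUnit_msqrt hT)
  set R := msqrt (B * S * B) with hR
  have hRR : R * R = B * S * B := msqrt_mul_self hT.posSemidef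
  have e : W = B * R⁻¹ * B := h.scaling
  calc W * S * W = B * R⁻¹ * (B * S * B) * R⁻¹ * B := by rw [e]; simp only [Matrix.mul_assoc]
    _ = B * (R⁻¹ * R) * (R * R⁻¹) * B := by rw [← hRR]; simp only [Matrix.mul_assoc]
    _ = X := by
      rw [Matrix.nonsing_inv_mul _ hu, Matrix.mul_nonsing_inv _ hu, Matrix.mul_one, Matrix.mul_one,
        msqrt_mul_self h.posDef_X.posSemidef]

theorem IsEigendecomp.mulVec_col (h : IsEigendecomp W P w) (i : Fin n) :
    W *ᵥ (P *ᵥ Pi.single i 1) = w i • (P *ᵥ Pi.single i 1) := by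
  rw [h.eq, Matrix.mulVec_mulVec, Matrix.mul_assoc, h.orth, Matrix.mul_one,
    ← Matrix.mulVec_mulVec, ← Matrix.mulVec_smul]
  congr 1
  ext j
  simp [Pi.single_apply, eq_comm]

theorem dotProduct_mulVec_of_orth (h : Pᵀ * P = 1) (x y : Fin n → ℝ) :
    (P *ᵥ x) ⬝ᵥ (P *ᵥ y) = x ⬝ᵥ y := by
  rw [mulVec_dotProduct, Matrix.mulVec_mulVec, h, Matrix.one_mulVec]

theorem IsEigendecomp.dotProduct_mulVec (h : IsEigendecomp W P w) (x : Fin n → ℝ) :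
    (P *ᵥ x) ⬝ᵥ (W *ᵥ (P *ᵥ x)) = ∑ i, w i * x i ^ 2 := by
  rw [h.eq, Matrix.mulVec_mulVec, Matrix.mul_assoc, h.orth, Matrix.mul_one,
    ← Matrix.mulVec_mulVec, dotProduct_mulVec_of_orth h.orth, dotProduct]
  refine Finset.sum_congr rfl fun i _ => ?_
  rw [Matrix.mulVec_diagonal]; ring

theorem IsEigendecomp.pos (h : IsEigendecomp W P w) (hW : W.PosDef) (i : Fin n) : 0 < w i := by
  have hx : P *ᵥ Pi.single i 1 ≠ 0 := by
    intro e
    have := dotProduct_mulVec_of_orth h.orth (Pi.single i 1) (Pi.single i 1)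
    rw [e] at this
    simp at this
  have := hW.dotProduct_mulVec_pos hx
  rw [star_trivial, h.mulVec_col, dotProduct_smul, dotProduct_mulVec_of_orth h.orth] at this
  simpa using this

theorem CenteredScaling.posDef (h : CenteredScaling W X S Xs Ss μ L δ χ₁) : W.PosDef := by
  have hBT : (msqrt X)ᵀ = msqrt X := msqrt_transpose X
  have hT : (msqrt X * S * msqrt X).PosDef := by
    have := h.posDef_S.conjTranspose_mul_mul_same (B := msqrt X)
      (Matrix.mulVec_injective_of_isUnit (isUnit_msqrt h.posDef_X))
    rwa [Matrix.conjTranspose_eq_transpose_of_trivial, hBT] at this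
  have hR : (msqrt (msqrt X * S * msqrt X)).PosDef :=
    (msqrt_posSemidef _).posDef_iff_isUnit.2 (isUnit_msqrt hT)
  have := hR.inv.conjTranspose_mul_mul_same (B := msqrt X)
      (Matrix.mulVec_injective_of_isUnit (isUnit_msqrt h.posDef_X))
  rwa [Matrix.conjTranspose_eq_transpose_of_trivial, hBT, ← h.scaling] at this

/-- At a unit eigenvector x of W, the identity W S W = X gives ⟨x, X x⟩ = w² ⟨x, S x⟩, and S ≤ 1 + L
because S⋆ ≤ 1. Comparison with √((1-δ)μ) W ≤ X leaves a bound linear in w after division by w > 0.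
-/
theorem CenteredScaling.le_eigenvalue (h : CenteredScaling W X S Xs Ss μ L δ χ₁)
    (he : IsEigendecomp W P w) (hμ : 0 < μ) (hδ : δ < 1) (i : Fin n) :
    √((1 - δ) * μ) ≤ (1 + L) * w i := by
  have hw := he.pos h.posDef i
  set x := P *ᵥ Pi.single i 1 with hx
  have hxx : x ⬝ᵥ x = 1 := by
    rw [hx, dotProduct_mulVec_of_orth he.orth]; simp
  have hWx : W *ᵥ x = w i • x := he.mulVec_col i
  have hWsymm : W.IsSymm := by
    have := h.posDef.isHermitian.eq
    rwa [Matrix.conjTranspose_eq_transpose_of_trivial] at this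
  have h1 := h.dotProduct_le hμ hδ x
  have h2 : x ⬝ᵥ (X *ᵥ x) = w i ^ 2 * (x ⬝ᵥ (S *ᵥ x)) := by
    rw [← h.mul_mul_eq, ← Matrix.mulVec_mulVec, ← Matrix.mulVec_mulVec,
      ← dotProduct_mulVec_comm hWsymm, hWx, Matrix.mulVec_smul, smul_dotProduct, dotProduct_smul]
    simp only [smul_eq_mul]; ring
  have h3 : x ⬝ᵥ (S *ᵥ x) ≤ 1 + L := by
    have a1 := dotProduct_mulVec_le_norm (S - Ss) x
    have a2 := h.strict_upper.dotProduct_mulVec_nonneg x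
    have a3 := h.posSemidef_Xs.dotProduct_mulVec_nonneg x
    have a4 := h.dist_S
    rw [star_trivial] at a2 a3
    rw [Matrix.sub_mulVec, dotProduct_sub] at a1 a2
    rw [Matrix.one_mulVec, Matrix.add_mulVec, dotProduct_add] at a2
    rw [hxx] at a1 a2
    linarith
  rw [h2, hWx, dotProduct_smul, hxx, smul_eq_mul, mul_one] at h1
  have h4 : w i * √((1 - δ) * μ) ≤ w i * ((1 + L) * w i) := by nlinarith
  exact le_of_mul_le_mul_left h4 hw

theorem exists_mulVec_eq_zero_of_rank_lt {l k : ℕ} (B : Matrix (Fin l) (Fin k) ℝ)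
    (h : B.rank < k) : ∃ a : Fin k → ℝ, a ≠ 0 ∧ B *ᵥ a = 0 := by
  have h1 := LinearMap.finrank_range_add_finrank_ker B.mulVecLin
  rw [Module.finrank_fin_fun] at h1
  have h2 : LinearMap.ker B.mulVecLin ≠ ⊥ := by
    intro e
    rw [e, finrank_bot] at h1
    have : B.rank = Module.finrank ℝ (LinearMap.range B.mulVecLin) := rfl
    omega
  obtain ⟨a, ha, hne⟩ := Submodule.exists_mem_ne_zero_of_ne_bot h2
  exact ⟨a, hne, ha⟩

/-- On the kernel of X⋆, the quadratic forms of X and X - X⋆ agree, and the latter has norm at most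
L μ. -/
theorem CenteredScaling.dotProduct_le_of_mulVec_eq_zero
    (h : CenteredScaling W X S Xs Ss μ L δ χ₁) (hμ : 0 < μ) (hδ : δ < 1) {x : Fin n → ℝ}
    (hx : Xs *ᵥ x = 0) :
    √((1 - δ) * μ) * (x ⬝ᵥ (W *ᵥ x)) ≤ L * μ * (x ⬝ᵥ x) := by
  have h1 := h.dotProduct_le hμ hδ x
  have h2 := dotProduct_mulVec_le_norm (X - Xs) x
  have h3 := mul_le_mul_of_nonneg_right h.dist_X (vnorm_sq x ▸ sq_nonneg (vnorm x))
  rw [Matrix.sub_mulVec, hx, sub_zero] at h2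
  linarith

/-- The Courant–Fischer argument: the span of the top r + 1 eigenvectors meets the kernel of X⋆,
whose rank is at most r, and every vector of that span has Rayleigh quotient at least λ_{r+1}(W). -/
theorem CenteredScaling.eigenvalue_le (h : CenteredScaling W X S Xs Ss μ L δ χ₁)
    (he : IsEigendecomp W P w) (hμ : 0 < μ) (hδ : δ < 1) (hr : r < n) (hrank : Xs.rank ≤ r) :
    √((1 - δ) * μ) * w ⟨r, hr⟩ ≤ L * μ := by
  -- The inclusion of the first r + 1 coordinates, so that P * J spans the top r + 1 eigenvectors.
  set J : Matrix (Fin n) (Fin (r + 1)) ℝ :=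
    (1 : Matrix (Fin n) (Fin n) ℝ).submatrix id (Fin.castLE hr) with hJ
  obtain ⟨a, ha, hz⟩ := exists_mulVec_eq_zero_of_rank_lt (Xs * (P * J))
    ((Matrix.rank_mul_le_left _ _).trans_lt (by omega))
  rw [← Matrix.mulVec_mulVec, ← Matrix.mulVec_mulVec] at hz
  have h1 := h.dotProduct_le_of_mulVec_eq_zero hμ hδ hz
  rw [he.dotProduct_mulVec, dotProduct_mulVec_of_orth he.orth] at h1
  set x := J *ᵥ a with hx
  have hJa : ∀ i : Fin n, (r : ℕ) < i → x i = 0 := by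
    intro i hi
    rw [hx, Matrix.mulVec, dotProduct]
    refine Finset.sum_eq_zero fun k _ => ?_
    rw [hJ, Matrix.submatrix_apply, id, Matrix.one_apply_ne, zero_mul]
    intro e; rw [e, Fin.val_castLE] at hi; omega
  have hxne : 0 < x ⬝ᵥ x := by
    rw [← vnorm_sq]
    refine pow_pos (lt_of_le_of_ne (vnorm_nonneg _) fun e => ha ?_) 2
    have e0 := vnorm_eq_zero.1 e.symm
    ext k
    have := congrFun e0 (Fin.castLE hr k)
    rw [hx, Matrix.mulVec, dotProduct] at this
    simpa [hJ, Matrix.one_apply, (Fin.castLE_injective hr).eq_iff] using this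
  have h2 : w ⟨r, hr⟩ * (x ⬝ᵥ x) ≤ ∑ i, w i * x i ^ 2 := by
    rw [dotProduct, Finset.mul_sum]
    refine Finset.sum_le_sum fun i _ => ?_
    rcases lt_or_ge (r : ℕ) i with hi | hi
    · rw [hJa i hi]; simp
    · have : w ⟨r, hr⟩ ≤ w i := he.antitone (by rw [Fin.le_def]; exact hi)
      rw [← sq]
      exact mul_le_mul_of_nonneg_right this (sq_nonneg _)
  have h3 := mul_le_mul_of_nonneg_left h2 (Real.sqrt_nonneg ((1 - δ) * μ))
  refine le_of_mul_le_mul_right ?_ hxne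
  linarith

end Scaling

/-! ### The tangent space -/

section Tangent

variable {m n r : ℕ}

theorem vnorm_svec {X : Matrix (Fin n) (Fin n) ℝ} (h : X.IsSymm) : vnorm (svec X) = frob X := by
  have e := dotProduct_vec_smat (svec X) (svec X)
  rw [smat_svec_of_isSymm h] at e
  rw [frob]
  exact le_antisymm (vnorm_le_of_sq_le e.ge) (vnorm_le_of_sq_le e.le)

theorem frob_smat (x : SIdx n → ℝ) : frob (smat x) = vnorm x := by
  rw [← vnorm_svec (smat_isSymm x), svec_smat]

theorem frob_nonneg {p q : ℕ} (X : Matrix (Fin p) (Fin q) ℝ) : 0 ≤ frob X := vnorm_nonneg _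

theorem frob_sq {p q : ℕ} (X : Matrix (Fin p) (Fin q) ℝ) : frob X ^ 2 = ∑ j, ∑ i, X i j ^ 2 := by
  rw [frob, vnorm_sq, dotProduct, Fintype.sum_prod_type]
  simp only [Matrix.vec, sq]

theorem frob_transpose {p q : ℕ} (X : Matrix (Fin p) (Fin q) ℝ) : frob Xᵀ = frob X := by
  have : frob Xᵀ ^ 2 = frob X ^ 2 := by
    rw [frob_sq, frob_sq, Finset.sum_comm]; rfl
  exact (pow_left_inj₀ (frob_nonneg _) (frob_nonneg _) two_ne_zero).1 this

theorem frob_mul_le {p q l : ℕ} (B : Matrix (Fin p) (Fin q) ℝ) (X : Matrix (Fin q) (Fin l) ℝ) :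
    frob (B * X) ≤ ‖B‖ * frob X := by
  refine le_of_sq_le_sq ?_ (mul_nonneg (norm_nonneg _) (frob_nonneg _))
  rw [mul_pow, frob_sq, frob_sq, Finset.mul_sum]
  refine Finset.sum_le_sum fun j _ => ?_
  have h := pow_le_pow_left₀ (vnorm_nonneg _) (vnorm_mulVec_le B fun i => X i j) 2
  rw [mul_pow, vnorm_sq, vnorm_sq, dotProduct, dotProduct] at h
  simpa only [Matrix.mul_apply, Matrix.mulVec, dotProduct, sq] using h

theorem frob_mul_mul_transpose_le {p q : ℕ} (B : Matrix (Fin p) (Fin q) ℝ)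
    (X : Matrix (Fin q) (Fin q) ℝ) : frob (B * X * Bᵀ) ≤ ‖B‖ ^ 2 * frob X := by
  have h1 := frob_mul_le B (B * X)ᵀ
  have h2 := frob_mul_le B X
  rw [frob_transpose] at h1
  have h3 := mul_le_mul_of_nonneg_left h2 (norm_nonneg B)
  have e : B * X * Bᵀ = (B * (B * X)ᵀ)ᵀ := by
    rw [Matrix.transpose_mul, Matrix.transpose_transpose]
  rw [e, frob_transpose]
  linarith

theorem posDef_mul_transpose {A : Matrix (Fin m) (SIdx n) ℝ} (hA : LinearIndependent ℝ A.row) :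
    (A * Aᵀ).PosDef := by
  refine Matrix.PosDef.of_dotProduct_mulVec_pos ?_ fun x hx => ?_
  · rw [Matrix.IsHermitian, Matrix.conjTranspose_eq_transpose_of_trivial, Matrix.transpose_mul,
      Matrix.transpose_transpose]
  · rw [star_trivial, ← Matrix.mulVec_mulVec, dotProduct_comm, mulVec_dotProduct, ← vnorm_sq]
    refine pow_pos (lt_of_le_of_ne (vnorm_nonneg _) fun e => hx ?_) 2
    have e0 := vnorm_eq_zero.1 e.symm
    rw [Matrix.mulVec_transpose] at e0
    exact Matrix.vecMul_injective_iff.2 hA (e0.trans (Matrix.zero_vecMul A).symm)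

theorem msqrt_inv_mul_mul_transpose {A : Matrix (Fin m) (SIdx n) ℝ}
    (hA : LinearIndependent ℝ A.row) :
    ((msqrt (A * Aᵀ))⁻¹ * A) * ((msqrt (A * Aᵀ))⁻¹ * A)ᵀ = 1 := by
  have h := posDef_mul_transpose hA
  have hu := (Matrix.isUnit_iff_isUnit_det _).1 (isUnit_msqrt h)
  have hsq := msqrt_mul_self h.posSemidef
  set R := msqrt (A * Aᵀ) with hR
  have hT : (R⁻¹)ᵀ = R⁻¹ := by rw [Matrix.transpose_nonsing_inv, hR, msqrt_transpose]
  calc R⁻¹ * A * (R⁻¹ * A)ᵀ = R⁻¹ * (A * Aᵀ) * R⁻¹ := by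
        rw [Matrix.transpose_mul, hT]; simp only [Matrix.mul_assoc]
    _ = R⁻¹ * R * (R * R⁻¹) := by rw [← hsq]; simp only [Matrix.mul_assoc]
    _ = 1 := by rw [Matrix.nonsing_inv_mul _ hu, Matrix.mul_nonsing_inv _ hu, Matrix.one_mul]

/-- The transpose is an isometry, hence |Bx|² = ⟨x, Bᵀ B x⟩ ≤ |x| |Bx|. -/
theorem vnorm_mulVec_le_of_mul_transpose_eq_one {ι κ : Type*} [Fintype ι] [DecidableEq ι]
    [Fintype κ] {B : Matrix ι κ ℝ} (hB : B * Bᵀ = 1) (x : κ → ℝ) :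
    vnorm (B *ᵥ x) ≤ vnorm x := by
  have h1 : vnorm (Bᵀ *ᵥ (B *ᵥ x)) = vnorm (B *ᵥ x) := by
    have : vnorm (Bᵀ *ᵥ (B *ᵥ x)) ^ 2 = vnorm (B *ᵥ x) ^ 2 := by
      rw [vnorm_sq, mulVec_dotProduct, Matrix.transpose_transpose, Matrix.mulVec_mulVec, hB,
        Matrix.one_mulVec, vnorm_sq]
    exact (pow_left_inj₀ (vnorm_nonneg _) (vnorm_nonneg _) two_ne_zero).1 this
  have h2 := dotProduct_le_vnorm_mul_vnorm x (Bᵀ *ᵥ (B *ᵥ x))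
  rw [h1, ← mulVec_dotProduct, ← vnorm_sq] at h2
  rcases (vnorm_nonneg (B *ᵥ x)).eq_or_lt with h | h
  · rw [← h]; exact vnorm_nonneg x
  · exact le_of_mul_le_mul_right (by linarith) h

theorem isUnit_transpose_mul_self_of_rank {k : ℕ} {U : Matrix (Fin n) (Fin k) ℝ}
    (h : U.rank = k) : IsUnit (Uᵀ * U) := by
  rw [← Matrix.mulVec_surjective_iff_isUnit]
  have h1 : (Uᵀ * U).rank = k := by rw [Matrix.rank_transpose_mul_self, h]
  have h2 : LinearMap.range (Uᵀ * U).mulVecLin = ⊤ :=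
    Submodule.eq_top_of_finrank_eq (by rw [Module.finrank_fin_fun]; exact h1)
  exact LinearMap.range_eq_top.1 h2

/-- Tangent space injectivity controls a symmetric matrix by its image and its compression to the
kernel of `X⋆`. -/
theorem TangentInjective.frob_le {A : Matrix (Fin m) (SIdx n) ℝ}
    {Xs : Matrix (Fin n) (Fin n) ℝ} {χ₂ : ℝ} (h : TangentInjective A Xs χ₂)
    (hA : LinearIndependent ℝ A.row) :
    ∃ N : Matrix (Fin n) (Fin n) ℝ, Nᵀ = N ∧ N * N = N ∧ Xs * N = 0 ∧
      ∀ H : Matrix (Fin n) (Fin n) ℝ, H.IsSymm →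
        frob H ≤ χ₂ * (vnorm (((msqrt (A * Aᵀ))⁻¹ * A) *ᵥ svec H) + 2 * frob (N * H * N)) := by
  obtain ⟨hχ, U, hU, hV⟩ := h
  -- The factor U has as many columns as its rank, which makes Uᵀ U invertible.
  have hrank : U.rank = Xs.rank := by
    conv_rhs => rw [hU]
    rw [Matrix.rank_self_mul_transpose]
  have hG := (Matrix.isUnit_iff_isUnit_det _).1 (isUnit_transpose_mul_self_of_rank hrank)
  set G := Uᵀ * U with hGdef
  set K := G⁻¹ * Uᵀ with hK
  have hGT : (G⁻¹)ᵀ = G⁻¹ := by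
    rw [Matrix.transpose_nonsing_inv, hGdef, Matrix.transpose_mul, Matrix.transpose_transpose]
  -- R = U (Uᵀ U)⁻¹ Uᵀ is the orthogonal projection onto the range of X⋆; the witness 1 - R projects
  -- onto its kernel.
  set R := U * K with hR
  have hRT : Rᵀ = R := by
    rw [hR, hK, Matrix.transpose_mul, Matrix.transpose_mul, hGT, Matrix.transpose_transpose,
      Matrix.mul_assoc]
  have hUR : Uᵀ * R = Uᵀ := by
    rw [hR, hK, ← Matrix.mul_assoc, ← Matrix.mul_assoc, ← hGdef, Matrix.mul_nonsing_inv _ hG,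
      Matrix.one_mul]
  have hRR : R * R = R := by
    conv_lhs => rw [hR, hK, Matrix.mul_assoc, Matrix.mul_assoc, hUR]
  refine ⟨1 - R, by rw [Matrix.transpose_sub, Matrix.transpose_one, hRT], ?_, ?_, fun H hH => ?_⟩
  · simp only [Matrix.sub_mul, Matrix.mul_sub, hRR, Matrix.one_mul, Matrix.mul_one, sub_self,
      sub_zero]
  · rw [hU, Matrix.mul_assoc, Matrix.mul_sub, hUR, Matrix.mul_one, sub_self,
      Matrix.mul_zero]
  -- This choice makes U Vᵀ + V Uᵀ equal to H minus its compression to the kernel. The factor 1/2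
  -- shares R H R between the two summands.
  set V : Matrix (Fin n) (Fin Xs.rank) ℝ := (K * H - (1 / 2 : ℝ) • (K * H * R))ᵀ with hVd
  have hT : U * Vᵀ + V * Uᵀ = R * H + H * R - R * H * R := by
    have e1 : U * Vᵀ = R * H - (1 / 2 : ℝ) • (R * H * R) := by
      rw [hVd, Matrix.transpose_transpose, Matrix.mul_sub, Matrix.mul_smul, hR]
      simp only [Matrix.mul_assoc]
    have e2 : V * Uᵀ = H * R - (1 / 2 : ℝ) • (R * H * R) := by
      have : V * Uᵀ = (U * Vᵀ)ᵀ := by rw [Matrix.transpose_mul, Matrix.transpose_transpose]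
      rw [this, e1]
      simp only [Matrix.transpose_sub, Matrix.transpose_smul, Matrix.transpose_mul, hRT, hH.eq,
        Matrix.mul_assoc]
    rw [e1, e2]
    have : (1 / 2 : ℝ) • (R * H * R) + (1 / 2 : ℝ) • (R * H * R) = R * H * R := by
      rw [← add_smul]; norm_num
    rw [sub_add_sub_comm, this]
  set T := R * H + H * R - R * H * R with hTd
  set F := (1 - R) * H * (1 - R) with hFd
  have hsplit : H = T + F := by
    rw [hTd, hFd]
    simp only [Matrix.sub_mul, Matrix.mul_sub, Matrix.one_mul, Matrix.mul_one]
    abel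
  have hFsymm : F.IsSymm := by
    rw [Matrix.IsSymm, hFd]
    simp only [Matrix.transpose_mul, Matrix.transpose_sub, Matrix.transpose_one, hRT, hH.eq,
      Matrix.mul_assoc]
  set B := (msqrt (A * Aᵀ))⁻¹ * A with hB
  have h1 : χ₂⁻¹ * frob T ≤ vnorm (B *ᵥ svec T) := by
    have := hV V
    rwa [hT] at this
  have h2 : vnorm (B *ᵥ svec F) ≤ frob F := by
    rw [← vnorm_svec hFsymm]
    exact vnorm_mulVec_le_of_mul_transpose_eq_one (msqrt_inv_mul_mul_transpose hA) _
  have h3 : vnorm (B *ᵥ svec T) ≤ vnorm (B *ᵥ svec H) + vnorm (B *ᵥ svec F) := by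
    have e : B *ᵥ svec T = B *ᵥ svec H - B *ᵥ svec F := by
      conv_rhs => rw [hsplit, svec_add, Matrix.mulVec_add]
      abel
    rw [e]; exact vnorm_sub_le _ _
  have h4 : frob H ≤ frob T + frob F := by
    conv_lhs => rw [hsplit]
    rw [frob, Matrix.vec_add]; exact vnorm_add_le _ _
  have hχ0 : 0 < χ₂ := by linarith
  rw [inv_mul_le_iff₀ hχ0] at h1
  -- The compression occurs twice, once in splitting the Frobenius norm and once in passing from T
  -- to H inside the image; χ₂ ≥ 1 merges both into the term 2 * χ₂ * frob F.
  have h5 := mul_le_mul_of_nonneg_left (h3.trans (add_le_add_right h2 _)) hχ0.le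
  have h6 := mul_le_mul_of_nonneg_right hχ (frob_nonneg F)
  linarith

end Tangent

/-! ### Extension by zero of the second block -/

section Extension

variable {n r : ℕ}

/-- Extension by zero to the whole lower triangle. -/
def vext (hr : r < n) (v : VIdx n r → ℝ) : SIdx n → ℝ := Function.extend (vemb hr) v 0

theorem vext_vemb (hr : r < n) (v : VIdx n r → ℝ) (q : VIdx n r) :
    vext hr v (vemb hr q) = v q := (vemb_injective hr).extend_apply _ _ _

theorem vext_of_notMem_range (hr : r < n) (v : VIdx n r → ℝ) {p : SIdx n}
    (hp : p ∉ Set.range (vemb hr)) : vext hr v p = 0 := Function.extend_apply' _ _ _ hp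

theorem sum_vemb (hr : r < n) {f : SIdx n → ℝ} {g : VIdx n r → ℝ}
    (hf : ∀ p, p ∉ Set.range (vemb hr) → f p = 0) (hfg : ∀ q, f (vemb hr q) = g q) :
    ∑ p, f p = ∑ q, g q :=
  (Fintype.sum_of_injective (vemb hr) (vemb_injective hr) g f hf fun q => (hfg q).symm).symm

theorem dotProduct_vext (hr : r < n) (x : SIdx n → ℝ) (v : VIdx n r → ℝ) :
    x ⬝ᵥ vext hr v = (x ∘ vemb hr) ⬝ᵥ v :=
  sum_vemb hr (fun p hp => by rw [vext_of_notMem_range hr v hp, mul_zero])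
    fun q => by rw [vext_vemb]; rfl

theorem vext_dotProduct_vext (hr : r < n) (u v : VIdx n r → ℝ) :
    vext hr u ⬝ᵥ vext hr v = u ⬝ᵥ v := by
  rw [dotProduct_vext]
  congr 1
  ext q; exact vext_vemb hr u q

theorem vnorm_vext (hr : r < n) (v : VIdx n r → ℝ) : vnorm (vext hr v) = vnorm v :=
  le_antisymm (vnorm_le_of_sq_le (vext_dotProduct_vext hr v v).le)
    (vnorm_le_of_sq_le (vext_dotProduct_vext hr v v).ge)

theorem vnorm_comp_vemb_le (hr : r < n) (x : SIdx n → ℝ) : vnorm (x ∘ vemb hr) ≤ vnorm x := by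
  refine vnorm_le_of_sq_le ?_
  rw [dotProduct, dotProduct]
  calc ∑ q, (x ∘ vemb hr) q * (x ∘ vemb hr) q
      = ∑ p ∈ Finset.univ.map ⟨vemb hr, vemb_injective hr⟩, x p * x p := by
        rw [Finset.sum_map]; rfl
    _ ≤ _ := Finset.sum_le_sum_of_subset_of_nonneg (Finset.subset_univ _)
        fun p _ _ => mul_self_nonneg _

theorem QQ_mulVec (hr : r < n) (P : Matrix (Fin n) (Fin n) ℝ) (v : VIdx n r → ℝ) :
    QQ hr P *ᵥ v = symKron P P *ᵥ vext hr v := by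
  ext i
  rw [QQ_eq, Matrix.mulVec, Matrix.mulVec, dotProduct_vext]
  rfl

theorem QQ_transpose_mulVec (hr : r < n) (P : Matrix (Fin n) (Fin n) ℝ) (x : SIdx n → ℝ) :
    (QQ hr P)ᵀ *ᵥ x = ((symKron P P)ᵀ *ᵥ x) ∘ vemb hr := by
  ext q
  rw [QQ_eq]; rfl

end Extension

/-! ### The augmented system in the eigenbasis -/

section Augmented

variable {m n r : ℕ} (hr : r < n) {P : Matrix (Fin n) (Fin n) ℝ} {w : Fin n → ℝ}

/-- Diagonal of `𝓔` in the eigenbasis. -/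
def eeDiag (w : Fin n → ℝ) (p : SIdx n) : ℝ :=
  gval hr w p.1.1 * gval hr w p.1.2 / tau hr w ^ 2

/-- Diagonal of `τ² Σ`. -/
def dDiag (w : Fin n → ℝ) (q : VIdx n r) : ℝ :=
  tau hr w ^ 2 / swt hr w (vemb hr q).1.1 (vemb hr q).1.2

theorem EE_mulVec (hpos : ∀ i, 0 < w i) (x : SIdx n → ℝ) :
    EE hr P w *ᵥ x = symKron P P *ᵥ (eeDiag hr w * ((symKron P P)ᵀ *ᵥ x)) := by
  rw [EE_eq hr hpos, ← Matrix.mulVec_mulVec, ← Matrix.mulVec_mulVec]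
  congr 1
  ext p; rw [Matrix.mulVec_diagonal]; rfl

theorem augMat_isSymm (hpos : ∀ i, 0 < w i) (hw : Antitone w) (A : Matrix (Fin m) (SIdx n) ℝ) :
    (augMat hr P w A).IsSymm := by
  rw [augMat, Matrix.IsSymm, Matrix.fromBlocks_transpose]
  congr 1
  · have : (EE hr P w)ᵀ = EE hr P w := by
      rw [EE_eq hr hpos, Matrix.transpose_mul, Matrix.transpose_mul, Matrix.transpose_transpose,
        Matrix.diagonal_transpose, Matrix.mul_assoc]
    rw [Matrix.transpose_mul, Matrix.transpose_mul, Matrix.transpose_transpose, this,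
      Matrix.mul_assoc]
  · rw [Matrix.transpose_mul, Matrix.transpose_transpose, Matrix.transpose_transpose]
  · rw [Matrix.transpose_mul]
  · rw [Matrix.transpose_neg, Matrix.transpose_smul, Sig_eq hr hpos hw, Matrix.diagonal_transpose]

/-- In the eigenbasis 𝓔 and Σ are diagonal and 𝓠 is extension by zero. The norm estimates and the
machine program use the augmented matrix only in this form. -/
theorem augMat_mulVec (hpos : ∀ i, 0 < w i) (hw : Antitone w) (A : Matrix (Fin m) (SIdx n) ℝ)
    (u : Fin m → ℝ) (v : VIdx n r → ℝ) :
    augMat hr P w A *ᵥ Sum.elim u v = Sum.elim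
      (A *ᵥ (symKron P P *ᵥ (eeDiag hr w * ((symKron P P)ᵀ *ᵥ (Aᵀ *ᵥ u)) + vext hr v)))
      (((symKron P P)ᵀ *ᵥ (Aᵀ *ᵥ u)) ∘ vemb hr - dDiag hr w * v) := by
  rw [augMat, Matrix.fromBlocks_mulVec, Sum.elim_comp_inl, Sum.elim_comp_inr]
  congr 1
  · rw [Matrix.mulVec_add, Matrix.mulVec_add, ← EE_mulVec hr hpos, ← QQ_mulVec]
    simp only [Matrix.mulVec_mulVec, Matrix.mul_assoc]
  · rw [← Matrix.mulVec_mulVec, QQ_transpose_mulVec, Matrix.neg_mulVec, Matrix.smul_mulVec,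
      Sig_eq hr hpos hw, sub_eq_add_neg]
    congr 2
    ext q
    rw [Pi.smul_apply, Matrix.mulVec_diagonal, Pi.mul_apply, dDiag, smul_eq_mul]
    ring

theorem augRhs_eq (hpos : ∀ i, 0 < w i) (A : Matrix (Fin m) (SIdx n) ℝ) (b : Fin m → ℝ)
    (C : Matrix (Fin n) (Fin n) ℝ) :
    augRhs hr P w A b C = Sum.elim
      (b + tau hr w ^ 2 •
        (A *ᵥ (symKron P P *ᵥ (eeDiag hr w * ((symKron P P)ᵀ *ᵥ svec C)))))
      (tau hr w ^ 2 • (((symKron P P)ᵀ *ᵥ svec C) ∘ vemb hr)) := by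
  rw [augRhs, QQ_transpose_mulVec, ← Matrix.mulVec_mulVec, EE_mulVec hr hpos]

theorem svec_recoverX (hpos : ∀ i, 0 < w i) (A : Matrix (Fin m) (SIdx n) ℝ)
    (C : Matrix (Fin n) (Fin n) ℝ) (u : Fin m → ℝ) (v : VIdx n r → ℝ) :
    svec (recoverX hr P w A C (Sum.elim u v)) = symKron P P *ᵥ
      (eeDiag hr w * ((symKron P P)ᵀ *ᵥ (Aᵀ *ᵥ u - tau hr w ^ 2 • svec C)) + vext hr v) := by
  rw [recoverX, svec_smat, Sum.elim_comp_inl, Sum.elim_comp_inr, EE_mulVec hr hpos, QQ_mulVec,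
    Matrix.mulVec_add]

theorem vnorm_sum_sq {α β : Type*} [Fintype α] [Fintype β] (x : α → ℝ) (y : β → ℝ) :
    vnorm (Sum.elim x y) ^ 2 = vnorm x ^ 2 + vnorm y ^ 2 := by
  rw [vnorm_sq, vnorm_sq, vnorm_sq, dotProduct, Fintype.sum_sum_type]; rfl

theorem vnorm_inl_le {α β : Type*} [Fintype α] [Fintype β] (x : α → ℝ) (y : β → ℝ) :
    vnorm x ≤ vnorm (Sum.elim x y) := by
  refine le_of_sq_le_sq ?_ (vnorm_nonneg _)
  rw [vnorm_sum_sq]; nlinarith [vnorm_nonneg y]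

theorem vnorm_inr_le {α β : Type*} [Fintype α] [Fintype β] (x : α → ℝ) (y : β → ℝ) :
    vnorm y ≤ vnorm (Sum.elim x y) := by
  refine le_of_sq_le_sq ?_ (vnorm_nonneg _)
  rw [vnorm_sum_sq]; nlinarith [vnorm_nonneg x]

theorem vnorm_sum_le {α β : Type*} [Fintype α] [Fintype β] (x : α → ℝ) (y : β → ℝ) :
    vnorm (Sum.elim x y) ≤ vnorm x + vnorm y := by
  refine le_of_sq_le_sq ?_ (add_nonneg (vnorm_nonneg _) (vnorm_nonneg _))
  rw [vnorm_sum_sq]; nlinarith [vnorm_nonneg x, vnorm_nonneg y]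

theorem vnorm_mul_le {ι : Type*} [Fintype ι] {d : ι → ℝ} {c : ℝ} (hc : 0 ≤ c)
    (hd : ∀ i, |d i| ≤ c) (x : ι → ℝ) : vnorm (d * x) ≤ c * vnorm x := by
  refine le_of_sq_le_sq ?_ (mul_nonneg hc (vnorm_nonneg _))
  rw [mul_pow, vnorm_sq, vnorm_sq, dotProduct, dotProduct, Finset.mul_sum]
  refine Finset.sum_le_sum fun i _ => ?_
  have := pow_le_pow_left₀ (abs_nonneg _) (hd i) 2
  rw [sq_abs] at this
  simp only [Pi.mul_apply]
  nlinarith [mul_le_mul_of_nonneg_right this (mul_self_nonneg (x i))]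

theorem vnorm_symKron_mulVec (h : Pᵀ * P = 1) (x : SIdx n → ℝ) :
    vnorm (symKron P P *ᵥ x) = vnorm x := by
  have : vnorm (symKron P P *ᵥ x) ^ 2 = vnorm x ^ 2 := by
    rw [vnorm_sq, mulVec_dotProduct, Matrix.mulVec_mulVec, symKron_transpose_mul_self h,
      Matrix.one_mulVec, vnorm_sq]
  exact (pow_left_inj₀ (vnorm_nonneg _) (vnorm_nonneg _) two_ne_zero).1 this

theorem vnorm_symKron_transpose_mulVec (h : Pᵀ * P = 1) (x : SIdx n → ℝ) :
    vnorm ((symKron P P)ᵀ *ᵥ x) = vnorm x := by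
  rw [← vnorm_symKron_mulVec h, Matrix.mulVec_mulVec, symKron_mul_transpose_self h,
    Matrix.one_mulVec]

theorem eeDiag_pos (hpos : ∀ i, 0 < w i) (p : SIdx n) : 0 < eeDiag hr w p :=
  div_pos (mul_pos (gval_pos hr hpos _) (gval_pos hr hpos _)) (pow_pos (tau_pos hr hpos) 2)

theorem eeDiag_le (hpos : ∀ i, 0 < w i) (hw : Antitone w) (p : SIdx n) : eeDiag hr w p ≤ 4 := by
  rw [eeDiag, div_le_iff₀ (pow_pos (tau_pos hr hpos) 2)]
  have := mul_le_mul (gval_le hr hpos hw p.1.1) (gval_le hr hpos hw p.1.2)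
    (gval_pos hr hpos _).le (by have := tau_pos hr hpos; linarith)
  linarith

theorem dDiag_pos (hpos : ∀ i, 0 < w i) (hw : Antitone w) (q : VIdx n r) : 0 < dDiag hr w q :=
  div_pos (pow_pos (tau_pos hr hpos) 2) (swt_vemb_pos hr hpos hw q)

/-- The Newton residual is bounded by the residual of the augmented system. -/
theorem newtResidual_le {W : Matrix (Fin n) (Fin n) ℝ} (he : IsEigendecomp W P w)
    (hpos : ∀ i, 0 < w i) (A : Matrix (Fin m) (SIdx n) ℝ) (b : Fin m → ℝ)
    (C : Matrix (Fin n) (Fin n) ℝ) (z : Fin m ⊕ VIdx n r → ℝ) {c : ℝ} (hc1 : 1 ≤ c)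
    (hc : (tau hr w ^ 2)⁻¹ ≤ c) :
    newtResidual W A b C (recoverX hr P w A C z) (recoverY hr w z) ≤
      c * vnorm (augMat hr P w A *ᵥ z - augRhs hr P w A b C) := by
  obtain ⟨u, v, rfl⟩ : ∃ u v, z = Sum.elim u v :=
    ⟨z ∘ Sum.inl, z ∘ Sum.inr, (Sum.elim_comp_inl_inr z).symm⟩
  have ht := pow_pos (tau_pos hr hpos) 2
  have hPP := symKron_mul_transpose_self he.orth
  have hPP' := symKron_transpose_mul_self he.orth
  set t2 := tau hr w ^ 2 with ht2
  set PP := symKron P P with hPPd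
  set h := PPᵀ *ᵥ (Aᵀ *ᵥ u - t2 • svec C) with hh
  have hinv : (symKron W W)⁻¹ =
      PP * Matrix.diagonal (fun p : SIdx n => (w p.1.1 * w p.1.2)⁻¹) * PPᵀ := by
    refine Matrix.inv_eq_right_inv ?_
    rw [he.symKron_eq]
    calc _ = PP * Matrix.diagonal (fun p : SIdx n => w p.1.1 * w p.1.2) * (PPᵀ * PP) *
          Matrix.diagonal (fun p : SIdx n => (w p.1.1 * w p.1.2)⁻¹) * PPᵀ := by
          simp only [Matrix.mul_assoc]; rfl
      _ = 1 := by
          rw [hPP', Matrix.mul_one, Matrix.mul_assoc PP, Matrix.diagonal_mul_diagonal]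
          have : (fun p : SIdx n => w p.1.1 * w p.1.2 * (w p.1.1 * w p.1.2)⁻¹) = fun _ => 1 := by
            ext p; exact mul_inv_cancel₀ (mul_pos (hpos _) (hpos _)).ne'
          rw [this, Matrix.diagonal_one, Matrix.mul_one, hPP]
  have hres : augMat hr P w A *ᵥ Sum.elim u v - augRhs hr P w A b C = Sum.elim
      (A *ᵥ (PP *ᵥ (eeDiag hr w * h + vext hr v)) - b) (h ∘ vemb hr - dDiag hr w * v) := by
    rw [augMat_mulVec hr hpos he.antitone, augRhs_eq hr hpos, ← Sum.elim_sub_sub]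
    have e : eeDiag hr w * h = eeDiag hr w * (PPᵀ *ᵥ (Aᵀ *ᵥ u)) -
        t2 • (eeDiag hr w * (PPᵀ *ᵥ svec C)) := by
      rw [hh, Matrix.mulVec_sub, Matrix.mulVec_smul, mul_sub, mul_smul_comm]
    congr 1
    · rw [e]
      simp only [Matrix.mulVec_add, Matrix.mulVec_sub, Matrix.mulVec_smul]
      abel
    · ext q
      simp only [hh, Matrix.mulVec_sub, Matrix.mulVec_smul, Pi.sub_apply, Function.comp_apply,
        Pi.smul_apply]
      ring
  -- The primal rows agree with the first block of the augmented residual. In the eigenbasis, the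
  -- dual rows vanish off the second block, where W ⊗ₛ W equals τ²𝓔, and on it they are rescaled
  -- entries of the second block of the augmented residual.
  have hfirst : Matrix.fromBlocks (-(symKron W W)⁻¹) Aᵀ A 0 *ᵥ
      Sum.elim (svec (recoverX hr P w A C (Sum.elim u v))) (recoverY hr w (Sum.elim u v)) -
      Sum.elim (svec C) b = Sum.elim
        (PP *ᵥ (t2⁻¹ • vext hr (fun q => swt hr w (vemb hr q).1.1 (vemb hr q).1.2 *
          (w (vemb hr q).1.1 * w (vemb hr q).1.2)⁻¹ * (h (vemb hr q) - dDiag hr w q * v q))))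
        (A *ᵥ (PP *ᵥ (eeDiag hr w * h + vext hr v)) - b) := by
    rw [Matrix.fromBlocks_mulVec, Sum.elim_comp_inl, Sum.elim_comp_inr, ← Sum.elim_sub_sub,
      svec_recoverX hr hpos, Matrix.zero_mulVec, add_zero,
      show (symKron P P)ᵀ *ᵥ (Aᵀ *ᵥ u - tau hr w ^ 2 • svec C) = h from rfl]
    congr 1
    have e1 : Aᵀ *ᵥ recoverY hr w (Sum.elim u v) - svec C = PP *ᵥ (t2⁻¹ • h) := by
      rw [recoverY, Sum.elim_comp_inl, Matrix.mulVec_smul, Matrix.mulVec_smul, hh,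
        Matrix.mulVec_mulVec, hPP, Matrix.one_mulVec, smul_sub, smul_smul,
        inv_mul_cancel₀ ht.ne', one_smul]
    rw [add_sub_assoc, e1, hinv, Matrix.neg_mulVec, Matrix.mulVec_mulVec, Matrix.mul_assoc,
      hPP', Matrix.mul_one, ← Matrix.mulVec_mulVec, ← Matrix.mulVec_neg, ← Matrix.mulVec_add]
    congr 1
    ext p
    rw [Pi.add_apply, Pi.neg_apply, Matrix.mulVec_diagonal, Pi.smul_apply, Pi.smul_apply,
      Pi.add_apply, Pi.mul_apply]
    have hw1 := (hpos p.1.1).ne'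
    have hw2 := (hpos p.1.2).ne'
    -- The splitting W ⊗ₛ W = τ²𝓔 + 𝓠Σ⁻¹𝓠ᵀ, read entrywise.
    have hee : t2 * eeDiag hr w p = w p.1.1 * w p.1.2 - swt hr w p.1.1 p.1.2 := by
      rw [eeDiag, mul_div_cancel₀ _ ht.ne', swt]; ring
    have hee' : eeDiag hr w p = (w p.1.1 * w p.1.2 - swt hr w p.1.1 p.1.2) / t2 := by
      rw [← hee, mul_div_cancel_left₀ _ ht.ne']
    have htne := ht.ne'
    by_cases hp : p ∈ Set.range (vemb hr)
    · obtain ⟨q, rfl⟩ := hp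
      have hs := (swt_vemb_pos hr hpos he.antitone q).ne'
      rw [vext_vemb, vext_vemb, hee', dDiag, ← ht2]
      simp only [smul_eq_mul]
      field_simp
      ring
    · rw [vext_of_notMem_range hr _ hp, vext_of_notMem_range hr _ hp, hee',
        swt_of_notMem_range hr w p hp]
      simp only [smul_eq_mul]
      field_simp
      ring
  rw [newtResidual, hfirst, hres]
  refine le_of_sq_le_sq ?_ (mul_nonneg (by linarith) (vnorm_nonneg _))
  rw [mul_pow, vnorm_sum_sq, vnorm_sum_sq, vnorm_symKron_mulVec he.orth, vnorm_smul, vnorm_vext,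
    abs_of_pos (inv_pos.2 ht)]
  have h1 : vnorm (fun q => swt hr w (vemb hr q).1.1 (vemb hr q).1.2 *
      (w (vemb hr q).1.1 * w (vemb hr q).1.2)⁻¹ * (h (vemb hr q) - dDiag hr w q * v q)) ≤
      1 * vnorm (h ∘ vemb hr - dDiag hr w * v) := by
    refine vnorm_mul_le zero_le_one (d := fun q => swt hr w (vemb hr q).1.1 (vemb hr q).1.2 *
      (w (vemb hr q).1.1 * w (vemb hr q).1.2)⁻¹) (fun q => ?_) _
    -- The rescaling factor is the weight divided by w i * w j, which lies in (0, 1] because a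
    -- positive product g i * g j was subtracted. Only τ⁻² is lost.
    have hs := swt_vemb_pos hr hpos he.antitone q
    have hwq := mul_pos (hpos (vemb hr q).1.1) (hpos (vemb hr q).1.2)
    rw [abs_of_pos (mul_pos hs (inv_pos.2 hwq)), ← div_eq_mul_inv, div_le_one hwq, swt]
    have := mul_pos (gval_pos hr hpos (vemb hr q).1.1) (gval_pos hr hpos (vemb hr q).1.2)
    linarith
  rw [one_mul] at h1
  have h2 := mul_le_mul hc h1 (vnorm_nonneg _) (by linarith)
  have h3 := pow_le_pow_left₀ (mul_nonneg (inv_pos.2 ht).le (vnorm_nonneg _)) h2 2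
  have h4 : 1 ≤ c ^ 2 := one_le_pow₀ hc1
  rw [mul_pow _ (vnorm (h ∘ vemb hr - dDiag hr w * v))] at h3
  nlinarith [mul_le_mul_of_nonneg_right h4
    (sq_nonneg (vnorm (A *ᵥ (PP *ᵥ (eeDiag hr w * h + vext hr v)) - b)))]

end Augmented

/-! ### Conditioning of the augmented matrix -/

section Conditioning

variable {m n r : ℕ} {W X S Xs Ss P : Matrix (Fin n) (Fin n) ℝ} {w : Fin n → ℝ}
  {μ L δ χ₁ χ₂ : ℝ} {A : Matrix (Fin m) (SIdx n) ℝ}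

theorem CenteredScaling.le_four_mul_tau (h : CenteredScaling W X S Xs Ss μ L δ χ₁)
    (he : IsEigendecomp W P w) (hμ : 0 < μ) (hδ : δ < 1) (hL : 1 ≤ L) (hr : r < n) :
    √((1 - δ) * μ) ≤ 4 * L * tau hr w := by
  have h1 := h.le_eigenvalue he hμ hδ ⟨r, hr⟩
  have h2 := he.pos h.posDef ⟨r, hr⟩
  rw [tau]; nlinarith

/-- Multiplying the lower bound for w i by the upper bound for λ_{r+1}(W) produces √((1-δ)μ)² =
(1-δ)μ on one side and μ on the other, so μ cancels. This is where independence of μ enters the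
conditioning. -/
theorem CenteredScaling.tau_le (h : CenteredScaling W X S Xs Ss μ L δ χ₁)
    (he : IsEigendecomp W P w) (hμ : 0 < μ) (hδ : δ < 1) (hL : 1 ≤ L) (hr : r < n)
    (hrank : Xs.rank ≤ r) (i : Fin n) : tau hr w ≤ L ^ 2 / (1 - δ) * w i := by
  have h1 := h.le_eigenvalue he hμ hδ i
  have h2 := he.pos h.posDef i
  have h3 := h.eigenvalue_le he hμ hδ hr hrank
  have hd : 0 < 1 - δ := by linarith
  have h4 : √((1 - δ) * μ) ^ 2 = (1 - δ) * μ := Real.sq_sqrt (mul_pos hd hμ).le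
  have h5 : 0 ≤ √((1 - δ) * μ) := Real.sqrt_nonneg _
  set θ := √((1 - δ) * μ)
  have h6 : θ ≤ 2 * L * w i := by nlinarith
  rw [div_mul_eq_mul_div, le_div_iff₀ hd, tau]
  have h7 : θ * (θ * w ⟨r, hr⟩) ≤ (2 * L * w i) * (L * μ) :=
    mul_le_mul h6 h3 (mul_nonneg h5 (he.pos h.posDef _).le) (by positivity)
  have h8 : μ * ((1 - δ) * w ⟨r, hr⟩) ≤ μ * (2 * L ^ 2 * w i) := by
    calc _ = θ * (θ * w ⟨r, hr⟩) := by rw [← mul_assoc, ← mul_assoc, ← sq, h4]; ring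
      _ ≤ _ := h7
      _ = _ := by ring
  have h9 := le_of_mul_le_mul_left h8 hμ
  linarith

theorem dotProduct_proj_le {N : Matrix (Fin n) (Fin n) ℝ} (hN : Nᵀ = N) (hNN : N * N = N)
    (x : Fin n → ℝ) : (N *ᵥ x) ⬝ᵥ (N *ᵥ x) ≤ x ⬝ᵥ x := by
  have h1 : (N *ᵥ x) ⬝ᵥ (N *ᵥ x) = x ⬝ᵥ (N *ᵥ x) := by
    rw [mulVec_dotProduct, hN, Matrix.mulVec_mulVec, hNN]
  have h2 : 0 ≤ (x - N *ᵥ x) ⬝ᵥ (x - N *ᵥ x) := vnorm_sq (x - N *ᵥ x) ▸ sq_nonneg _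
  rw [sub_dotProduct, dotProduct_sub, dotProduct_sub, dotProduct_comm (N *ᵥ x) x] at h2
  linarith

/-- The compression to the kernel of `X⋆` of an element of the second block. -/
theorem CenteredScaling.frob_compression_le (h : CenteredScaling W X S Xs Ss μ L δ χ₁)
    (he : IsEigendecomp W P w) (hμ : 0 < μ) (hδ : δ < 1) (hL : 1 ≤ L) (hr : r < n)
    {N : Matrix (Fin n) (Fin n) ℝ} (hN : Nᵀ = N) (hNN : N * N = N) (hXN : Xs * N = 0)
    (v : VIdx n r → ℝ) :
    frob (N * smat (symKron P P *ᵥ vext hr v) * N) ^ 2 ≤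
      16 * (L ^ 2 / (1 - δ)) ^ 2 * (v ⬝ᵥ (dDiag hr w * v)) := by
  have hpos := he.pos h.posDef
  have hd : 0 < 1 - δ := by linarith
  have hθ : 0 < √((1 - δ) * μ) := Real.sqrt_pos.2 (mul_pos hd hμ)
  have hθ2 : √((1 - δ) * μ) ^ 2 = (1 - δ) * μ := Real.sq_sqrt (mul_pos hd hμ).le
  have hτ := h.le_four_mul_tau he hμ hδ hL hr
  have hτ0 := tau_pos hr hpos
  set θ := √((1 - δ) * μ) with hθd
  set D := Matrix.diagonal fun i => √(w i) with hD
  set B := N * P * D with hB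
  set g : SIdx n → ℝ := fun p => (√(w p.1.1) * √(w p.1.2))⁻¹ * vext hr v p with hg
  have hsq : ∀ i, √(w i) ≠ 0 := fun i => (Real.sqrt_pos.2 (hpos i)).ne'
  -- The entries are balanced by √(w i) √(w j), so that the compression becomes B (smat g) Bᵀ with B
  -- = N P W_diag^(1/2), and B Bᵀ = N W N.
  have hG : D * smat g * D = smat (vext hr v) := by
    ext i j
    rw [Matrix.mul_diagonal, Matrix.diagonal_mul, hg,
      smat_diagonal_mulVec (fun i j => (√(w i) * √(w j))⁻¹) (fun i j => by rw [mul_comm])]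
    have := hsq i
    have := hsq j
    field_simp
  have hF : N * smat (symKron P P *ᵥ vext hr v) * N = B * smat g * Bᵀ := by
    rw [smat_symKron_self_mulVec, ← hG, hB, Matrix.transpose_mul, Matrix.transpose_mul, hN, hD,
      Matrix.diagonal_transpose]
    simp only [Matrix.mul_assoc]
  -- The range of N lies in the kernel of X⋆, on which W is at most Lμ/θ.
  have hBn : ‖B‖ ^ 2 ≤ L * μ / θ := by
    have hc : 0 ≤ L * μ / θ := by positivity
    have : ‖Bᵀ‖ ≤ √(L * μ / θ) := by
      refine norm_le_of_vnorm_mulVec_le (Real.sqrt_nonneg _) fun x => ?_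
      refine le_of_sq_le_sq ?_ (mul_nonneg (Real.sqrt_nonneg _) (vnorm_nonneg _))
      rw [mul_pow, Real.sq_sqrt hc, vnorm_sq, vnorm_sq]
      have e1 : Bᵀ *ᵥ x = D *ᵥ (Pᵀ *ᵥ (N *ᵥ x)) := by
        rw [hB, Matrix.transpose_mul, Matrix.transpose_mul, hN, hD, Matrix.diagonal_transpose]
        simp only [Matrix.mulVec_mulVec]
      have e2 : (Bᵀ *ᵥ x) ⬝ᵥ (Bᵀ *ᵥ x) = (N *ᵥ x) ⬝ᵥ (W *ᵥ (N *ᵥ x)) := by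
        have e3 : N *ᵥ x = P *ᵥ (Pᵀ *ᵥ (N *ᵥ x)) := by
          rw [Matrix.mulVec_mulVec, mul_eq_one_comm.1 he.orth, Matrix.one_mulVec]
        rw [e3, he.dotProduct_mulVec, e1, dotProduct]
        refine Finset.sum_congr rfl fun i _ => ?_
        rw [hD, Matrix.mulVec_diagonal, mul_mul_mul_comm, Real.mul_self_sqrt (hpos i).le, sq]
      have e4 := h.dotProduct_le_of_mulVec_eq_zero hμ hδ (x := N *ᵥ x)
        (by rw [Matrix.mulVec_mulVec, hXN, Matrix.zero_mulVec])
      have e5 := mul_le_mul_of_nonneg_left (dotProduct_proj_le hN hNN x)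
        (by positivity : 0 ≤ L * μ)
      rw [e2, div_mul_eq_mul_div, le_div_iff₀ hθ]
      linarith
    rw [norm_transpose] at this
    calc ‖B‖ ^ 2 ≤ √(L * μ / θ) ^ 2 := by gcongr
      _ = _ := Real.sq_sqrt hc
  -- The τ²Σ-energy has the weights in its denominators, and these are at most w i * w j.
  have hgn : tau hr w ^ 2 * vnorm g ^ 2 ≤ v ⬝ᵥ (dDiag hr w * v) := by
    rw [vnorm_sq, dotProduct, dotProduct, sum_vemb hr
      (g := fun q => (w (vemb hr q).1.1 * w (vemb hr q).1.2)⁻¹ * v q ^ 2), Finset.mul_sum]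
    · refine Finset.sum_le_sum fun q _ => ?_
      have h1 := swt_vemb_pos hr hpos he.antitone q
      have h2 : swt hr w (vemb hr q).1.1 (vemb hr q).1.2 ≤
          w (vemb hr q).1.1 * w (vemb hr q).1.2 := by
        rw [swt]
        have := mul_pos (gval_pos hr hpos (vemb hr q).1.1) (gval_pos hr hpos (vemb hr q).1.2)
        linarith
      have h3 := inv_anti₀ h1 h2
      have h4 := mul_le_mul_of_nonneg_left h3 (by positivity : 0 ≤ tau hr w ^ 2 * v q ^ 2)
      simp only [Pi.mul_apply, dDiag, div_eq_mul_inv]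
      linarith
    · intro p hp
      rw [hg]; simp only [vext_of_notMem_range hr v hp, mul_zero]
    · intro q
      rw [hg]; simp only [vext_vemb]
      rw [mul_mul_mul_comm, ← mul_inv, mul_mul_mul_comm, Real.mul_self_sqrt (hpos _).le,
        Real.mul_self_sqrt (hpos _).le, sq]
  have h1 := frob_mul_mul_transpose_le B (smat g)
  rw [← hF, frob_smat] at h1
  have h2 : frob (N * smat (symKron P P *ᵥ vext hr v) * N) ≤
      4 * (L ^ 2 / (1 - δ)) * (tau hr w * vnorm g) := by
    refine h1.trans ?_
    -- From θ² = (1-δ)μ and θ ≤ 4Lτ; the factor τ is the one absorbed by the energy.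
    have h3 : L * μ / θ ≤ 4 * (L ^ 2 / (1 - δ)) * tau hr w := by
      rw [div_le_iff₀ hθ]
      have h4 := mul_le_mul_of_nonneg_left hτ hθ.le
      rw [← sq, hθ2] at h4
      calc L * μ = L / (1 - δ) * ((1 - δ) * μ) := by field_simp
        _ ≤ L / (1 - δ) * (θ * (4 * L * tau hr w)) := by gcongr
        _ = _ := by ring
    have := mul_le_mul_of_nonneg_right (hBn.trans h3) (vnorm_nonneg g)
    linarith
  have h3 := pow_le_pow_left₀ (frob_nonneg _) h2 2
  calc _ ≤ _ := h3
    _ = 16 * (L ^ 2 / (1 - δ)) ^ 2 * (tau hr w ^ 2 * vnorm g ^ 2) := by ring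
    _ ≤ _ := by gcongr

theorem norm_msqrt_inv_sq (hA : LinearIndependent ℝ A.row) :
    ‖(msqrt (A * Aᵀ))⁻¹‖ ^ 2 = ‖(A * Aᵀ)⁻¹‖ := by
  rw [← norm_mul_transpose_self, Matrix.transpose_nonsing_inv, msqrt_transpose,
    ← Matrix.mul_inv_rev, msqrt_mul_self (posDef_mul_transpose hA).posSemidef]

theorem vnorm_msqrt_inv_mulVec_sq_le (hA : LinearIndependent ℝ A.row) (x : Fin m → ℝ) :
    vnorm ((msqrt (A * Aᵀ))⁻¹ *ᵥ x) ^ 2 ≤ ‖(A * Aᵀ)⁻¹‖ * vnorm x ^ 2 := by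
  rw [← norm_msqrt_inv_sq hA, ← mul_pow]
  exact pow_le_pow_left₀ (vnorm_nonneg _) (vnorm_mulVec_le _ _) 2

theorem vnorm_sq_le_transpose_mulVec (hA : LinearIndependent ℝ A.row) (x : Fin m → ℝ) :
    vnorm x ^ 2 ≤ ‖(A * Aᵀ)⁻¹‖ * vnorm (Aᵀ *ᵥ x) ^ 2 := by
  have h := posDef_mul_transpose hA
  have hu := (Matrix.isUnit_iff_isUnit_det _).1 (isUnit_msqrt h)
  have h1 := vnorm_msqrt_inv_mulVec_sq_le hA (msqrt (A * Aᵀ) *ᵥ x)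
  rw [Matrix.mulVec_mulVec, Matrix.nonsing_inv_mul _ hu, Matrix.one_mulVec, vnorm_sq (_ *ᵥ x),
    mulVec_dotProduct, msqrt_transpose, Matrix.mulVec_mulVec, msqrt_mul_self h.posSemidef,
    ← Matrix.mulVec_mulVec, dotProduct_comm, mulVec_dotProduct, ← vnorm_sq] at h1
  exact h1

/-- If Z exceeded 2βG, then β Z G would be at most Z²/2 and a G² less than Z²/4, contradicting the
quadratic inequality. -/
theorem le_two_mul_of_sq_le {Z G a β : ℝ} (hG : 0 ≤ G) (hβ : 0 < β)
    (ha : a ≤ β ^ 2) (h : Z ^ 2 ≤ a * G ^ 2 + β * (Z * G)) : Z ≤ 2 * β * G := by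
  by_contra! hlt
  have h1 : a * G ^ 2 ≤ (β * G) ^ 2 := by
    rw [mul_pow]; exact mul_le_mul_of_nonneg_right ha (sq_nonneg _)
  have h2 : 0 ≤ β * G := by positivity
  nlinarith

/-- In the sum of the bounds for u and v, each energy has coefficient at most Γ²χ²(α + 128). The
energy bound 2ZG turns this into β Z G with β = Γ²χ²(2α + 256), and the remaining G² term has
coefficient at most β². -/
theorem le_of_energy_bounds {Z G α Γ χ Eu Ev u₂ v₂ : ℝ} (hG0 : 0 ≤ G) (hα0 : 0 ≤ α)
    (hΓ1 : 1 ≤ Γ) (hχ : 1 ≤ χ) (hEu0 : 0 ≤ Eu) (hEv0 : 0 ≤ Ev)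
    (hE : Eu + Ev ≤ 2 * (Z * G)) (hZ : Z ^ 2 = u₂ + v₂) (hu : u₂ ≤ α * (Γ ^ 2 * Eu))
    (hv : v₂ ≤ χ ^ 2 * (4 * (α * G ^ 2) + 16 * Eu + 128 * (Γ ^ 2 * Ev))) :
    Z ≤ 2 * (Γ ^ 2 * χ ^ 2 * (2 * α + 256)) * G := by
  have hΓ2 : 1 ≤ Γ ^ 2 := one_le_pow₀ hΓ1
  have hχ2 : 1 ≤ χ ^ 2 := one_le_pow₀ hχ
  refine le_two_mul_of_sq_le (a := χ ^ 2 * (4 * α)) hG0 (by positivity) ?_ ?_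
  · have h1 : 2 * α + 256 ≤ Γ ^ 2 * (2 * α + 256) :=
      le_mul_of_one_le_left (by positivity) hΓ2
    have h2 : χ ^ 2 * (2 * α + 256) ≤ Γ ^ 2 * χ ^ 2 * (2 * α + 256) := by
      have := mul_le_mul_of_nonneg_left h1 (by positivity : 0 ≤ χ ^ 2)
      linarith
    refine le_trans ?_ (pow_le_pow_left₀ (by positivity) h2 2)
    rw [mul_pow, sq (χ ^ 2), mul_assoc]
    refine mul_le_mul_of_nonneg_left ?_ (by positivity)
    have h3 : 4 * α ≤ (2 * α + 256) ^ 2 := by nlinarith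
    exact h3.trans (le_mul_of_one_le_left (sq_nonneg _) hχ2)
  · rw [hZ]
    have a1 : α * (Γ ^ 2 * Eu) ≤ χ ^ 2 * (Γ ^ 2 * (α * Eu)) := by
      have := mul_le_mul_of_nonneg_right hχ2 (by positivity : 0 ≤ Γ ^ 2 * (α * Eu))
      linarith
    have a2 : χ ^ 2 * (16 * Eu) ≤ χ ^ 2 * (Γ ^ 2 * (128 * Eu)) := by
      refine mul_le_mul_of_nonneg_left ?_ (by positivity)
      have := mul_le_mul_of_nonneg_right hΓ2 hEu0
      linarith
    have a3 : 0 ≤ χ ^ 2 * (Γ ^ 2 * (α * Ev)) := by positivity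
    have a4 := mul_le_mul_of_nonneg_left hE (by positivity : 0 ≤ Γ ^ 2 * χ ^ 2 * (α + 128))
    linarith

/-- Lower bound for the augmented matrix. -/
theorem CenteredScaling.vnorm_le_augMat (h : CenteredScaling W X S Xs Ss μ L δ χ₁)
    (ht : TangentInjective A Xs χ₂) (he : IsEigendecomp W P w) (hA : LinearIndependent ℝ A.row)
    (hμ : 0 < μ) (hδ0 : 0 ≤ δ) (hδ : δ < 1) (hL : 1 ≤ L) (hr : r < n) (hrank : Xs.rank ≤ r)
    (z : Fin m ⊕ VIdx n r → ℝ) :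
    vnorm z ≤ 2 * ((L ^ 2 / (1 - δ)) ^ 2 * χ₂ ^ 2 * (2 * ‖(A * Aᵀ)⁻¹‖ + 256)) *
      vnorm (augMat hr P w A *ᵥ z) := by
  obtain ⟨u, v, rfl⟩ : ∃ u v, z = Sum.elim u v :=
    ⟨z ∘ Sum.inl, z ∘ Sum.inr, (Sum.elim_comp_inl_inr z).symm⟩
  have hpos := he.pos h.posDef
  have hw := he.antitone
  have hd : 0 < 1 - δ := by linarith
  have hχ : 1 ≤ χ₂ := ht.1
  have hΓ1 : 1 ≤ L ^ 2 / (1 - δ) := by rw [le_div_iff₀ hd]; nlinarith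
  have hτ0 := tau_pos hr hpos
  have hτ := h.tau_le he hμ hδ hL hr hrank
  set Γ := L ^ 2 / (1 - δ) with hΓ
  have hα0 : 0 ≤ ‖(A * Aᵀ)⁻¹‖ := norm_nonneg _
  set PP := symKron P P with hPP
  set x := PPᵀ *ᵥ (Aᵀ *ᵥ u) with hx
  have hM := augMat_mulVec (P := P) hr hpos hw A u v
  rw [← hPP, ← hx] at hM
  set g₁ := A *ᵥ (PP *ᵥ (eeDiag hr w * x + vext hr v)) with hg₁
  set g₂ := x ∘ vemb hr - dDiag hr w * v with hg₂
  rw [hM]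
  set G := vnorm (Sum.elim g₁ g₂) with hG
  set Z := vnorm (Sum.elim u v) with hZ
  have hG0 : 0 ≤ G := vnorm_nonneg _
  have hZ0 : 0 ≤ Z := vnorm_nonneg _
  set Eu := x ⬝ᵥ (eeDiag hr w * x) with hEu
  set Ev := v ⬝ᵥ (dDiag hr w * v) with hEv
  have hEu0 : 0 ≤ Eu := Finset.sum_nonneg fun p _ => by
    have := eeDiag_pos hr hpos p
    simp only [Pi.mul_apply]; nlinarith [mul_nonneg this.le (mul_self_nonneg (x p))]
  have hEv0 : 0 ≤ Ev := Finset.sum_nonneg fun q _ => by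
    have := dDiag_pos hr hpos hw q
    simp only [Pi.mul_apply]; nlinarith [mul_nonneg this.le (mul_self_nonneg (v q))]
  -- Quasidefiniteness: with the sign of v reversed, the coupling terms cancel and two nonnegative
  -- diagonal forms remain.
  have henergy : u ⬝ᵥ g₁ - v ⬝ᵥ g₂ = Eu + Ev := by
    have e1 : u ⬝ᵥ g₁ = x ⬝ᵥ (eeDiag hr w * x + vext hr v) := by
      rw [hg₁, dotProduct_comm, mulVec_dotProduct, mulVec_dotProduct, dotProduct_comm]
    rw [e1, dotProduct_add, dotProduct_vext, hg₂, dotProduct_sub, dotProduct_comm v (x ∘ _)]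
    ring
  have hE : Eu + Ev ≤ 2 * (Z * G) := by
    have h1 := dotProduct_le_vnorm_mul_vnorm u g₁
    have h2 := dotProduct_le_vnorm_mul_vnorm (-v) g₂
    rw [neg_dotProduct, vnorm_neg] at h2
    have h3 := mul_le_mul (vnorm_inl_le u v) (vnorm_inl_le g₁ g₂) (vnorm_nonneg _) hZ0
    have h4 := mul_le_mul (vnorm_inr_le u v) (vnorm_inr_le g₁ g₂) (vnorm_nonneg _) hZ0
    linarith
  have hu : vnorm u ^ 2 ≤ ‖(A * Aᵀ)⁻¹‖ * (Γ ^ 2 * Eu) := by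
    refine (vnorm_sq_le_transpose_mulVec hA u).trans (mul_le_mul_of_nonneg_left ?_ hα0)
    rw [← vnorm_symKron_transpose_mulVec he.orth, ← hPP, ← hx, vnorm_sq, hEu, dotProduct,
      dotProduct, Finset.mul_sum]
    refine Finset.sum_le_sum fun p _ => ?_
    -- It bounds the entries of 𝓔 below by Γ⁻²; on the top positions g = τ and Γ ≥ 1 suffices.
    have hg : ∀ i, tau hr w ≤ Γ * gval hr w i := by
      intro i
      rw [gval]; split_ifs
      · nlinarith
      · exact hτ i
    have h1 : 1 ≤ Γ ^ 2 * eeDiag hr w p := by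
      rw [eeDiag, mul_div_assoc', le_div_iff₀ (by positivity)]
      have := mul_le_mul (hg p.1.1) (hg p.1.2) hτ0.le
        (mul_nonneg (by linarith) (gval_pos hr hpos _).le)
      linarith
    have := mul_le_mul_of_nonneg_right h1 (mul_self_nonneg (x p))
    simp only [Pi.mul_apply]
    linarith
  obtain ⟨N, hN, hNN, hXN, hfrob⟩ := ht.frob_le hA
  have hF := h.frob_compression_le he hμ hδ hL hr hN hNN hXN v
  rw [← hPP, ← hEv, ← hΓ] at hF
  have hv := hfrob (smat (PP *ᵥ vext hr v)) (smat_isSymm _)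
  rw [frob_smat, hPP, vnorm_symKron_mulVec he.orth, vnorm_vext, ← hPP, svec_smat] at hv
  set F := frob (N * smat (PP *ᵥ vext hr v) * N)
  have hF0 : 0 ≤ F := frob_nonneg _
  set q := vnorm (((msqrt (A * Aᵀ))⁻¹ * A) *ᵥ (PP *ᵥ vext hr v)) with hq
  have hq0 : 0 ≤ q := vnorm_nonneg _
  -- The first block of the equations gives the image of 𝓠v under (AAᵀ)^(-1/2)A as (AAᵀ)^(-1/2) g₁
  -- minus the contribution of 𝓔Aᵀu. The latter is controlled by the first energy because the
  -- entries of 𝓔 are at most 4.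
  have hq2 : q ^ 2 ≤ 2 * (‖(A * Aᵀ)⁻¹‖ * G ^ 2) + 8 * Eu := by
    have e : ((msqrt (A * Aᵀ))⁻¹ * A) *ᵥ (PP *ᵥ vext hr v) = (msqrt (A * Aᵀ))⁻¹ *ᵥ g₁ -
        ((msqrt (A * Aᵀ))⁻¹ * A) *ᵥ (PP *ᵥ (eeDiag hr w * x)) := by
      rw [hg₁, Matrix.mulVec_add, Matrix.mulVec_add, Matrix.mulVec_add]
      simp only [← Matrix.mulVec_mulVec]
      abel
    have h1 := vnorm_sub_le ((msqrt (A * Aᵀ))⁻¹ *ᵥ g₁)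
      (((msqrt (A * Aᵀ))⁻¹ * A) *ᵥ (PP *ᵥ (eeDiag hr w * x)))
    rw [← e, ← hq] at h1
    have h2 := vnorm_mulVec_le_of_mul_transpose_eq_one (msqrt_inv_mul_mul_transpose hA)
      (PP *ᵥ (eeDiag hr w * x))
    rw [hPP, vnorm_symKron_mulVec he.orth, ← hPP] at h2
    have h3 : vnorm (eeDiag hr w * x) ^ 2 ≤ 4 * Eu := by
      rw [vnorm_sq, hEu, dotProduct, dotProduct, Finset.mul_sum]
      refine Finset.sum_le_sum fun p _ => ?_
      have := mul_le_mul_of_nonneg_right (eeDiag_le hr hpos hw p)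
        (mul_nonneg (eeDiag_pos hr hpos p).le (mul_self_nonneg (x p)))
      simp only [Pi.mul_apply]
      linarith
    have h4 := vnorm_msqrt_inv_mulVec_sq_le hA g₁
    have h5 := pow_le_pow_left₀ (vnorm_nonneg _) (vnorm_inl_le g₁ g₂) 2
    rw [← hG] at h5
    have h6 := h4.trans (mul_le_mul_of_nonneg_left h5 hα0)
    have h7 := pow_le_pow_left₀ hq0 (h1.trans (add_le_add_right h2 _)) 2
    nlinarith [sq_nonneg (vnorm ((msqrt (A * Aᵀ))⁻¹ *ᵥ g₁) - vnorm (eeDiag hr w * x))]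
  have hv2 : vnorm v ^ 2 ≤
      χ₂ ^ 2 * (4 * (‖(A * Aᵀ)⁻¹‖ * G ^ 2) + 16 * Eu + 128 * (Γ ^ 2 * Ev)) := by
    have h1 := pow_le_pow_left₀ (vnorm_nonneg _) hv 2
    rw [mul_pow] at h1
    refine h1.trans (mul_le_mul_of_nonneg_left ?_ (sq_nonneg _))
    -- From (q + 2F)² ≤ 2q² + 8F² and F² ≤ 16Γ²Ev; hence the coefficients 4, 16 and 128.
    nlinarith [sq_nonneg (q - 2 * F)]
  have hZ2 : Z ^ 2 = vnorm u ^ 2 + vnorm v ^ 2 := vnorm_sum_sq u v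
  exact le_of_energy_bounds hG0 hα0 hΓ1 hχ hEu0 hEv0 hE hZ2 hu hv2

/-- Upper bound for the augmented matrix. -/
theorem CenteredScaling.vnorm_augMat_le (h : CenteredScaling W X S Xs Ss μ L δ χ₁)
    (he : IsEigendecomp W P w) (hμ : 0 < μ) (hδ : δ < 1) (hL : 1 ≤ L) (hr : r < n)
    (hrank : Xs.rank ≤ r) (z : Fin m ⊕ VIdx n r → ℝ) :
    vnorm (augMat hr P w A *ᵥ z) ≤ (4 * ‖A‖ ^ 2 + 2 * ‖A‖ + L ^ 2 / (1 - δ)) * vnorm z := by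
  obtain ⟨u, v, rfl⟩ : ∃ u v, z = Sum.elim u v :=
    ⟨z ∘ Sum.inl, z ∘ Sum.inr, (Sum.elim_comp_inl_inr z).symm⟩
  have hpos := he.pos h.posDef
  have hw := he.antitone
  have hd : 0 < 1 - δ := by linarith
  have hτ := h.tau_le he hμ hδ hL hr hrank
  have hτ0 := tau_pos hr hpos
  have hΓ : 0 < L ^ 2 / (1 - δ) := by positivity
  set Γ := L ^ 2 / (1 - δ)
  rw [augMat_mulVec hr hpos hw]
  refine (vnorm_sum_le _ _).trans ?_
  set x := (symKron P P)ᵀ *ᵥ (Aᵀ *ᵥ u) with hx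
  have hxn : vnorm x ≤ ‖A‖ * vnorm u := by
    rw [hx, vnorm_symKron_transpose_mulVec he.orth, ← norm_transpose A]
    exact vnorm_mulVec_le _ _
  have h1 : vnorm (A *ᵥ (symKron P P *ᵥ (eeDiag hr w * x + vext hr v))) ≤
      ‖A‖ * (4 * (‖A‖ * vnorm u) + vnorm v) := by
    refine (vnorm_mulVec_le _ _).trans (mul_le_mul_of_nonneg_left ?_ (norm_nonneg _))
    rw [vnorm_symKron_mulVec he.orth]
    refine (vnorm_add_le _ _).trans ?_
    rw [vnorm_vext]
    have := vnorm_mul_le (d := eeDiag hr w) (c := 4) (by norm_num) (fun p => by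
      rw [abs_of_pos (eeDiag_pos hr hpos p)]; exact eeDiag_le hr hpos hw p) x
    linarith
  have h2 : vnorm (x ∘ vemb hr - dDiag hr w * v) ≤ ‖A‖ * vnorm u + Γ * vnorm v := by
    refine (vnorm_sub_le _ _).trans (add_le_add ((vnorm_comp_vemb_le hr x).trans hxn) ?_)
    refine vnorm_mul_le hΓ.le (fun q => ?_) v
    rw [abs_of_pos (dDiag_pos hr hpos hw q), dDiag, div_le_iff₀ (swt_vemb_pos hr hpos hw q)]
    have hj : ((vemb hr q).1.2 : ℕ) < r := (mem_range_vemb_iff hr _).1 ⟨q, rfl⟩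
    -- Multiplying τ ≤ Γ w i by 2τ ≤ w j for the top index j gives 2τ² ≤ Γ w i w j, at most 2Γ times
    -- the weight. So the entries of τ²Σ are at most Γ.
    have b1 := mul_le_two_mul_swt hr hpos hw (vemb hr q).1.1 (vemb hr q).1.2 hj
    have b2 := two_mul_tau_le hr hw hj
    have b3 := mul_le_mul (hτ (vemb hr q).1.1) b2 (by linarith)
      (mul_nonneg hΓ.le (hpos _).le)
    have b4 := mul_le_mul_of_nonneg_left b1 hΓ.le
    nlinarith
  have h3 := vnorm_inl_le u v
  have h4 := vnorm_inr_le u v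
  have ha := norm_nonneg A
  have c1 := mul_le_mul_of_nonneg_left h3 (by positivity : 0 ≤ 4 * ‖A‖ ^ 2 + ‖A‖)
  have c2 := mul_le_mul_of_nonneg_left h4 (by positivity : 0 ≤ ‖A‖ + Γ)
  linarith

end Conditioning

/-! ### The iteration bound -/

section IterationBound

/-- As κ ≥ 1 and ℓ ≥ 1/2, the loss of 1/2 from halving k costs at most κℓ, which leaves an exponent
of at least 9ℓ. The exponential is then at most (2 + y)⁻⁹, and (2 + y)⁹ dominates 32y. -/
theorem exp_bound {κ ℓ k y c e F : ℝ} {j : ℕ} (hκ : 1 ≤ κ) (hj : (k - 1) / 2 ≤ j)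
    (hk : 20 * κ * ℓ ≤ k) (hy : 0 ≤ y) (hℓ : ℓ = Real.log (2 + y)) (he : 0 < e)
    (hc : c * F ≤ 16 * e * y) :
    c * (2 * Real.exp (-(j * (1 / κ))) * F) ≤ e := by
  have hl2 : 1 / 2 ≤ ℓ := by
    rw [hℓ]
    have h1 := Real.log_two_gt_d9
    have h2 : Real.log 2 ≤ Real.log (2 + y) := Real.log_le_log (by norm_num) (by linarith)
    linarith
  have h1 : 9 * ℓ ≤ j * (1 / κ) := by
    rw [mul_one_div, le_div_iff₀ (by linarith)]
    nlinarith
  have h2 : Real.exp (-(j * (1 / κ))) ≤ ((2 + y) ^ 9)⁻¹ := by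
    have e1 : ((2 + y) ^ 9)⁻¹ = Real.exp (-(9 * ℓ)) := by
      rw [Real.exp_neg, show 9 * ℓ = ((9 : ℕ) : ℝ) * ℓ by norm_num, Real.exp_nat_mul, hℓ,
        Real.exp_log (by linarith)]
    rw [e1]
    exact Real.exp_le_exp.2 (by linarith)
  have h3 : 32 * y ≤ (2 + y) ^ 9 := by
    have : (2 : ℝ) ^ 8 ≤ (2 + y) ^ 8 := pow_le_pow_left₀ (by norm_num) (by linarith) 8
    rw [pow_succ]
    nlinarith
  have h4 : 0 < (2 + y) ^ 9 := by positivity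
  calc c * (2 * Real.exp (-(j * (1 / κ))) * F) = 2 * Real.exp (-(j * (1 / κ))) * (c * F) := by ring
    _ ≤ 2 * Real.exp (-(j * (1 / κ))) * (16 * e * y) :=
        mul_le_mul_of_nonneg_left hc (by positivity)
    _ = (32 * y * e) * Real.exp (-(j * (1 / κ))) := by ring
    _ ≤ (32 * y * e) * ((2 + y) ^ 9)⁻¹ := mul_le_mul_of_nonneg_left h2 (by positivity)
    _ = 32 * y * e / (2 + y) ^ 9 := by rw [div_eq_mul_inv]
    _ ≤ e := by
      rw [div_le_iff₀ h4]
      nlinarith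

/-- Each of the four terms of the expanded product is at most σ * (a2 * α), since a2 = α⁻¹ (a2 α)
and α = a2⁻¹ (a2 α). This is what σ is for: it compensates an unnormalized scaling of A. -/
theorem cond_bound {a2 α σ : ℝ} (ha : 0 < a2) (hα : 0 < α) (hc : 1 ≤ a2 * α) (h1 : 1 ≤ σ)
    (h2 : a2⁻¹ ≤ σ) (h3 : α⁻¹ ≤ σ) : (1 + a2) * (1 + α) ≤ 4 * (σ * (a2 * α)) := by
  have e1 : a2 ≤ σ * (a2 * α) := by
    have := mul_le_mul_of_nonneg_right h3 (by positivity : 0 ≤ a2 * α)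
    calc a2 = α⁻¹ * (a2 * α) := by field_simp
      _ ≤ _ := this
  have e2 : α ≤ σ * (a2 * α) := by
    have := mul_le_mul_of_nonneg_right h2 (by positivity : 0 ≤ a2 * α)
    calc α = a2⁻¹ * (a2 * α) := by field_simp
      _ ≤ _ := this
  have e3 : a2 * α ≤ σ * (a2 * α) := le_mul_of_one_le_left (by positivity) h1
  nlinarith

/-- The product of the upper and the inverse lower bound is of order Γ³ χ₂² (1 + a²)(1 + α). The
exponents 20, 19, 2 and 6 only weaken this, as L, χ₁, χ₂ and 1/d are at least 1; the constant is
10240 = 2560 * 4. -/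
theorem kappa_bound {a α σ L d χ₁ χ₂ : ℝ} (ha : 0 < a ^ 2) (hα : 0 < α) (hc : 1 ≤ a ^ 2 * α)
    (h1 : 1 ≤ σ) (h2 : (a ^ 2)⁻¹ ≤ σ) (h3 : α⁻¹ ≤ σ) (hL : 1 ≤ L) (hd0 : 0 < d) (hd1 : d ≤ 1)
    (hχ₁ : 1 ≤ χ₁) (hχ₂ : 1 ≤ χ₂) :
    (4 * a ^ 2 + 2 * a + L ^ 2 / d) * (2 * ((L ^ 2 / d) ^ 2 * χ₂ ^ 2 * (2 * α + 256))) ≤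
      10240 * (σ * (a ^ 2 * α) * L ^ 20 * (d ^ 19)⁻¹ * χ₁ ^ 2 * χ₂ ^ 6) := by
  have hΓ : 1 ≤ L ^ 2 / d := by rw [le_div_iff₀ hd0]; nlinarith
  have s1 : 4 * a ^ 2 + 2 * a + L ^ 2 / d ≤ 5 * (L ^ 2 / d) * (1 + a ^ 2) := by
    have : 1 + a ^ 2 ≤ L ^ 2 / d * (1 + a ^ 2) := le_mul_of_one_le_left (by positivity) hΓ
    nlinarith [sq_nonneg (a - 1), mul_nonneg (by linarith : 0 ≤ L ^ 2 / d) ha.le]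
  have s2 : 2 * α + 256 ≤ 256 * (1 + α) := by linarith
  have s3 : (L ^ 2 / d) ^ 3 ≤ L ^ 20 * (d ^ 19)⁻¹ := by
    rw [div_pow, ← pow_mul, div_eq_mul_inv]
    refine mul_le_mul (pow_le_pow_right₀ hL (by norm_num))
      (inv_anti₀ (by positivity) (pow_le_pow_of_le_one hd0.le hd1 (by norm_num)))
      (by positivity) (by positivity)
  have s4 : χ₂ ^ 2 ≤ χ₁ ^ 2 * χ₂ ^ 6 := by
    have := pow_le_pow_right₀ hχ₂ (show 2 ≤ 6 by norm_num)
    have := le_mul_of_one_le_left (by positivity : 0 ≤ χ₂ ^ 6) (one_le_pow₀ hχ₁ : 1 ≤ χ₁ ^ 2)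
    linarith
  have s5 := cond_bound ha hα hc h1 h2 h3
  have hσ : 0 < σ := by linarith
  calc _ ≤ 5 * (L ^ 2 / d) * (1 + a ^ 2) *
        (2 * ((L ^ 2 / d) ^ 2 * χ₂ ^ 2 * (256 * (1 + α)))) := by gcongr
    _ = 2560 * (((1 + a ^ 2) * (1 + α)) * (L ^ 2 / d) ^ 3 * χ₂ ^ 2) := by ring
    _ ≤ 2560 * (4 * (σ * (a ^ 2 * α)) * (L ^ 20 * (d ^ 19)⁻¹) * (χ₁ ^ 2 * χ₂ ^ 6)) := by gcongr
    _ = _ := by ring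

/-- Both bounds on X⋆ + S⋆ are tested on one unit vector, which exists since n > 0. -/
theorem CenteredScaling.one_le_chi {n : ℕ} (hn : 0 < n) {W X S Xs Ss : Matrix (Fin n) (Fin n) ℝ}
    {μ L δ χ₁ : ℝ} (h : CenteredScaling W X S Xs Ss μ L δ χ₁) (hχ : 0 < χ₁) : 1 ≤ χ₁ := by
  have h1 := h.strict_lower.dotProduct_mulVec_nonneg (Pi.single ⟨0, hn⟩ 1)
  have h2 := h.strict_upper.dotProduct_mulVec_nonneg (Pi.single ⟨0, hn⟩ 1)
  rw [star_trivial, Matrix.sub_mulVec, dotProduct_sub] at h1 h2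
  rw [Matrix.smul_mulVec, Matrix.one_mulVec, dotProduct_smul] at h1
  rw [Matrix.one_mulVec] at h2
  have h3 : (Pi.single ⟨0, hn⟩ 1 : Fin n → ℝ) ⬝ᵥ Pi.single ⟨0, hn⟩ 1 = 1 := by simp
  rw [h3] at h1 h2
  rw [smul_eq_mul, mul_one] at h1
  have : χ₁⁻¹ ≤ 1 := by linarith
  exact (inv_le_one₀ hχ).1 this

theorem iteration_bound {m n r : ℕ} (hr : r < n) (A : Matrix (Fin m) (SIdx n) ℝ)
    (W X S Xs Ss P : Matrix (Fin n) (Fin n) ℝ) (w : Fin n → ℝ)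
    (b : Fin m → ℝ) (C : Matrix (Fin n) (Fin n) ℝ) (μ L δ χ₁ χ₂ ε : ℝ)
    (hm : 0 < m) (hA : LinearIndependent ℝ A.row) (hμ : 0 < μ) (hμ1 : μ ≤ 1)
    (hL : 1 ≤ L) (hδ0 : 0 ≤ δ) (hδ : δ < 1) (hχ₁ : 0 < χ₁) (hε : 0 < ε)
    (h : CenteredScaling W X S Xs Ss μ L δ χ₁) (ht : TangentInjective A Xs χ₂)
    (hrank : Xs.rank ≤ r) (he : IsEigendecomp W P w) :
    (∀ k : ℕ, ∃! z, IsMinres (augMat hr P w A) (augRhs hr P w A b C) k z) ∧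
    ∀ k : ℕ,
      204800 * max 1 (max ‖A * Aᵀ‖⁻¹ ‖(A * Aᵀ)⁻¹‖⁻¹) * cond (A * Aᵀ) *
          L ^ 20 * ((1 - δ) ^ 19)⁻¹ * χ₁ ^ 2 * χ₂ ^ 6 *
          Real.log (2 + L ^ 4 * vnorm (augRhs hr P w A b C) / (μ * ε * (1 - δ) ^ 4)) ≤ k →
      ∀ z, IsMinres (augMat hr P w A) (augRhs hr P w A b C) k z →
        newtResidual W A b C (recoverX hr P w A C z) (recoverY hr w z) ≤ ε := by
  have hpos := he.pos h.posDef
  have hsymm := augMat_isSymm (P := P) hr hpos he.antitone A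
  have hd : 0 < 1 - δ := by linarith
  have hd1 : 1 - δ ≤ 1 := by linarith
  have hχ₂ : 1 ≤ χ₂ := ht.1
  have hχ₁' := h.one_le_chi (by omega) hχ₁
  have hlow := h.vnorm_le_augMat ht he hA hμ hδ0 hδ hL hr hrank
  have hup := h.vnorm_augMat_le (A := A) he hμ hδ hL hr hrank
  constructor
  · refine existsUnique_isMinres _ _ hsymm fun x hx => ?_
    have := hlow x
    rw [hx, vnorm_eq_zero.2 (rfl : (0 : Fin m ⊕ VIdx n r → ℝ) = 0), mul_zero] at this
    exact vnorm_eq_zero.1 (le_antisymm this (vnorm_nonneg _))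
  intro k hk z hz
  have hΓ : 1 ≤ L ^ 2 / (1 - δ) := by rw [le_div_iff₀ hd]; nlinarith
  have hτ := h.le_four_mul_tau he hμ hδ hL hr
  have hτ0 := tau_pos hr hpos
  have hc1 : 1 ≤ 16 * L ^ 2 / ((1 - δ) * μ) := by
    rw [le_div_iff₀ (mul_pos hd hμ)]
    have : (1 - δ) * μ ≤ 1 * 1 := mul_le_mul hd1 hμ1 hμ.le zero_le_one
    nlinarith
  -- From √((1-δ)μ) ≤ 4Lτ. This is the only place where 1/μ enters the estimate, and it ends up
  -- inside the logarithm.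
  have hc2 : (tau hr w ^ 2)⁻¹ ≤ 16 * L ^ 2 / ((1 - δ) * μ) := by
    have h1 := pow_le_pow_left₀ (Real.sqrt_nonneg _) hτ 2
    rw [Real.sq_sqrt (mul_pos hd hμ).le] at h1
    rw [inv_eq_one_div, div_le_div_iff₀ (by positivity) (mul_pos hd hμ)]
    linarith
  have hposdef := posDef_mul_transpose hA
  have hu := (Matrix.isUnit_iff_isUnit_det _).1 hposdef.isUnit
  have : Nonempty (Fin m) := ⟨⟨0, hm⟩⟩
  have hcond : 1 ≤ ‖A‖ ^ 2 * ‖(A * Aᵀ)⁻¹‖ := by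
    rw [← norm_mul_transpose_self]
    have h1 := Matrix.l2_opNorm_mul (A * Aᵀ) (A * Aᵀ)⁻¹
    rw [Matrix.mul_nonsing_inv _ hu] at h1
    have h2 : ‖(1 : Matrix (Fin m) (Fin m) ℝ)‖ = 1 := by
      rw [← Matrix.diagonal_one, Matrix.l2_opNorm_diagonal]
      exact (pi_norm_const (1 : ℝ)).trans (by simp)
    linarith
  have ha2 : 0 < ‖A‖ ^ 2 := lt_of_le_of_ne (sq_nonneg _) fun e => by
    rw [← e] at hcond; linarith
  have hα : 0 < ‖(A * Aᵀ)⁻¹‖ := lt_of_le_of_ne (norm_nonneg _) fun e => by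
    rw [← e] at hcond; linarith
  rw [cond, norm_mul_transpose_self] at hk
  set σ := max 1 (max (‖A‖ ^ 2)⁻¹ ‖(A * Aᵀ)⁻¹‖⁻¹)
  have hκ := kappa_bound (σ := σ) ha2 hα hcond (le_max_left _ _)
    ((le_max_left _ _).trans (le_max_right _ _)) ((le_max_right _ _).trans (le_max_right _ _))
    hL hd hd1 hχ₁' hχ₂
  set B := 4 * ‖A‖ ^ 2 + 2 * ‖A‖ + L ^ 2 / (1 - δ) with hB
  set β := 2 * ((L ^ 2 / (1 - δ)) ^ 2 * χ₂ ^ 2 * (2 * ‖(A * Aᵀ)⁻¹‖ + 256)) with hβ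
  have hB1 : 1 ≤ B := by
    have := norm_nonneg A
    have := sq_nonneg ‖A‖
    linarith
  have hβ1 : 1 ≤ β := by
    have e1 : 1 ≤ (L ^ 2 / (1 - δ)) ^ 2 := one_le_pow₀ hΓ
    have e2 : 1 ≤ χ₂ ^ 2 := one_le_pow₀ hχ₂
    have e3 : 1 ≤ (L ^ 2 / (1 - δ)) ^ 2 * χ₂ ^ 2 := one_le_mul_of_one_le_of_one_le e1 e2
    nlinarith
  -- The spectrum of M satisfies 1/β ≤ |c| ≤ B, so the rate is governed by B * β.
  have hres := hz.residual_le _ _ hsymm (a := 1 / β) (b := B) (by positivity)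
    (by rw [div_le_iff₀ (by linarith)]; nlinarith)
    (fun x => by rw [one_div, inv_mul_le_iff₀ (by linarith)]; exact hlow x) hup
  set F := vnorm (augRhs hr P w A b C) with hF
  have hF0 : 0 ≤ F := vnorm_nonneg _
  refine (newtResidual_le hr he hpos A b C z hc1 hc2).trans
    ((mul_le_mul_of_nonneg_left hres (by positivity)).trans ?_)
  rw [show 1 / β / B = 1 / (B * β) by rw [div_div, mul_comm]]
  set y := L ^ 4 * F / (μ * ε * (1 - δ) ^ 4) with hy
  have hy0 : 0 ≤ y := by positivity
  have hℓ : 0 ≤ Real.log (2 + y) := Real.log_nonneg (by linarith)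
  refine exp_bound (k := k) (y := y) (one_le_mul_of_one_le_of_one_le hB1 hβ1) ?_ ?_ hy0 rfl hε ?_
  -- The Chebyshev polynomial has index ⌊k/2⌋ ≥ (k - 1)/2.
  · rw [div_le_iff₀ two_pos]
    have : k ≤ k / 2 * 2 + 1 := by omega
    have : (k : ℝ) ≤ (k / 2 : ℕ) * 2 + 1 := by exact_mod_cast this
    linarith
  · refine le_trans ?_ hk
    have := mul_le_mul_of_nonneg_right hκ hℓ
    calc 20 * (B * β) * Real.log (2 + y) = 20 * (B * β * Real.log (2 + y)) := by ring
      _ ≤ _ := mul_le_mul_of_nonneg_left this (by norm_num)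
      _ = _ := by ring
  -- The logarithm carries a spare factor L²/(1-δ)³ ≥ 1 beyond what the loss 16L²/((1-δ)μ) requires.
  · have e1 : 16 * ε * y = 16 * L ^ 2 / ((1 - δ) * μ) * F * (L ^ 2 / (1 - δ) ^ 3) := by
      rw [hy]; field_simp
    rw [e1]
    refine le_mul_of_one_le_right (by positivity) ?_
    rw [le_div_iff₀ (by positivity)]
    have : (1 - δ) ^ 3 ≤ 1 := pow_le_one₀ hd.le hd1
    nlinarith

end IterationBound

/-! ### Programs: expressions and loops -/

section Programs

/-- The array of scratch cells for the evaluation of expressions. -/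
abbrev scr : ℕ := 39

/-- Arithmetic expressions over memory cells. -/
inductive SE where
  | ref (a : ℕ) (off : IExp)
  | rat (q : ℚ)
  | op (o : BinOp) (x y : SE)

/-- Value of an expression. -/
def SE.eval (ρ : ℕ → ℕ) (M : Mem) : SE → ℝ
  | ref a off => M a (off.eval ρ)
  | rat q => q
  | op o x y => o.eval (x.eval ρ M) (y.eval ρ M)

/-- The expression does not refer to the scratch array. -/
def SE.Clean : SE → Prop
  | ref a _ => a ≠ scr
  | rat _ => True
  | op _ x y => x.Clean ∧ y.Clean

/-- Number of scratch cells beyond the first. -/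
def SE.depth : SE → ℕ
  | ref _ _ => 0
  | rat _ => 0
  | op _ x y => max x.depth (y.depth + 1)

/-- Time of an evaluation. -/
def SE.cost : SE → ℕ
  | ref _ _ => 2
  | rat _ => 1
  | op _ x y => x.cost + y.cost + 1

/-- All referenced cells lie in the first `40` arrays, at offsets below `N`. -/
def SE.Within (N : ℕ) (ρ : ℕ → ℕ) : SE → Prop
  | ref a off => a < 40 ∧ off.eval ρ < N
  | rat _ => True
  | op _ x y => x.Within N ρ ∧ y.Within N ρ

/-- Evaluation of an expression into cell `t` of the scratch array. -/
def SE.comp (t : ℕ) : SE → Prog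
  | ref a off => .seq (.const ⟨scr, .const t⟩ 0) (.binop .add ⟨scr, .const t⟩ ⟨a, off⟩ ⟨scr, .const t⟩)
  | rat q => .const ⟨scr, .const t⟩ q
  | op o x y => .seq (.seq (x.comp t) (y.comp (t + 1)))
      (.binop o ⟨scr, .const t⟩ ⟨scr, .const t⟩ ⟨scr, .const (t + 1)⟩)

/-- Assignment of the value of an expression. -/
def assign (a : ℕ) (off : IExp) (e : SE) : Prog :=
  .seq (e.comp 0) (.seq (.const ⟨scr, .const 1⟩ 0)
    (.binop .add ⟨a, off⟩ ⟨scr, .const 0⟩ ⟨scr, .const 1⟩))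

/-- Two memories agree outside the scratch array. -/
def EqT (M M' : Mem) : Prop := ∀ a, a ≠ scr → M' a = M a

theorem Mem.set_self (M : Mem) (a o : ℕ) (x : ℝ) : M.set (a, o) x a o = x := by
  simp [Mem.set]

theorem Mem.set_of_ne (M : Mem) {a b : ℕ} (h : b ≠ a) (o : ℕ) (x : ℝ) :
    M.set (a, o) x b = M b := by
  simp [Mem.set, h]

theorem Mem.set_offset_of_ne (M : Mem) (a : ℕ) {o o' : ℕ} (h : o' ≠ o) (x : ℝ) :
    M.set (a, o) x a o' = M a o' := by
  simp [Mem.set, h]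

theorem SE.eval_congr {ρ : ℕ → ℕ} {M M' : Mem} (h : EqT M M') {e : SE} (he : e.Clean) :
    e.eval ρ M' = e.eval ρ M := by
  induction e with
  | ref a off => simp only [SE.eval]; rw [h a he]
  | rat q => rfl
  | op o x y hx hy => simp only [SE.eval]; rw [hx he.1, hy he.2]

variable {m n : ℕ} (Θ : Subroutines m n)

/-- Scratch cells below t are preserved, so the value of the left operand in cell t survives the
evaluation of the right operand into cell t + 1. -/
theorem SE.comp_spec (ρ : ℕ → ℕ) {e : SE} (he : e.Clean) (t : ℕ) (M : Mem) :
    EqT M ((e.comp t).run Θ ρ M).mem ∧ ((e.comp t).run Θ ρ M).mem scr t = e.eval ρ M ∧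
      ∀ s < t, ((e.comp t).run Θ ρ M).mem scr s = M scr s := by
  induction e generalizing t M with
  | ref a off =>
    refine ⟨fun b hb => ?_, ?_, fun s hs => ?_⟩
    · simp only [SE.comp, Prog.run, Ref.cell, IExp.eval]
      rw [Mem.set_of_ne _ hb, Mem.set_of_ne _ hb]
    · simp only [SE.comp, Prog.run, Ref.cell, IExp.eval, SE.eval, BinOp.eval]
      rw [Mem.set_self, Mem.set_self, Mem.set_of_ne _ he]; simp
    · simp only [SE.comp, Prog.run, Ref.cell, IExp.eval]
      rw [Mem.set_offset_of_ne _ _ hs.ne, Mem.set_offset_of_ne _ _ hs.ne]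
  | rat q =>
    refine ⟨fun b hb => ?_, ?_, fun s hs => ?_⟩
    · simp only [SE.comp, Prog.run, Ref.cell, IExp.eval]
      rw [Mem.set_of_ne _ hb]
    · simp only [SE.comp, Prog.run, Ref.cell, IExp.eval, SE.eval]
      rw [Mem.set_self]
    · simp only [SE.comp, Prog.run, Ref.cell, IExp.eval]
      rw [Mem.set_offset_of_ne _ _ hs.ne]
  | op o x y hx hy =>
    obtain ⟨x1, x2, x3⟩ := hx he.1 t M
    obtain ⟨y1, y2, y3⟩ := hy he.2 (t + 1) ((x.comp t).run Θ ρ M).mem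
    refine ⟨fun b hb => ?_, ?_, fun s hs => ?_⟩
    · simp only [SE.comp, Prog.run, Ref.cell, IExp.eval]
      rw [Mem.set_of_ne _ hb, y1 b hb, x1 b hb]
    · simp only [SE.comp, Prog.run, Ref.cell, IExp.eval, SE.eval]
      rw [Mem.set_self, y2, y3 t (by omega), x2, SE.eval_congr x1 he.2]
    · simp only [SE.comp, Prog.run, Ref.cell, IExp.eval]
      rw [Mem.set_offset_of_ne _ _ hs.ne, y3 s (by omega), x3 s hs]

/-- The machine moves a value by adding zero: cell 1 of the scratch array is cleared after the
evaluation and serves as the second summand. -/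
theorem assign_spec (ρ : ℕ → ℕ) {e : SE} (he : e.Clean) {a : ℕ} (ha : a ≠ scr) (off : IExp)
    (M : Mem) : EqT (M.set (a, off.eval ρ) (e.eval ρ M)) ((assign a off e).run Θ ρ M).mem := by
  obtain ⟨h1, h2, -⟩ := SE.comp_spec Θ ρ he 0 M
  intro b hb
  have hne : (0 : ℕ) ≠ 1 := by norm_num
  simp only [assign, Prog.run, Ref.cell, IExp.eval, BinOp.eval]
  rw [Mem.set_self, Mem.set_offset_of_ne _ _ hne, h2, Rat.cast_zero, add_zero]
  by_cases hba : b = a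
  · subst hba
    ext o
    by_cases ho : o = off.eval ρ
    · subst ho; rw [Mem.set_self, Mem.set_self]
    · rw [Mem.set_offset_of_ne _ _ ho, Mem.set_offset_of_ne _ _ ho, Mem.set_of_ne _ hb, h1 b hb]
  · rw [Mem.set_of_ne _ hba, Mem.set_of_ne _ hba, Mem.set_of_ne _ hb, h1 b hb]

theorem loop_inv (v : ℕ) (count : IExp) (body : Prog) (ρ : ℕ → ℕ) (M : Mem)
    (Inv : ℕ → Mem → Prop) (h0 : Inv 0 M)
    (hs : ∀ i < count.eval ρ, ∀ M₁, Inv i M₁ →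
      Inv (i + 1) (body.run Θ (Function.update ρ v i) M₁).mem) :
    Inv (count.eval ρ) ((Prog.loop v count body).run Θ ρ M).mem := by
  simp only [Prog.run]
  have key : ∀ j ≤ count.eval ρ, Inv j (Nat.rec (motive := fun _ => Outcome) ⟨M, 1, ∅⟩
      (fun i o => let o' := body.run Θ (Function.update ρ v i) o.mem
        ⟨o'.mem, o.time + o'.time + 1, o.used ∪ o'.used⟩) j).mem := by
    intro j
    induction j with
    | zero => intro _; exact h0
    | succ j ih => intro hj; exact hs j (by omega) _ (ih (by omega))
  exact key _ le_rfl

theorem loop_res (v : ℕ) (count : IExp) (body : Prog) (ρ : ℕ → ℕ) (M : Mem) (t : ℕ)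
    (U : Finset (ℕ × ℕ))
    (hs : ∀ i < count.eval ρ, ∀ M₁, (body.run Θ (Function.update ρ v i) M₁).time ≤ t ∧
      (body.run Θ (Function.update ρ v i) M₁).used ⊆ U) :
    ((Prog.loop v count body).run Θ ρ M).time ≤ count.eval ρ * (t + 1) + 1 ∧
      ((Prog.loop v count body).run Θ ρ M).used ⊆ U := by
  simp only [Prog.run]
  have key : ∀ j ≤ count.eval ρ,
      (Nat.rec (motive := fun _ => Outcome) ⟨M, 1, ∅⟩
        (fun i o => let o' := body.run Θ (Function.update ρ v i) o.mem
          ⟨o'.mem, o.time + o'.time + 1, o.used ∪ o'.used⟩) j : Outcome).time ≤ j * (t + 1) + 1 ∧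
      (Nat.rec (motive := fun _ => Outcome) ⟨M, 1, ∅⟩
        (fun i o => let o' := body.run Θ (Function.update ρ v i) o.mem
          ⟨o'.mem, o.time + o'.time + 1, o.used ∪ o'.used⟩) j : Outcome).used ⊆ U := by
    intro j
    induction j with
    | zero => intro _; exact ⟨by simp, Finset.empty_subset _⟩
    | succ j ih =>
      intro hj
      obtain ⟨i1, i2⟩ := ih (by omega)
      obtain ⟨b1, b2⟩ := hs j (by omega) (Nat.rec (motive := fun _ => Outcome) ⟨M, 1, ∅⟩
        (fun i o => let o' := body.run Θ (Function.update ρ v i) o.mem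
          ⟨o'.mem, o.time + o'.time + 1, o.used ∪ o'.used⟩) j : Outcome).mem
      exact ⟨(Nat.add_le_add (Nat.add_le_add i1 b1) le_rfl).trans (le_of_eq (by ring)),
        Finset.union_subset i2 b2⟩
  exact key _ le_rfl

/-- `M₁` is `M` with the first `c` cells of array `d` replaced by the values of `f`, up to the
scratch array. -/
def Filled (M M₁ : Mem) (d c : ℕ) (f : ℕ → ℝ) : Prop :=
  (∀ a, a ≠ scr → a ≠ d → M₁ a = M a) ∧ ∀ o, M₁ d o = if o < c then f o else M d o

theorem Filled.zero {M : Mem} {d : ℕ} {f : ℕ → ℝ} : Filled M M d 0 f :=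
  ⟨fun _ _ _ => rfl, fun o => by simp⟩

theorem Filled.step {M M₁ M₂ : Mem} {d c : ℕ} {f : ℕ → ℝ} (h : Filled M M₁ d c f) (hd : d ≠ scr)
    {x : ℝ} (h2 : EqT (M₁.set (d, c) x) M₂) (hx : x = f c) : Filled M M₂ d (c + 1) f := by
  refine ⟨fun a ha had => ?_, fun o => ?_⟩
  · rw [h2 a ha, Mem.set_of_ne _ had, h.1 a ha had]
  · rw [h2 d hd]
    rcases lt_trichotomy o c with ho | rfl | ho
    · rw [Mem.set_offset_of_ne _ _ ho.ne, h.2, if_pos ho, if_pos (by omega)]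
    · rw [Mem.set_self, if_pos (by omega), hx]
    · rw [Mem.set_offset_of_ne _ _ ho.ne', h.2, if_neg (by omega), if_neg (by omega)]

/-- Fill the first `N` cells of an array; the position is variable `4`. -/
def vmap (N : IExp) (d : ℕ) (e : SE) : Prog := .loop 4 N (assign d (.var 4) e)

/-- At position o, the target array has only been changed before o. The expression may therefore
read the current entry of its own target, which permits updates in place. -/
theorem vmap_spec (N : IExp) {d : ℕ} (hd : d ≠ scr) {e : SE} (he : e.Clean) (ρ : ℕ → ℕ) (M : Mem)
    (f : ℕ → ℝ) (hf : ∀ o < N.eval ρ, ∀ M₁ : Mem, (∀ a, a ≠ scr → a ≠ d → M₁ a = M a) →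
      M₁ d o = M d o → e.eval (Function.update ρ 4 o) M₁ = f o) :
    Filled M ((vmap N d e).run Θ ρ M).mem d (N.eval ρ) f := by
  refine loop_inv Θ 4 N _ ρ M (fun i M₁ => Filled M M₁ d i f) Filled.zero fun i hi M₁ h => ?_
  have := assign_spec Θ (Function.update ρ 4 i) he hd (.var 4) M₁
  simp only [IExp.eval, Function.update_self] at this
  exact h.step hd this (hf i hi M₁ h.1 (by rw [h.2]; simp))

/-- Double loop over the entries of an `n × n` matrix; row and column are variables `4`, `5`. -/
def loop2 (body : Prog) : Prog := .loop 4 (.var 0) (.loop 5 (.var 0) body)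

/-- The offset of entry `(i, j)` where `i`, `j` are variables. -/
abbrev pos (i j : ℕ) : IExp := .add (.mul (.var i) (.var 0)) (.var j)

/-- With storage by rows, the double loop writes the cells in linear order, so one invariant with i
* n + j filled cells serves both loops. -/
theorem loop2_spec {d : ℕ} (hd : d ≠ scr) (body : Prog) (ρ : ℕ → ℕ) (h0 : ρ 0 = n) (M : Mem)
    (f : ℕ → ℕ → ℝ)
    (hf : ∀ i < n, ∀ j < n, ∀ M₁ : Mem, (∀ a, a ≠ scr → a ≠ d → M₁ a = M a) →
      EqT (M₁.set (d, i * n + j) (f i j))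
        (body.run Θ (Function.update (Function.update ρ 4 i) 5 j) M₁).mem) :
    Filled M ((loop2 body).run Θ ρ M).mem d (n * n) fun o => f (o / n) (o % n) := by
  have e0 : (IExp.var 0).eval ρ = n := h0
  have := loop_inv Θ 4 (.var 0) (.loop 5 (.var 0) body) ρ M
    (fun i M₁ => Filled M M₁ d (i * n) fun o => f (o / n) (o % n))
    (by rw [zero_mul]; exact Filled.zero) fun i hi M₁ h => ?_
  · rwa [e0] at this
  rw [e0] at hi
  have e1 : (IExp.var 0).eval (Function.update ρ 4 i) = n := by simp [IExp.eval, h0]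
  have h2 := loop_inv Θ 5 (.var 0) body (Function.update ρ 4 i) M₁
    (fun j M₁ => Filled M M₁ d (i * n + j) fun o => f (o / n) (o % n)) h fun j hj M₁ h' => ?_
  · rw [e1] at h2
    rwa [Nat.add_mul, one_mul]
  rw [e1] at hj
  refine h'.step hd (hf i hi j hj M₁ h'.1) ?_
  have hn : 0 < n := by omega
  rw [Nat.mul_comm i n, Nat.mul_add_div hn, Nat.div_eq_of_lt hj, Nat.mul_add_mod,
    Nat.mod_eq_of_lt hj, add_zero]

theorem Filled.getMat {M M₁ : Mem} {d : ℕ} {f : ℕ → ℝ} (h : Filled M M₁ d (n * n) f) :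
    M₁.getMat n d = Matrix.of fun i j : Fin n => f ((i : ℕ) * n + j) := by
  ext i j
  have : (i : ℕ) * n + j < n * n := by
    have := Nat.mul_le_mul_right n (Nat.succ_le_of_lt i.2)
    rw [Nat.succ_mul] at this
    omega
  simp only [Mem.getMat, Matrix.of_apply, h.2, if_pos this]

theorem Filled.getMat₂ {M M₁ : Mem} {d : ℕ} {f : ℕ → ℕ → ℝ}
    (h : Filled M M₁ d (n * n) fun o => f (o / n) (o % n)) :
    M₁.getMat n d = Matrix.of fun i j : Fin n => f i j := by
  rw [h.getMat]
  ext i j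
  have hn : 0 < n := i.pos
  simp only [Matrix.of_apply]
  rw [Nat.mul_comm (i : ℕ) n, Nat.mul_add_div hn, Nat.div_eq_of_lt j.2, Nat.mul_add_mod,
    Nat.mod_eq_of_lt j.2, add_zero]

theorem Filled.getVec {M M₁ : Mem} {d : ℕ} {f : ℕ → ℝ} (h : Filled M M₁ d m f) :
    M₁.getVec m d = fun i : Fin m => f i := by
  ext i
  simp only [Mem.getVec, h.2, if_pos i.2]

/-- Matrix product into array `d`; the entry `(i, l)` of the left factor is at offset `xo` of array
`x`, the entry `(l, j)` of the right factor at offset `yo` of array `y`, where `i`, `j`, `l` are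
variables `4`, `5`, `6`. -/
def matmul (d x : ℕ) (xo : IExp) (y : ℕ) (yo : IExp) : Prog :=
  loop2 (.seq (assign d (pos 4 5) (.rat 0)) (.loop 6 (.var 0)
    (assign d (pos 4 5) (.op .add (.ref d (pos 4 5)) (.op .mul (.ref x xo) (.ref y yo))))))

/-- The offsets are arbitrary index expressions, which lets one program cover all transposed
variants. The target must differ from both factors, because its entries are overwritten while the
factors are still read. -/
theorem matmul_spec {d x y : ℕ} (hd : d ≠ scr) (hx : x ≠ scr) (hy : y ≠ scr) (hxd : x ≠ d)
    (hyd : y ≠ d) (xo yo : IExp) (ρ : ℕ → ℕ) (h0 : ρ 0 = n) (M : Mem) (X Y : ℕ → ℕ → ℝ)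
    (hX : ∀ i j l, i < n → l < n →
      M x (xo.eval (Function.update (Function.update (Function.update ρ 4 i) 5 j) 6 l)) = X i l)
    (hY : ∀ i j l, l < n → j < n →
      M y (yo.eval (Function.update (Function.update (Function.update ρ 4 i) 5 j) 6 l)) = Y l j) :
    Filled M ((matmul d x xo y yo).run Θ ρ M).mem d (n * n)
      fun o => ∑ l ∈ Finset.range n, X (o / n) l * Y l (o % n) := by
  refine loop2_spec Θ hd _ ρ h0 M (fun i j => ∑ l ∈ Finset.range n, X i l * Y l j)
    fun i hi j hj M₁ hM₁ => ?_
  set ρ' := Function.update (Function.update ρ 4 i) 5 j with hρ'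
  have p0 : ∀ l, (pos 4 5).eval (Function.update ρ' 6 l) = i * n + j := by
    intro l; simp [IExp.eval, hρ', h0]
  have p1 : (pos 4 5).eval ρ' = i * n + j := by simp [IExp.eval, hρ', h0]
  have c0 : (IExp.var 0).eval ρ' = n := by simp [IExp.eval, hρ', h0]
  simp only [Prog.run.eq_4]
  have a0 := assign_spec Θ ρ' (e := .rat 0) trivial hd (pos 4 5) M₁
  rw [p1] at a0
  set M₂ := ((assign d (pos 4 5) (.rat 0)).run Θ ρ' M₁).mem
  -- The partial inner product is accumulated in the target cell itself.
  have := loop_inv Θ 6 (.var 0) (assign d (pos 4 5) (.op .add (.ref d (pos 4 5))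
    (.op .mul (.ref x xo) (.ref y yo)))) ρ' M₂
    (fun l M₃ => EqT (M₁.set (d, i * n + j) (∑ l ∈ Finset.range l, X i l * Y l j)) M₃) ?_ ?_
  · rwa [c0] at this
  · simpa [SE.eval] using a0
  · intro l hl M₃ h3
    rw [c0] at hl
    have a1 := assign_spec Θ (Function.update ρ' 6 l) (e := .op .add (.ref d (pos 4 5))
      (.op .mul (.ref x xo) (.ref y yo))) ⟨hd, hx, hy⟩ hd (pos 4 5) M₃
    simp only [SE.eval, BinOp.eval, p0] at a1
    rw [h3 d hd, Mem.set_self, h3 x hx, Mem.set_of_ne _ hxd, hM₁ x hx hxd, h3 y hy,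
      Mem.set_of_ne _ hyd, hM₁ y hy hyd, hX i j l hi hl, hY i j l hl hj,
      ← Finset.sum_range_succ (fun l => X i l * Y l j)] at a1
    intro a ha
    rw [a1 a ha]
    by_cases had : a = d
    · subst had
      ext o
      by_cases ho : o = i * n + j
      · subst ho; rw [Mem.set_self, Mem.set_self]
      · rw [Mem.set_offset_of_ne _ _ ho, Mem.set_offset_of_ne _ _ ho, h3 a ha,
          Mem.set_offset_of_ne _ _ ho]
    · rw [Mem.set_of_ne _ had, Mem.set_of_ne _ had, h3 a ha, Mem.set_of_ne _ had]

end Programs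

/-! ### Time and storage -/

section Resources

/-- The cells that programs may use. -/
def pool (n : ℕ) : Finset (ℕ × ℕ) := Finset.range 40 ×ˢ Finset.range (n * n + 8)

theorem mem_pool {n : ℕ} {c : ℕ × ℕ} : c ∈ pool n ↔ c.1 < 40 ∧ c.2 < n * n + 8 := by
  simp [pool]

theorem cells_subset_pool {n a s : ℕ} (ha : a < 40) (hs : s ≤ n * n) : cells a s ⊆ pool n := by
  intro c hc
  simp only [cells, Finset.mem_product, Finset.mem_singleton, Finset.mem_range] at hc
  rw [mem_pool]; omega

theorem pos_lt {n i j : ℕ} (hi : i < n) (hj : j < n) : i * n + j < n * n := by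
  have := Nat.mul_le_mul_right n (Nat.succ_le_of_lt hi)
  rw [Nat.succ_mul] at this
  omega

variable {m n : ℕ} (Θ : Subroutines m n)

/-- The 8 extra cells per array of the pool make room for the scratch cells of any expression of
small depth, whatever n is. -/
theorem SE.comp_res (ρ : ℕ → ℕ) {e : SE} (he : e.Within (n * n + 8) ρ) (t : ℕ)
    (ht : t + e.depth < 8) (M : Mem) :
    ((e.comp t).run Θ ρ M).time ≤ e.cost ∧ ((e.comp t).run Θ ρ M).used ⊆ pool n := by
  induction e generalizing t M with
  | ref a off =>
    simp only [SE.depth] at ht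
    refine ⟨le_rfl, ?_⟩
    simp only [SE.comp, Prog.run, Ref.cell, IExp.eval]
    intro c hc
    simp only [Finset.mem_union, Finset.mem_insert, Finset.mem_singleton] at hc
    rw [mem_pool]
    rcases hc with rfl | rfl | rfl | rfl
    · exact ⟨by norm_num, by simp only; omega⟩
    · exact ⟨by norm_num, by simp only; omega⟩
    · exact he
    · exact ⟨by norm_num, by simp only; omega⟩
  | rat q =>
    simp only [SE.depth] at ht
    refine ⟨le_rfl, ?_⟩
    simp only [SE.comp, Prog.run, Ref.cell, IExp.eval]
    rw [Finset.singleton_subset_iff, mem_pool]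
    exact ⟨by norm_num, by simp only; omega⟩
  | op o x y hx hy =>
    simp only [SE.depth] at ht
    have h1 := le_max_left x.depth (y.depth + 1)
    have h2 := le_max_right x.depth (y.depth + 1)
    obtain ⟨x1, x2⟩ := hx he.1 t (by omega) M
    obtain ⟨y1, y2⟩ := hy he.2 (t + 1) (by omega) ((x.comp t).run Θ ρ M).mem
    simp only [SE.comp, Prog.run, Ref.cell, IExp.eval, SE.cost]
    refine ⟨by omega, Finset.union_subset (Finset.union_subset x2 y2) ?_⟩
    intro c hc
    simp only [Finset.mem_insert, Finset.mem_singleton] at hc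
    rw [mem_pool]
    rcases hc with rfl | rfl | rfl
    · exact ⟨by norm_num, by simp only; omega⟩
    · exact ⟨by norm_num, by simp only; omega⟩
    · exact ⟨by norm_num, by simp only; omega⟩

theorem assign_res (ρ : ℕ → ℕ) {e : SE} (he : e.Within (n * n + 8) ρ) (hd : e.depth < 8) {a : ℕ}
    (ha : a < 40) {off : IExp} (hoff : off.eval ρ < n * n + 8) (M : Mem) :
    ((assign a off e).run Θ ρ M).time ≤ e.cost + 2 ∧
      ((assign a off e).run Θ ρ M).used ⊆ pool n := by
  obtain ⟨h1, h2⟩ := SE.comp_res Θ ρ he 0 (by omega) M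
  simp only [assign, Prog.run, Ref.cell, IExp.eval]
  refine ⟨by omega, Finset.union_subset h2 ?_⟩
  intro c hc
  simp only [Finset.mem_union, Finset.mem_insert, Finset.mem_singleton] at hc
  rw [mem_pool]
  rcases hc with rfl | rfl | rfl | rfl
  · exact ⟨by norm_num, by simp only; omega⟩
  · exact ⟨ha, hoff⟩
  · exact ⟨by norm_num, by simp only; omega⟩
  · exact ⟨by norm_num, by simp only; omega⟩

/-- Admissible index environments and subroutine costs. -/
structure Fits (c : ℕ) (Θ : Subroutines m n) (ρ : ℕ → ℕ) : Prop where
  var0 : ρ 0 = n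
  var1 : ρ 1 = m
  var2 : ρ 2 < n
  le : m ≤ n * n
  timeA : Θ.timeA ≤ c * n ^ 3
  timeAT : Θ.timeAT ≤ c * n ^ 3
  timeEig : Θ.timeEig ≤ c * n ^ 3

theorem Fits.update {c : ℕ} {Θ : Subroutines m n} {ρ : ℕ → ℕ} (h : Fits c Θ ρ) {v : ℕ}
    (hv : 3 ≤ v) (i : ℕ) : Fits c Θ (Function.update ρ v i) where
  var0 := by rw [Function.update_of_ne (by omega), h.var0]
  var1 := by rw [Function.update_of_ne (by omega), h.var1]
  var2 := by rw [Function.update_of_ne (by omega)]; exact h.var2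
  le := h.le
  timeA := h.timeA
  timeAT := h.timeAT
  timeEig := h.timeEig

/-- The program runs in time `O(n ^ 3)` within the pool. -/
def Cheap (p : Prog) : Prop :=
  ∀ c : ℕ, ∃ K : ℕ, ∀ (m n : ℕ) (Θ : Subroutines m n) (ρ : ℕ → ℕ), Fits c Θ ρ → ∀ M : Mem,
    (p.run Θ ρ M).time ≤ K * n ^ 3 ∧ (p.run Θ ρ M).used ⊆ pool n

theorem Fits.pos {c : ℕ} {Θ : Subroutines m n} {ρ : ℕ → ℕ} (h : Fits c Θ ρ) : 0 < n :=
  (Nat.zero_le _).trans_lt h.var2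

theorem Cheap.seq {p q : Prog} (hp : Cheap p) (hq : Cheap q) : Cheap (.seq p q) := by
  intro c
  obtain ⟨K₁, h₁⟩ := hp c
  obtain ⟨K₂, h₂⟩ := hq c
  refine ⟨K₁ + K₂, fun m n Θ ρ h M => ?_⟩
  obtain ⟨a1, a2⟩ := h₁ m n Θ ρ h M
  obtain ⟨b1, b2⟩ := h₂ m n Θ ρ h (p.run Θ ρ M).mem
  refine ⟨?_, Finset.union_subset a2 b2⟩
  rw [Nat.add_mul]
  exact Nat.add_le_add a1 b1

theorem cheap_assign {a : ℕ} {off : IExp} {e : SE} (ha : a < 40) (hd : e.depth < 8)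
    (h : ∀ n ρ, ρ 0 = n → ρ 2 < n → off.eval ρ < n * n + 8 ∧ e.Within (n * n + 8) ρ) :
    Cheap (assign a off e) := by
  refine fun c => ⟨e.cost + 2, fun m n Θ ρ hf M => ?_⟩
  obtain ⟨h1, h2⟩ := h n ρ hf.var0 hf.var2
  obtain ⟨a1, a2⟩ := assign_res Θ ρ h2 hd ha h1 M
  exact ⟨a1.trans (Nat.le_mul_of_pos_right _ (pow_pos hf.pos 3)), a2⟩

theorem cheap_loop {v : ℕ} {count : IExp} {body : Prog} (t : ℕ)
    (hc : ∀ m n ρ, ρ 0 = n → ρ 1 = m → ρ 2 < n → m ≤ n * n → count.eval ρ ≤ n * n)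
    (h : ∀ m n (Θ : Subroutines m n) ρ i, ρ 0 = n → ρ 2 < n → i < n * n → ∀ M,
      (body.run Θ (Function.update ρ v i) M).time ≤ t ∧
        (body.run Θ (Function.update ρ v i) M).used ⊆ pool n) : Cheap (.loop v count body) := by
  refine fun c => ⟨t + 2, fun m n Θ ρ hf M => ?_⟩
  have hN := hc m n ρ hf.var0 hf.var1 hf.var2 hf.le
  obtain ⟨h1, h2⟩ := loop_res Θ v count body ρ M t (pool n)
    fun i hi M₁ => h m n Θ ρ i hf.var0 hf.var2 (by omega) M₁
  refine ⟨h1.trans ?_, h2⟩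
  have hn := hf.pos
  have h3 : count.eval ρ * (t + 1) ≤ n ^ 3 * (t + 1) := by
    refine Nat.mul_le_mul_right _ (hN.trans ?_)
    rw [pow_succ, sq]; exact Nat.le_mul_of_pos_right _ hn
  have h4 : 1 ≤ n ^ 3 := Nat.one_le_pow _ _ hn
  calc count.eval ρ * (t + 1) + 1 ≤ n ^ 3 * (t + 1) + n ^ 3 := Nat.add_le_add h3 h4
    _ = _ := by ring

theorem cheap_vmap {N : IExp} {d : ℕ} {e : SE} (hd : d < 40) (he : e.depth < 8)
    (hN : ∀ m n ρ, ρ 0 = n → ρ 1 = m → ρ 2 < n → m ≤ n * n → N.eval ρ ≤ n * n)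
    (h : ∀ n ρ, ρ 4 < n * n → ρ 0 = n → e.Within (n * n + 8) ρ) : Cheap (vmap N d e) := by
  refine cheap_loop (e.cost + 2) hN fun m n Θ ρ i h0 _ hi M => ?_
  refine assign_res Θ _ (h n _ (by simpa using hi) (by simpa using h0)) he hd ?_ M
  simp [IExp.eval]; omega

/-- The body may take linear time, which is what the inner product inside a matrix product needs. -/
theorem cheap_loop2 {body : Prog} (t : ℕ)
    (h : ∀ m n (Θ : Subroutines m n) ρ, ρ 0 = n → ρ 4 < n → ρ 5 < n → ∀ M,
      (body.run Θ ρ M).time ≤ t * n ∧ (body.run Θ ρ M).used ⊆ pool n) :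
    Cheap (loop2 body) := by
  refine fun c => ⟨t + 4, fun m n Θ ρ hf M => ?_⟩
  have hn := hf.pos
  have e0 : (IExp.var 0).eval ρ = n := hf.var0
  obtain ⟨h1, h2⟩ := loop_res Θ 4 (.var 0) (.loop 5 (.var 0) body) ρ M (n * (t * n + 1) + 1)
    (pool n) fun i hi M₁ => by
      have e1 : (IExp.var 0).eval (Function.update ρ 4 i) = n := by
        simp [IExp.eval, hf.var0]
      have := loop_res Θ 5 (.var 0) body (Function.update ρ 4 i) M₁ (t * n) (pool n)
        fun j hj M₂ => h m n Θ _ (by simp [hf.var0]) (by simpa [e0] using hi)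
          (by simpa [e1] using hj) M₂
      rwa [e1] at this
  refine ⟨h1.trans ?_, h2⟩
  rw [e0]
  have h4 : n ^ 2 ≤ n ^ 3 := Nat.pow_le_pow_right hn (by norm_num)
  have h5 : n ^ 1 ≤ n ^ 3 := Nat.pow_le_pow_right hn (by norm_num)
  have h6 : 1 ≤ n ^ 3 := Nat.one_le_pow _ _ hn
  calc n * (n * (t * n + 1) + 1 + 1) + 1 = t * n ^ 3 + n ^ 2 + 2 * n ^ 1 + 1 := by ring
    _ ≤ t * n ^ 3 + n ^ 3 + 2 * n ^ 3 + n ^ 3 := by gcongr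
    _ = _ := by ring

theorem cheap_matmul {d x y : ℕ} {xo yo : IExp} (hd : d < 40) (hx : x < 40) (hy : y < 40)
    (h : ∀ n ρ, ρ 0 = n → ρ 4 < n → ρ 5 < n → ρ 6 < n →
      xo.eval ρ < n * n ∧ yo.eval ρ < n * n) : Cheap (matmul d x xo y yo) := by
  refine cheap_loop2 20 fun m n Θ ρ h0 h4 h5 M => ?_
  have p1 : (pos 4 5).eval ρ < n * n := by
    simp only [IExp.eval, h0]; exact pos_lt h4 h5
  obtain ⟨a1, a2⟩ := assign_res Θ ρ (e := .rat 0) trivial (by simp [SE.depth]) hd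
    (off := pos 4 5) (by omega) M
  obtain ⟨b1, b2⟩ := loop_res Θ 6 (.var 0) (assign d (pos 4 5) (.op .add (.ref d (pos 4 5))
    (.op .mul (.ref x xo) (.ref y yo)))) ρ ((assign d (pos 4 5) (.rat 0)).run Θ ρ M).mem 10
    (pool n) fun l hl M₁ => by
      have hl' : l < n := by simpa [IExp.eval, h0] using hl
      have p2 : (pos 4 5).eval (Function.update ρ 6 l) < n * n := by
        simp only [IExp.eval]
        simpa [h0] using pos_lt h4 h5
      obtain ⟨q1, q2⟩ := h n (Function.update ρ 6 l) (by simpa using h0) (by simpa using h4)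
        (by simpa using h5) (by simpa using hl')
      exact assign_res Θ (Function.update ρ 6 l) (e := .op .add (.ref d (pos 4 5))
        (.op .mul (.ref x xo) (.ref y yo))) ⟨⟨hd, by omega⟩, ⟨hx, by omega⟩, ⟨hy, by omega⟩⟩
        (by simp [SE.depth]) hd (by omega) M₁
  refine ⟨?_, Finset.union_subset a2 b2⟩
  have e0 : (IExp.var 0).eval ρ = n := h0
  rw [e0] at b1
  have hcost : (SE.rat 0).cost = 1 := rfl
  rw [hcost] at a1
  have hn : 1 ≤ n := by omega
  calc _ ≤ (1 + 2) + (n * (10 + 1) + 1) := Nat.add_le_add a1 b1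
    _ ≤ _ := by omega

theorem cheap_callA {s d : ℕ} (hs : s < 40) (hd : d < 40) : Cheap (.callA s d) := by
  refine fun c => ⟨c + 1, fun m n Θ ρ hf M => ⟨?_, Finset.union_subset
    (cells_subset_pool hs le_rfl) (cells_subset_pool hd hf.le)⟩⟩
  have h6 : 1 ≤ n ^ 3 := Nat.one_le_pow _ _ hf.pos
  rw [Nat.add_mul, one_mul]
  exact Nat.add_le_add hf.timeA h6

theorem cheap_callAT {s d : ℕ} (hs : s < 40) (hd : d < 40) : Cheap (.callAT s d) := by
  refine fun c => ⟨c + 1, fun m n Θ ρ hf M => ⟨?_, Finset.union_subset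
    (cells_subset_pool hs hf.le) (cells_subset_pool hd le_rfl)⟩⟩
  have h6 : 1 ≤ n ^ 3 := Nat.one_le_pow _ _ hf.pos
  rw [Nat.add_mul, one_mul]
  exact Nat.add_le_add hf.timeAT h6

theorem cheap_callEig {s d d' : ℕ} (hs : s < 40) (hd : d < 40) (hd' : d' < 40) :
    Cheap (.callEig s d d') := by
  refine fun c => ⟨c + 1, fun m n Θ ρ hf M => ⟨?_, Finset.union_subset (Finset.union_subset
    (cells_subset_pool hs le_rfl) (cells_subset_pool hd le_rfl))
    (cells_subset_pool hd' (Nat.le_mul_self n))⟩⟩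
  have h6 : 1 ≤ n ^ 3 := Nat.one_le_pow _ _ hf.pos
  rw [Nat.add_mul, one_mul]
  exact Nat.add_le_add hf.timeEig h6

end Resources

/-! ### Vector and matrix operations of the machine -/

section Operations

variable {m n r : ℕ} (Θ : Subroutines m n)

/-- Only the arrays in `S` and the scratch array may differ. -/
def Touch (S : List ℕ) (M M' : Mem) : Prop := ∀ a, a ∉ scr :: S → M' a = M a

theorem Touch.trans {S T : List ℕ} {M M' M'' : Mem} (h : Touch S M M') (h' : Touch T M' M'') :
    Touch (S ++ T) M M'' := fun a ha => by
  simp only [List.mem_cons, List.mem_append, not_or] at ha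
  rw [h' a (by simp [ha]), h a (by simp [ha])]

theorem Touch.mono {S T : List ℕ} {M M' : Mem} (h : Touch S M M') (hST : S ⊆ T) :
    Touch T M M' := fun a ha => h a fun h' => ha (by
  rcases List.mem_cons.1 h' with h' | h'
  · exact List.mem_cons.2 (.inl h')
  · exact List.mem_cons.2 (.inr (hST h')))

theorem Touch.getMat {S : List ℕ} {M M' : Mem} (h : Touch S M M') {a : ℕ} (ha : a ∉ scr :: S) :
    M'.getMat n a = M.getMat n a := by
  rw [Mem.getMat, Mem.getMat, h a ha]

theorem Touch.getVec {S : List ℕ} {M M' : Mem} (h : Touch S M M') {a : ℕ} (ha : a ∉ scr :: S) :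
    M'.getVec m a = M.getVec m a := by
  unfold Mem.getVec; rw [h a ha]

theorem Filled.touch {M M' : Mem} {d c : ℕ} {f : ℕ → ℝ} (h : Filled M M' d c f) :
    Touch [d] M M' := fun a ha => by
  simp only [List.mem_cons, List.not_mem_nil, or_false, not_or] at ha
  exact h.1 a ha.1 ha.2

theorem run_seq (p q : Prog) (ρ : ℕ → ℕ) (M : Mem) :
    ((Prog.seq p q).run Θ ρ M).mem = (q.run Θ ρ (p.run Θ ρ M).mem).mem := rfl

/-- The number of entries of an `n × n` matrix. -/
abbrev nn : IExp := .mul (.var 0) (.var 0)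

/-- The current entry of an array in an entrywise loop. -/
abbrev el (a : ℕ) : SE := .ref a (.var 4)

/-- The scalar stored in an array. -/
abbrev sc (a : ℕ) : SE := .ref a (.const 0)

/-- The expression does not use the scratch array, and of array `d` at most the current entry. -/
def SE.Local (d : ℕ) : SE → Prop
  | ref a off => a ≠ scr ∧ (a ≠ d ∨ off = .var 4)
  | rat _ => True
  | op _ x y => x.Local d ∧ y.Local d

theorem SE.Local.clean {d : ℕ} {e : SE} (h : e.Local d) : e.Clean := by
  induction e with
  | ref a off => exact h.1
  | rat q => trivial
  | op o x y hx hy => exact ⟨hx h.1, hy h.2⟩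

theorem SE.Local.eval_eq {d : ℕ} {e : SE} (h : e.Local d) {ρ : ℕ → ℕ} {M M' : Mem}
    (h1 : ∀ a, a ≠ scr → a ≠ d → M' a = M a) (h2 : M' d (ρ 4) = M d (ρ 4)) :
    e.eval ρ M' = e.eval ρ M := by
  induction e with
  | ref a off =>
    simp only [SE.eval]
    by_cases had : a = d
    · subst had
      rw [h.2.resolve_left (by simp)]
      exact h2
    · rw [h1 a h.1 had]
  | rat q => rfl
  | op o x y hx hy => simp only [SE.eval]; rw [hx h.1, hy h.2]

theorem vmap_filled (N : IExp) {d : ℕ} (hd : d ≠ scr) {e : SE} (he : e.Local d) (ρ : ℕ → ℕ)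
    (M : Mem) : Filled M ((vmap N d e).run Θ ρ M).mem d (N.eval ρ)
      fun o => e.eval (Function.update ρ 4 o) M :=
  vmap_spec Θ N hd he.clean ρ M _ fun o _ M₁ h1 h2 => he.eval_eq h1 (by simpa using h2)

theorem vecmap_spec {d : ℕ} (hd : d ≠ scr) {e : SE} (he : e.Local d) {ρ : ℕ → ℕ} (h1 : ρ 1 = m)
    (M : Mem) : Touch [d] M ((vmap (.var 1) d e).run Θ ρ M).mem ∧
      ((vmap (.var 1) d e).run Θ ρ M).mem.getVec m d =
        fun i : Fin m => e.eval (Function.update ρ 4 i) M := by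
  have := vmap_filled Θ (.var 1) hd he ρ M
  simp only [IExp.eval, h1] at this
  exact ⟨this.touch, this.getVec⟩

theorem matmap_spec {d : ℕ} (hd : d ≠ scr) {e : SE} (he : e.Local d) {ρ : ℕ → ℕ} (h0 : ρ 0 = n)
    (M : Mem) : Touch [d] M ((vmap nn d e).run Θ ρ M).mem ∧
      ((vmap nn d e).run Θ ρ M).mem.getMat n d =
        Matrix.of fun i j : Fin n => e.eval (Function.update ρ 4 ((i : ℕ) * n + j)) M := by
  have := vmap_filled Θ nn hd he ρ M
  simp only [IExp.eval, h0] at this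
  exact ⟨this.touch, this.getMat⟩

theorem cheap_vecmap {d : ℕ} {e : SE} (hd : d < 40) (he : e.depth < 8)
    (h : ∀ n ρ, ρ 4 < n * n → ρ 0 = n → e.Within (n * n + 8) ρ) : Cheap (vmap (.var 1) d e) :=
  cheap_vmap hd he (fun m n ρ _ h1 _ h => by simpa [IExp.eval, h1] using h) h

theorem cheap_matmap {d : ℕ} {e : SE} (hd : d < 40) (he : e.depth < 8)
    (h : ∀ n ρ, ρ 4 < n * n → ρ 0 = n → e.Within (n * n + 8) ρ) : Cheap (vmap nn d e) :=
  cheap_vmap hd he (fun m n ρ h0 _ _ _ => by simp [IExp.eval, h0]) h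

theorem scalar_spec {s : ℕ} (hs : s ≠ scr) {e : SE} (he : e.Clean) (ρ : ℕ → ℕ) (M : Mem) :
    Touch [s] M ((assign s (.const 0) e).run Θ ρ M).mem ∧
      ((assign s (.const 0) e).run Θ ρ M).mem s 0 = e.eval ρ M := by
  have := assign_spec Θ ρ he hs (.const 0) M
  refine ⟨fun a ha => ?_, ?_⟩
  · simp only [List.mem_cons, List.not_mem_nil, or_false, not_or] at ha
    rw [this a ha.1, Mem.set_of_ne _ ha.2]
  · rw [this s hs]; exact Mem.set_self _ _ _ _

/-- Add the values of an expression over an entrywise loop to a scalar. -/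
def accum (s : ℕ) (N : IExp) (e : SE) : Prog :=
  .loop 4 N (assign s (.const 0) (.op .add (sc s) e))

theorem accum_spec {s : ℕ} (hs : s ≠ scr) (N : IExp) {e : SE} (he : e.Clean) (ρ : ℕ → ℕ) (M : Mem)
    (f : ℕ → ℝ) (hf : ∀ o, ∀ M₁ : Mem, Touch [s] M M₁ →
      e.eval (Function.update ρ 4 o) M₁ = f o) :
    Touch [s] M ((accum s N e).run Θ ρ M).mem ∧
      ((accum s N e).run Θ ρ M).mem s 0 = M s 0 + ∑ o ∈ Finset.range (N.eval ρ), f o := by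
  refine loop_inv Θ 4 N _ ρ M
    (fun i M₁ => Touch [s] M M₁ ∧ M₁ s 0 = M s 0 + ∑ o ∈ Finset.range i, f o)
    ⟨fun _ _ => rfl, by simp⟩ fun i _ M₁ h => ?_
  obtain ⟨a1, a2⟩ := scalar_spec Θ hs (e := .op .add (sc s) e) ⟨hs, he⟩ (Function.update ρ 4 i) M₁
  refine ⟨(h.1.trans a1).mono (by simp), ?_⟩
  rw [a2, SE.eval, hf i M₁ h.1, Finset.sum_range_succ, ← add_assoc, ← h.2]
  rfl

theorem cheap_accum {s : ℕ} {N : IExp} {e : SE} (hs : s < 40) (he : e.depth < 7)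
    (hN : ∀ m n ρ, ρ 0 = n → ρ 1 = m → ρ 2 < n → m ≤ n * n → N.eval ρ ≤ n * n)
    (h : ∀ n ρ, ρ 4 < n * n → ρ 0 = n → e.Within (n * n + 8) ρ) : Cheap (accum s N e) := by
  refine cheap_loop (e.cost + 5) hN fun m n Θ ρ i h0 _ hi M => ?_
  have := assign_res Θ (Function.update ρ 4 i) (e := .op .add (sc s) e)
    ⟨⟨hs, by simp [IExp.eval]⟩, h n _ (by simpa using hi) (by simpa using h0)⟩
    (by simp only [SE.depth]; omega) hs (off := .const 0) (by simp [IExp.eval]) M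
  refine ⟨this.1.trans ?_, this.2⟩
  simp only [SE.cost]; omega

theorem vext_sub_smul (hr : r < n) (c : ℝ) (u v : VIdx n r → ℝ) :
    vext hr (u - c • v) = vext hr u - c • vext hr v := by
  ext p
  simp only [Pi.sub_apply, Pi.smul_apply]
  by_cases hp : p ∈ Set.range (vemb hr)
  · obtain ⟨q, rfl⟩ := hp
    simp only [vext_vemb, Pi.sub_apply, Pi.smul_apply]
  · simp [vext_of_notMem_range hr _ hp]

/-- The pair of arrays `a`, `a + 1` holds the vector `x`, the second block being stored as a
symmetric matrix. -/
def Rep (hr : r < n) (M : Mem) (a : ℕ) (x : Fin m ⊕ VIdx n r → ℝ) : Prop :=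
  M.getVec m a = x ∘ Sum.inl ∧ M.getMat n (a + 1) = smat (vext hr (x ∘ Sum.inr))

variable {hr : r < n}

theorem Rep.touch {M M' : Mem} {a : ℕ} {x : Fin m ⊕ VIdx n r → ℝ} (h : Rep hr M a x) {S : List ℕ}
    (hT : Touch S M M') (ha : a ∉ scr :: S ∧ a + 1 ∉ scr :: S) : Rep hr M' a x :=
  ⟨by rw [hT.getVec ha.1, h.1], by rw [hT.getMat ha.2, h.2]⟩

/-- Extension by zero and decoding to a symmetric matrix are both isometries, so summing over all n²
stored entries gives the inner product of the second blocks with the right weights. -/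
theorem Rep.dotProduct {M : Mem} {a b : ℕ} {x y : Fin m ⊕ VIdx n r → ℝ} (hx : Rep hr M a x)
    (hy : Rep hr M b y) : x ⬝ᵥ y = (∑ o ∈ Finset.range m, M a o * M b o) +
      ∑ o ∈ Finset.range (n * n), M (a + 1) o * M (b + 1) o := by
  have e1 : (∑ o ∈ Finset.range m, M a o * M b o) = (x ∘ Sum.inl) ⬝ᵥ (y ∘ Sum.inl) := by
    rw [Finset.sum_range, ← hx.1, ← hy.1]; rfl
  have e2 : (∑ o ∈ Finset.range (n * n), M (a + 1) o * M (b + 1) o) =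
      (x ∘ Sum.inr) ⬝ᵥ (y ∘ Sum.inr) := by
    rw [← vext_dotProduct_vext hr, ← dotProduct_vec_smat, ← hx.2, ← hy.2, Finset.sum_range,
      ← finProdFinEquiv.sum_comp, _root_.dotProduct, ← (Equiv.prodComm _ _).sum_comp]
    refine Finset.sum_congr rfl fun p _ => ?_
    simp [Matrix.vec, Mem.getMat, mul_comm n, add_comm]
  rw [e1, e2]
  simp only [_root_.dotProduct, Fintype.sum_sum_type]; rfl

/-- The scalar `s` becomes the inner product of two vectors. -/
def dotp (s a b : ℕ) : Prog :=
  .seq (assign s (.const 0) (.rat 0)) (.seq (accum s (.var 1) (.op .mul (el a) (el b)))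
    (accum s nn (.op .mul (el (a + 1)) (el (b + 1)))))

theorem dotp_spec {s a b : ℕ} (hs : s ≠ scr) (h : ∀ c ∈ [a, a + 1, b, b + 1], c ∉ [scr, s])
    {ρ : ℕ → ℕ} (h0 : ρ 0 = n) (h1 : ρ 1 = m) {M : Mem} {x y : Fin m ⊕ VIdx n r → ℝ}
    (hx : Rep hr M a x) (hy : Rep hr M b y) : Touch [s] M ((dotp s a b).run Θ ρ M).mem ∧
      ((dotp s a b).run Θ ρ M).mem s 0 = x ⬝ᵥ y := by
  have ha := h a (by simp)
  have ha' := h (a + 1) (by simp)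
  have hb := h b (by simp)
  have hb' := h (b + 1) (by simp)
  have clean : ∀ {c}, c ∉ [scr, s] → c ≠ scr := fun hc e => hc (by simp [e])
  rw [dotp, run_seq, run_seq]
  obtain ⟨t1, v1⟩ := scalar_spec Θ hs (e := .rat 0) trivial ρ M
  generalize ((assign s (.const 0) (.rat 0)).run Θ ρ M).mem = M₁ at *
  obtain ⟨t2, v2⟩ := accum_spec Θ hs (.var 1) (e := .op .mul (el a) (el b)) ⟨clean ha, clean hb⟩
    ρ M₁ (fun o => M a o * M b o) fun o M' t => by
      simp only [SE.eval, BinOp.eval, IExp.eval, Function.update_self]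
      rw [t a ha, t b hb, t1 a ha, t1 b hb]
  generalize ((accum s (.var 1) (.op .mul (el a) (el b))).run Θ ρ M₁).mem = M₂ at *
  obtain ⟨t3, v3⟩ := accum_spec Θ hs nn (e := .op .mul (el (a + 1)) (el (b + 1)))
    ⟨clean ha', clean hb'⟩ ρ M₂ (fun o => M (a + 1) o * M (b + 1) o) fun o M' t => by
      simp only [SE.eval, BinOp.eval, IExp.eval, Function.update_self]
      rw [t _ ha', t _ hb', t2 _ ha', t2 _ hb', t1 _ ha', t1 _ hb']
  refine ⟨((t1.trans t2).trans t3).mono (by simp), ?_⟩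
  rw [v3, v2, v1, hx.dotProduct hy]
  simp [SE.eval, IExp.eval, h0, h1]

theorem cheap_dotp {s a b : ℕ} (hs : s < 40) (ha : a + 1 < 40) (hb : b + 1 < 40) :
    Cheap (dotp s a b) := by
  refine (cheap_assign (e := .rat 0) hs (by simp [SE.depth]) fun n ρ _ _ => ⟨by simp [IExp.eval], trivial⟩).seq
    ((cheap_accum hs (by simp [SE.depth]) (fun m n ρ _ h1 _ h => by simpa [IExp.eval, h1] using h)
      fun n ρ h4 _ => ?_).seq (cheap_accum hs (by simp [SE.depth])
      (fun m n ρ h0 _ _ _ => by simp [IExp.eval, h0]) fun n ρ h4 _ => ?_)) <;>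
  · simp only [SE.Within, IExp.eval]; omega

/-- The vector `d` becomes `a - s • b`. -/
def comb (d a s b : ℕ) : Prog :=
  .seq (vmap (.var 1) d (.op .sub (el a) (.op .mul (sc s) (el b))))
    (vmap nn (d + 1) (.op .sub (el (a + 1)) (.op .mul (sc s) (el (b + 1)))))

/-- Vectors start at odd arrays, so two of them are either equal or disjoint. The target may then
coincide with an operand. -/
theorem comb_spec {d a s b : ℕ} (h : d % 2 = 1 ∧ a % 2 = 1 ∧ b % 2 = 1 ∧ d < 38 ∧ a < 38 ∧ b < 38 ∧
      s ≠ d ∧ s ≠ d + 1 ∧ s ≠ 39) {ρ : ℕ → ℕ} (h0 : ρ 0 = n) (h1 : ρ 1 = m) {M : Mem}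
    {x y : Fin m ⊕ VIdx n r → ℝ} (hx : Rep hr M a x) (hy : Rep hr M b y) :
    Touch [d, d + 1] M ((comb d a s b).run Θ ρ M).mem ∧
      Rep hr ((comb d a s b).run Θ ρ M).mem d (x - M s 0 • y) := by
  obtain ⟨hd, ha, hb, hd', ha', hb', hs, hs', hs''⟩ := h
  have hscr : scr = 39 := rfl
  rw [comb, run_seq]
  obtain ⟨t1, v1⟩ := vecmap_spec Θ (d := d) (e := .op .sub (el a) (.op .mul (sc s) (el b)))
    (by omega) ⟨⟨by omega, .inr rfl⟩, ⟨by omega, .inl hs⟩, ⟨by omega, .inr rfl⟩⟩ h1 M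
  generalize ((vmap (.var 1) d (.op .sub (el a) (.op .mul (sc s) (el b)))).run Θ ρ M).mem = M₁ at *
  obtain ⟨t2, v2⟩ := matmap_spec Θ (d := d + 1)
    (e := .op .sub (el (a + 1)) (.op .mul (sc s) (el (b + 1))))
    (by omega) ⟨⟨by omega, .inr rfl⟩, ⟨by omega, .inl hs'⟩, ⟨by omega, .inr rfl⟩⟩ h0 M₁
  refine ⟨(t1.trans t2).mono (by simp), ?_, ?_⟩
  · rw [t2.getVec (by simp; omega), v1]
    ext i
    simp only [SE.eval, BinOp.eval, IExp.eval, Function.update_self]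
    have e1 := congrFun hx.1 i
    have e2 := congrFun hy.1 i
    simp only [Mem.getVec] at e1 e2
    rw [e1, e2]; rfl
  · rw [v2]
    ext i j
    simp only [SE.eval, BinOp.eval, IExp.eval, Function.update_self, Matrix.of_apply]
    rw [t1 (a + 1) (by simp; omega), t1 (b + 1) (by simp; omega), t1 s (by simp; omega)]
    have e1 := congrFun (congrFun hx.2 i) j
    have e2 := congrFun (congrFun hy.2 i) j
    simp only [Mem.getMat, Matrix.of_apply] at e1 e2
    rw [e1, e2]
    have : (x - M s 0 • y) ∘ Sum.inr = x ∘ Sum.inr - M s 0 • (y ∘ Sum.inr) := rfl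
    rw [this, vext_sub_smul, smat_sub, smat_smul]; rfl

theorem cheap_comb {d a s b : ℕ} (h : d + 1 < 40 ∧ a + 1 < 40 ∧ b + 1 < 40 ∧ s < 40) :
    Cheap (comb d a s b) := by
  refine (cheap_vecmap (by omega) (by simp [SE.depth]) fun n ρ h4 _ => ?_).seq
    (cheap_matmap (by omega) (by simp [SE.depth]) fun n ρ h4 _ => ?_) <;>
  · simp only [SE.Within, IExp.eval]; omega

/-- The vector `d` becomes `a`. -/
def copy (d a : ℕ) : Prog := .seq (vmap (.var 1) d (el a)) (vmap nn (d + 1) (el (a + 1)))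

theorem copy_spec {d a : ℕ} (h : d % 2 = 1 ∧ a % 2 = 1 ∧ d < 38 ∧ a < 38)
    {ρ : ℕ → ℕ} (h0 : ρ 0 = n) (h1 : ρ 1 = m) {M : Mem} {x : Fin m ⊕ VIdx n r → ℝ}
    (hx : Rep hr M a x) : Touch [d, d + 1] M ((copy d a).run Θ ρ M).mem ∧
      Rep hr ((copy d a).run Θ ρ M).mem d x := by
  obtain ⟨hd, ha, hd', ha'⟩ := h
  have hscr : scr = 39 := rfl
  rw [copy, run_seq]
  obtain ⟨t1, v1⟩ := vecmap_spec Θ (d := d) (e := el a) (by omega) ⟨by omega, .inr rfl⟩ h1 M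
  generalize ((vmap (.var 1) d (el a)).run Θ ρ M).mem = M₁ at *
  obtain ⟨t2, v2⟩ := matmap_spec Θ (d := d + 1) (e := el (a + 1)) (by omega)
    ⟨by omega, .inr rfl⟩ h0 M₁
  refine ⟨(t1.trans t2).mono (by simp), ?_, ?_⟩
  · rw [t2.getVec (by simp; omega), v1, ← hx.1]
    ext i
    simp only [SE.eval, IExp.eval, Function.update_self, Mem.getVec]
  · rw [v2, ← hx.2]
    ext i j
    simp only [SE.eval, IExp.eval, Function.update_self, Matrix.of_apply, Mem.getMat]
    rw [t1 (a + 1) (by simp; omega)]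

theorem cheap_copy {d a : ℕ} (h : d + 1 < 40 ∧ a + 1 < 40) : Cheap (copy d a) := by
  refine (cheap_vecmap (by omega) (by simp [SE.depth]) fun n ρ h4 _ => ?_).seq
    (cheap_matmap (by omega) (by simp [SE.depth]) fun n ρ h4 _ => ?_) <;>
  · simp only [SE.Within, IExp.eval]; omega

/-- Product of two matrices. -/
def mulNN (d x y : ℕ) : Prog := matmul d x (pos 4 6) y (pos 6 5)

/-- Product of a transposed matrix and a matrix. -/
def mulTN (d x y : ℕ) : Prog := matmul d x (pos 6 4) y (pos 6 5)

/-- Product of a matrix and a transposed matrix. -/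
def mulNT (d x y : ℕ) : Prog := matmul d x (pos 4 6) y (pos 5 6)

theorem mulNN_spec {d x y : ℕ} (h : d ≠ scr ∧ x ∉ [scr, d] ∧ y ∉ [scr, d]) {ρ : ℕ → ℕ}
    (h0 : ρ 0 = n) (M : Mem) : Touch [d] M ((mulNN d x y).run Θ ρ M).mem ∧
      ((mulNN d x y).run Θ ρ M).mem.getMat n d = M.getMat n x * M.getMat n y := by
  simp only [List.mem_cons, List.not_mem_nil, or_false, not_or] at h
  have := matmul_spec Θ h.1 h.2.1.1 h.2.2.1 h.2.1.2 h.2.2.2 (pos 4 6) (pos 6 5) ρ h0 M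
    (fun i l => M x (i * n + l)) (fun l j => M y (l * n + j))
    (fun i j l _ _ => by simp [IExp.eval, h0]) (fun i j l _ _ => by simp [IExp.eval, h0])
  refine ⟨this.touch, ?_⟩
  rw [mulNN, this.getMat₂ (f := fun i j => ∑ l ∈ Finset.range n, M x (i * n + l) * M y (l * n + j))]
  ext i j
  rw [Matrix.of_apply, Finset.sum_range, Matrix.mul_apply]; rfl

theorem mulTN_spec {d x y : ℕ} (h : d ≠ scr ∧ x ∉ [scr, d] ∧ y ∉ [scr, d]) {ρ : ℕ → ℕ}
    (h0 : ρ 0 = n) (M : Mem) : Touch [d] M ((mulTN d x y).run Θ ρ M).mem ∧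
      ((mulTN d x y).run Θ ρ M).mem.getMat n d = (M.getMat n x)ᵀ * M.getMat n y := by
  simp only [List.mem_cons, List.not_mem_nil, or_false, not_or] at h
  have := matmul_spec Θ h.1 h.2.1.1 h.2.2.1 h.2.1.2 h.2.2.2 (pos 6 4) (pos 6 5) ρ h0 M
    (fun i l => M x (l * n + i)) (fun l j => M y (l * n + j))
    (fun i j l _ _ => by simp [IExp.eval, h0]) (fun i j l _ _ => by simp [IExp.eval, h0])
  refine ⟨this.touch, ?_⟩
  rw [mulTN, this.getMat₂ (f := fun i j => ∑ l ∈ Finset.range n, M x (l * n + i) * M y (l * n + j))]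
  ext i j
  rw [Matrix.of_apply, Finset.sum_range, Matrix.mul_apply]; rfl

theorem mulNT_spec {d x y : ℕ} (h : d ≠ scr ∧ x ∉ [scr, d] ∧ y ∉ [scr, d]) {ρ : ℕ → ℕ}
    (h0 : ρ 0 = n) (M : Mem) : Touch [d] M ((mulNT d x y).run Θ ρ M).mem ∧
      ((mulNT d x y).run Θ ρ M).mem.getMat n d = M.getMat n x * (M.getMat n y)ᵀ := by
  simp only [List.mem_cons, List.not_mem_nil, or_false, not_or] at h
  have := matmul_spec Θ h.1 h.2.1.1 h.2.2.1 h.2.1.2 h.2.2.2 (pos 4 6) (pos 5 6) ρ h0 M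
    (fun i l => M x (i * n + l)) (fun l j => M y (j * n + l))
    (fun i j l _ _ => by simp [IExp.eval, h0]) (fun i j l _ _ => by simp [IExp.eval, h0])
  refine ⟨this.touch, ?_⟩
  rw [mulNT, this.getMat₂ (f := fun i j => ∑ l ∈ Finset.range n, M x (i * n + l) * M y (j * n + l))]
  ext i j
  rw [Matrix.of_apply, Finset.sum_range, Matrix.mul_apply]; rfl

theorem cheap_mulNN {d x y : ℕ} (h : d < 40 ∧ x < 40 ∧ y < 40) : Cheap (mulNN d x y) :=
  cheap_matmul h.1 h.2.1 h.2.2 fun n ρ h0 h4 h5 h6 => by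
    simp only [IExp.eval, h0]; exact ⟨pos_lt h4 h6, pos_lt h6 h5⟩

theorem cheap_mulTN {d x y : ℕ} (h : d < 40 ∧ x < 40 ∧ y < 40) : Cheap (mulTN d x y) :=
  cheap_matmul h.1 h.2.1 h.2.2 fun n ρ h0 h4 h5 h6 => by
    simp only [IExp.eval, h0]; exact ⟨pos_lt h6 h4, pos_lt h6 h5⟩

theorem cheap_mulNT {d x y : ℕ} (h : d < 40 ∧ x < 40 ∧ y < 40) : Cheap (mulNT d x y) :=
  cheap_matmul h.1 h.2.1 h.2.2 fun n ρ h0 h4 h5 h6 => by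
    simp only [IExp.eval, h0]; exact ⟨pos_lt h4 h6, pos_lt h5 h6⟩

theorem Mem.getVec_setVec (M : Mem) (a : ℕ) (x : Fin m → ℝ) : (M.setVec a x).getVec m a = x := by
  ext i; simp [Mem.getVec, Mem.setVec]

theorem Mem.setVec_of_ne (M : Mem) {a b : ℕ} (h : b ≠ a) (x : Fin m → ℝ) :
    M.setVec a x b = M b := by
  simp [Mem.setVec, h]

theorem Mem.getMat_setMat (M : Mem) (a : ℕ) (X : Matrix (Fin n) (Fin n) ℝ) :
    (M.setMat a X).getMat n a = X := by
  ext i j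
  have h : (i : ℕ) * n + j < n * n := pos_lt i.2 j.2
  simp only [Mem.getMat, Mem.setMat, Mem.setVec, Matrix.of_apply, Function.update_self, dif_pos h]
  have hn : 0 < n := i.pos
  congr 1 <;> ext
  · simp only [Fin.divNat]
    rw [Nat.mul_comm (i : ℕ) n, Nat.mul_add_div hn, Nat.div_eq_of_lt j.2, add_zero]
  · simp only [Fin.modNat]
    rw [Nat.mul_comm (i : ℕ) n, Nat.mul_add_mod, Nat.mod_eq_of_lt j.2]

theorem callA_spec (s d : ℕ) (ρ : ℕ → ℕ) (M : Mem) :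
    Touch [d] M ((Prog.callA s d).run Θ ρ M).mem ∧
      ((Prog.callA s d).run Θ ρ M).mem.getVec m d = Θ.A *ᵥ svec (M.getMat n s) := by
  refine ⟨fun a ha => ?_, Mem.getVec_setVec _ _ _⟩
  simp only [List.mem_cons, List.not_mem_nil, or_false, not_or] at ha
  exact Mem.setVec_of_ne _ ha.2 _

theorem callAT_spec (s d : ℕ) (ρ : ℕ → ℕ) (M : Mem) :
    Touch [d] M ((Prog.callAT s d).run Θ ρ M).mem ∧
      ((Prog.callAT s d).run Θ ρ M).mem.getMat n d = smat (Θ.Aᵀ *ᵥ M.getVec m s) := by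
  refine ⟨fun a ha => ?_, Mem.getMat_setMat _ _ _⟩
  simp only [List.mem_cons, List.not_mem_nil, or_false, not_or] at ha
  show (M.setMat d (smat (Θ.Aᵀ *ᵥ M.getVec m s))) a = M a
  rw [Mem.setMat, Mem.setVec_of_ne _ ha.2]

theorem callEig_spec {s d d' : ℕ} (h : d ≠ d') (ρ : ℕ → ℕ) (M : Mem) :
    Touch [d, d'] M ((Prog.callEig s d d').run Θ ρ M).mem ∧
      ((Prog.callEig s d d').run Θ ρ M).mem.getMat n d = (Θ.eig (M.getMat n s)).1 ∧
      ((Prog.callEig s d d').run Θ ρ M).mem.getVec n d' = (Θ.eig (M.getMat n s)).2 := by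
  refine ⟨fun a ha => ?_, ?_, Mem.getVec_setVec _ _ _⟩
  · simp only [List.mem_cons, List.not_mem_nil, or_false, not_or] at ha
    exact (Mem.setVec_of_ne _ ha.2.2 _).trans (Mem.setVec_of_ne _ ha.2.1 _)
  · have : ((Prog.callEig s d d').run Θ ρ M).mem d = (M.setMat d (Θ.eig (M.getMat n s)).1) d :=
      Mem.setVec_of_ne _ h _
    simp only [Mem.getMat, this]
    exact Mem.getMat_setMat M d _

end Operations

/-! ### The solver -/

section Solver

variable {m n r : ℕ} (Θ : Subroutines m n)

/-- Fill an `n × n` matrix; row and column are variables `4`, `5`. -/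
def fill (d : ℕ) (e : SE) : Prog := loop2 (assign d (pos 4 5) e)

theorem fill_spec {d : ℕ} (hd : d ≠ scr) {e : SE} (he : e.Clean) {ρ : ℕ → ℕ} (h0 : ρ 0 = n)
    (M : Mem) (f : ℕ → ℕ → ℝ) (hf : ∀ i j, ∀ M₁ : Mem, Touch [d] M M₁ →
      e.eval (Function.update (Function.update ρ 4 i) 5 j) M₁ = f i j) :
    Touch [d] M ((fill d e).run Θ ρ M).mem ∧
      ((fill d e).run Θ ρ M).mem.getMat n d = Matrix.of fun i j : Fin n => f i j := by
  have := loop2_spec Θ hd (assign d (pos 4 5) e) ρ h0 M f fun i _ j _ M₁ h => by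
    have := assign_spec Θ (Function.update (Function.update ρ 4 i) 5 j) he hd (pos 4 5) M₁
    rw [hf i j M₁ fun a ha => by
      simp only [List.mem_cons, List.not_mem_nil, or_false, not_or] at ha
      exact h a ha.1 ha.2] at this
    simpa [IExp.eval, h0] using this
  exact ⟨this.touch, this.getMat₂⟩

theorem cheap_fill {d : ℕ} {e : SE} (hd : d < 40) (he : e.depth < 8)
    (h : ∀ n ρ, ρ 4 < n → ρ 5 < n → e.Within (n * n + 8) ρ) : Cheap (fill d e) :=
  cheap_loop2 (e.cost + 2) fun m n Θ ρ h0 h4 h5 M => by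
    have := pos_lt h4 h5
    have h1 := assign_res Θ ρ (h n ρ h4 h5) he hd (off := pos 4 5)
      (by simp only [IExp.eval, h0]; omega) M
    exact ⟨h1.1.trans (Nat.le_mul_of_pos_right _ (by omega)), h1.2⟩

/-- `d := Pᵀ s P`. -/
def conjT (s d : ℕ) : Prog := .seq (mulTN 13 5 s) (mulNN d 13 5)

/-- `d := P [13] Pᵀ`. -/
def conj (d : ℕ) : Prog := .seq (mulNN 12 5 13) (mulNT d 12 5)

/-- The orthogonal matrix of size n(n+1)/2 is never formed: its transpose acts as X ↦ Pᵀ X P, at the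
cost of two n × n products. -/
theorem conjT_spec {s d : ℕ} (hs : s ∉ [scr, 13]) (hd : d ∉ [scr, 13, 5]) {ρ : ℕ → ℕ}
    (h0 : ρ 0 = n) {M : Mem} {P : Matrix (Fin n) (Fin n) ℝ} (hP : M.getMat n 5 = P)
    {x : SIdx n → ℝ} (hx : M.getMat n s = smat x) :
    Touch [13, d] M ((conjT s d).run Θ ρ M).mem ∧
      ((conjT s d).run Θ ρ M).mem.getMat n d = smat ((symKron P P)ᵀ *ᵥ x) := by
  simp only [List.mem_cons, List.not_mem_nil, or_false, not_or] at hd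
  rw [conjT, run_seq]
  obtain ⟨t1, v1⟩ := mulTN_spec Θ (d := 13) (x := 5) (y := s) ⟨by decide, by decide, hs⟩ h0 M
  generalize ((mulTN 13 5 s).run Θ ρ M).mem = M₁ at *
  obtain ⟨t2, v2⟩ := mulNN_spec Θ (d := d) (x := 13) (y := 5)
    ⟨hd.1, by simp [Ne.symm hd.2.1], by simp [Ne.symm hd.2.2]⟩ h0 M₁
  refine ⟨t1.trans t2, ?_⟩
  rw [v2, v1, t1.getMat (by decide), hP, hx, symKron_transpose, smat_symKron_self_mulVec,
    Matrix.transpose_transpose]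

theorem conj_spec {d : ℕ} (hd : d ∉ [scr, 12, 5]) {ρ : ℕ → ℕ} (h0 : ρ 0 = n) {M : Mem}
    {P : Matrix (Fin n) (Fin n) ℝ} (hP : M.getMat n 5 = P) {x : SIdx n → ℝ}
    (hx : M.getMat n 13 = smat x) : Touch [12, d] M ((conj d).run Θ ρ M).mem ∧
      ((conj d).run Θ ρ M).mem.getMat n d = smat (symKron P P *ᵥ x) := by
  simp only [List.mem_cons, List.not_mem_nil, or_false, not_or] at hd
  rw [conj, run_seq]
  obtain ⟨t1, v1⟩ := mulNN_spec Θ (d := 12) (x := 5) (y := 13)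
    ⟨by decide, by decide, by decide⟩ h0 M
  generalize ((mulNN 12 5 13).run Θ ρ M).mem = M₁ at *
  obtain ⟨t2, v2⟩ := mulNT_spec Θ (d := d) (x := 12) (y := 5)
    ⟨hd.1, by simp [Ne.symm hd.2.1], by simp [Ne.symm hd.2.2]⟩ h0 M₁
  refine ⟨t1.trans t2, ?_⟩
  rw [v2, v1, t1.getMat (by decide), hP, hx, smat_symKron_self_mulVec]

theorem cheap_conjT {s d : ℕ} (h : s < 40 ∧ d < 40) : Cheap (conjT s d) :=
  (cheap_mulTN (by omega)).seq (cheap_mulNN (by omega))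

theorem cheap_conj {d : ℕ} (h : d < 40) : Cheap (conj d) :=
  (cheap_mulNN (by omega)).seq (cheap_mulNT (by omega))

theorem smat_eeDiag_mul (hr : r < n) (w : Fin n → ℝ) (x : SIdx n → ℝ) (i j : Fin n) :
    smat (eeDiag hr w * x) i j = gval hr w i * gval hr w j * smat x i j / tau hr w ^ 2 := by
  rw [← div_mul_eq_mul_div]
  exact smat_diagonal_mulVec (fun i j => gval hr w i * gval hr w j / tau hr w ^ 2)
    (fun i j => by rw [mul_comm (gval hr w i)]) x i j

/-- Since division by zero returns zero, s * x / s equals x where the weight s is nonzero and 0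
elsewhere. The restriction to the second block is thus arithmetic and needs no test on indices. -/
theorem smat_vext_comp (hr : r < n) {w : Fin n → ℝ} (hpos : ∀ i, 0 < w i) (hw : Antitone w)
    (x : SIdx n → ℝ) (i j : Fin n) :
    smat (vext hr (x ∘ vemb hr)) i j = swt hr w i j * smat x i j / swt hr w i j := by
  rw [mul_div_right_comm, ← smat_diagonal_mulVec (fun i j => swt hr w i j / swt hr w i j)
    (fun i j => by rw [swt_comm])]
  refine congrArg (fun x => smat x i j) (funext fun p => ?_)
  by_cases hp : p ∈ Set.range (vemb hr)
  · obtain ⟨q, rfl⟩ := hp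
    rw [vext_vemb, div_self (swt_vemb_pos hr hpos hw q).ne', one_mul]; rfl
  · rw [vext_of_notMem_range hr _ hp, swt_of_notMem_range hr w p hp, div_zero, zero_mul]

/-- The same mask; off the second block τ²/s is also evaluated as zero and does no harm. -/
theorem smat_vext_sub (hr : r < n) {w : Fin n → ℝ} (hpos : ∀ i, 0 < w i) (hw : Antitone w)
    (x : SIdx n → ℝ) (v : VIdx n r → ℝ) (i j : Fin n) :
    smat (vext hr (x ∘ vemb hr - dDiag hr w * v)) i j = swt hr w i j *
      (smat x i j - tau hr w ^ 2 / swt hr w i j * smat (vext hr v) i j) / swt hr w i j := by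
  have e : x ∘ vemb hr - dDiag hr w * v =
      (x - fun p => tau hr w ^ 2 / swt hr w p.1.1 p.1.2 * vext hr v p) ∘ vemb hr := by
    ext q
    simp only [Pi.sub_apply, Pi.mul_apply, Function.comp_apply, vext_vemb]; rfl
  rw [e, smat_vext_comp hr hpos hw, smat_sub, Matrix.sub_apply,
    smat_diagonal_mulVec (fun i j => tau hr w ^ 2 / swt hr w i j) fun i j => by rw [swt_comm]]

/-- The constants of the iteration are in memory. -/
structure Env (hr : r < n) (P : Matrix (Fin n) (Fin n) ℝ) (w : Fin n → ℝ)
    (C : Matrix (Fin n) (Fin n) ℝ) (M : Mem) : Prop where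
  vecs : M.getMat n 5 = P
  tt : M 9 0 = tau hr w ^ 2
  gg : M.getMat n 10 = Matrix.of fun i j => gval hr w i * gval hr w j
  wt : M.getMat n 11 = Matrix.of (swt hr w)
  rhs : M.getMat n 14 = smat ((symKron P P)ᵀ *ᵥ svec C)

variable {hr : r < n} {P C : Matrix (Fin n) (Fin n) ℝ} {w : Fin n → ℝ}

theorem Env.touch {M M' : Mem} (h : Env hr P w C M) {S : List ℕ} (hT : Touch S M M')
    (hS : ∀ a ∈ [5, 9, 10, 11, 14], a ∉ scr :: S) : Env hr P w C M' where
  vecs := by rw [hT.getMat (hS 5 (by decide)), h.vecs]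
  tt := by rw [hT 9 (hS 9 (by decide)), h.tt]
  gg := by rw [hT.getMat (hS 10 (by decide)), h.gg]
  wt := by rw [hT.getMat (hS 11 (by decide)), h.wt]
  rhs := by rw [hT.getMat (hS 14 (by decide)), h.rhs]

theorem getMat_entry {M : Mem} {a : ℕ} {X : Matrix (Fin n) (Fin n) ℝ} (h : M.getMat n a = X)
    (i j : Fin n) : M a ((i : ℕ) * n + j) = X i j := by
  rw [← h]; rfl

/-- The vector `27` becomes the product of the augmented matrix and the vector `21`. -/
def matvec : Prog :=
  .seq (.callAT 21 12) (.seq (conjT 12 12)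
    (.seq (vmap nn 13 (.op .add (.op .div (.op .mul (el 10) (el 12)) (sc 9)) (el 22)))
    (.seq (vmap nn 28 (.op .div (.op .mul (el 11)
      (.op .sub (el 12) (.op .mul (.op .div (sc 9) (el 11)) (el 22)))) (el 11)))
    (.seq (conj 13) (.callA 13 27)))))

/-- Array 12 holds Aᵀu in the eigenbasis. Both blocks are formed from it entrywise before `conj 13`
reuses it as work space. -/
theorem matvec_spec (hpos : ∀ i, 0 < w i) (hw : Antitone w) {ρ : ℕ → ℕ} (h0 : ρ 0 = n) {M : Mem}
    (hE : Env hr P w C M) {x : Fin m ⊕ VIdx n r → ℝ} (hx : Rep hr M 21 x) :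
    Touch [12, 13, 27, 28] M (matvec.run Θ ρ M).mem ∧
      Rep hr (matvec.run Θ ρ M).mem 27 (augMat hr P w Θ.A *ᵥ x) := by
  simp only [matvec, run_seq]
  obtain ⟨t1, v1⟩ := callAT_spec Θ 21 12 ρ M
  generalize ((Prog.callAT 21 12).run Θ ρ M).mem = M₁ at *
  rw [hx.1] at v1
  obtain ⟨t2, v2⟩ := conjT_spec Θ (s := 12) (d := 12) (by decide) (by decide) h0
    ((t1.getMat (by decide)).trans hE.vecs) v1
  generalize ((conjT 12 12).run Θ ρ M₁).mem = M₂ at *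
  have T2 := t1.trans t2
  have E2 := hE.touch T2 (by decide)
  have X2 := hx.touch T2 (by decide)
  obtain ⟨t3, v3⟩ := matmap_spec Θ (d := 13)
    (e := .op .add (.op .div (.op .mul (el 10) (el 12)) (sc 9)) (el 22)) (by decide)
    (by simp [SE.Local]) h0 M₂
  generalize ((vmap nn 13 _).run Θ ρ M₂).mem = M₃ at *
  have T3 := T2.trans t3
  have E3 := hE.touch T3 (by decide)
  have X3 := hx.touch T3 (by decide)
  obtain ⟨t4, v4⟩ := matmap_spec Θ (d := 28)
    (e := .op .div (.op .mul (el 11)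
      (.op .sub (el 12) (.op .mul (.op .div (sc 9) (el 11)) (el 22)))) (el 11)) (by decide)
    (by simp [SE.Local]) h0 M₃
  generalize ((vmap nn 28 _).run Θ ρ M₃).mem = M₄ at *
  set y := (symKron P P)ᵀ *ᵥ (Θ.Aᵀ *ᵥ (x ∘ Sum.inl)) with hy
  have w3 : M₃.getMat n 13 = smat (eeDiag hr w * y + vext hr (x ∘ Sum.inr)) := by
    rw [v3]
    ext i j
    simp only [SE.eval, BinOp.eval, IExp.eval, Function.update_self, Matrix.of_apply]
    rw [getMat_entry E2.gg, getMat_entry v2, E2.tt, getMat_entry X2.2, smat_add, Matrix.add_apply,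
      smat_eeDiag_mul]
    rfl
  have w4 : M₄.getMat n 28 =
      smat (vext hr (y ∘ vemb hr - dDiag hr w * (x ∘ Sum.inr))) := by
    rw [v4]
    ext i j
    simp only [SE.eval, BinOp.eval, IExp.eval, Function.update_self, Matrix.of_apply]
    rw [getMat_entry E3.wt, getMat_entry ((t3.getMat (by decide)).trans v2), E3.tt,
      getMat_entry X3.2, smat_vext_sub hr hpos hw]
    rfl
  obtain ⟨t5, v5⟩ := conj_spec Θ (d := 13) (by decide) h0
    ((t4.getMat (by decide)).trans E3.vecs) ((t4.getMat (by decide)).trans w3)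
  generalize ((conj 13).run Θ ρ M₄).mem = M₅ at *
  obtain ⟨t6, v6⟩ := callA_spec Θ 13 27 ρ M₅
  generalize ((Prog.callA 13 27).run Θ ρ M₅).mem = M₆ at *
  refine ⟨((T3.trans t4).trans (t5.trans t6)).mono (by decide), ?_⟩
  rw [← Sum.elim_comp_inl_inr x, augMat_mulVec hr hpos hw]
  refine ⟨?_, ?_⟩
  · rw [v6, v5, svec_smat, Sum.elim_comp_inl]
  · rw [(t5.trans t6).getMat (by decide), w4, Sum.elim_comp_inr]

theorem cheap_matvec : Cheap matvec :=
  (cheap_callAT (by decide) (by decide)).seq <| (cheap_conjT (by decide)).seq <|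
    (cheap_matmap (by decide) (by simp [SE.depth]) fun n ρ h4 _ => by
      simp only [SE.Within, IExp.eval]; omega).seq <|
    (cheap_matmap (by decide) (by simp [SE.depth]) fun n ρ h4 _ => by
      simp only [SE.Within, IExp.eval]; omega).seq <|
    (cheap_conj (by decide)).seq (cheap_callA (by decide) (by decide))

/-- The memory holds a state of the recurrence. -/
structure Holds (hr : r < n) (P : Matrix (Fin n) (Fin n) ℝ) (w : Fin n → ℝ)
    (C : Matrix (Fin n) (Fin n) ℝ) (f : Fin m ⊕ VIdx n r → ℝ) (s : DirState (Fin m ⊕ VIdx n r))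
    (M : Mem) : Prop where
  env : Env hr P w C M
  f : Rep hr M 15 f
  p : Rep hr M 17 s.p
  p' : Rep hr M 19 s.p'
  q : Rep hr M 21 s.q
  q' : Rep hr M 23 s.q'
  z : Rep hr M 25 s.z
  ν : M 32 0 = s.ν

/-- The coefficients of one step of the recurrence. -/
def coeffs : Prog :=
  .seq (dotp 29 21 21) (.seq (dotp 30 27 21) (.seq (dotp 31 15 21)
    (.seq (assign 34 (.const 0) (.op .div (sc 30) (sc 29)))
    (.seq (assign 35 (.const 0) (.op .div (sc 29) (sc 32)))
    (assign 36 (.const 0) (.op .div (.op .sub (.rat 0) (sc 31)) (sc 29)))))))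

/-- Arrays 27 and 28 already hold M q. The step length in array 36 is stored with a negative sign
because `comb` subtracts. -/
theorem coeffs_spec {ρ : ℕ → ℕ} (h0 : ρ 0 = n) (h1 : ρ 1 = m) {M : Mem}
    {f q t : Fin m ⊕ VIdx n r → ℝ} (hf : Rep hr M 15 f) (hq : Rep hr M 21 q)
    (ht : Rep hr M 27 t) : Touch [29, 30, 31, 34, 35, 36] M (coeffs.run Θ ρ M).mem ∧
      (coeffs.run Θ ρ M).mem 29 0 = q ⬝ᵥ q ∧
      (coeffs.run Θ ρ M).mem 34 0 = t ⬝ᵥ q / (q ⬝ᵥ q) ∧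
      (coeffs.run Θ ρ M).mem 35 0 = q ⬝ᵥ q / M 32 0 ∧
      (coeffs.run Θ ρ M).mem 36 0 = -(f ⬝ᵥ q / (q ⬝ᵥ q)) := by
  simp only [coeffs, run_seq]
  obtain ⟨t1, v1⟩ := dotp_spec Θ (s := 29) (by decide) (by decide) h0 h1 hq hq
  generalize ((dotp 29 21 21).run Θ ρ M).mem = M₁ at *
  obtain ⟨t2, v2⟩ := dotp_spec Θ (s := 30) (by decide) (by decide) h0 h1
    (ht.touch t1 (by decide)) (hq.touch t1 (by decide))
  generalize ((dotp 30 27 21).run Θ ρ M₁).mem = M₂ at *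
  have T2 := t1.trans t2
  obtain ⟨t3, v3⟩ := dotp_spec Θ (s := 31) (by decide) (by decide) h0 h1
    (hf.touch T2 (by decide)) (hq.touch T2 (by decide))
  generalize ((dotp 31 15 21).run Θ ρ M₂).mem = M₃ at *
  have T3 := T2.trans t3
  obtain ⟨t4, v4⟩ := scalar_spec Θ (s := 34) (e := .op .div (sc 30) (sc 29)) (by decide)
    (by simp [SE.Clean]) ρ M₃
  generalize ((assign 34 _ _).run Θ ρ M₃).mem = M₄ at *
  have T4 := T3.trans t4
  obtain ⟨t5, v5⟩ := scalar_spec Θ (s := 35) (e := .op .div (sc 29) (sc 32)) (by decide)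
    (by simp [SE.Clean]) ρ M₄
  generalize ((assign 35 _ _).run Θ ρ M₄).mem = M₅ at *
  have T5 := T4.trans t5
  obtain ⟨t6, v6⟩ := scalar_spec Θ (s := 36) (e := .op .div (.op .sub (.rat 0) (sc 31)) (sc 29))
    (by decide) (by simp [SE.Clean]) ρ M₅
  generalize ((assign 36 _ _).run Θ ρ M₅).mem = M₆ at *
  have T6 := T5.trans t6
  have a3 : M₃ 29 0 = q ⬝ᵥ q := by rw [t3 29 (by decide), t2 29 (by decide), v1]
  have a4 : M₄ 29 0 = q ⬝ᵥ q := by rw [t4 29 (by decide), a3]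
  have a5 : M₅ 29 0 = q ⬝ᵥ q := by rw [t5 29 (by decide), a4]
  refine ⟨T6.mono (by decide), ?_, ?_, ?_, ?_⟩
  · rw [t6 29 (by decide), a5]
  · rw [t6 34 (by decide), t5 34 (by decide), v4]
    simp only [SE.eval, BinOp.eval, IExp.eval]
    rw [a3, t3 30 (by decide), v2]
  · rw [t6 35 (by decide), v5]
    simp only [SE.eval, BinOp.eval, IExp.eval]
    rw [a4, T4 32 (by decide)]
  · rw [v6]
    simp only [SE.eval, BinOp.eval, IExp.eval]
    rw [a5, t5 31 (by decide), t4 31 (by decide), v3, Rat.cast_zero, zero_sub, neg_div]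

theorem cheap_coeffs : Cheap coeffs :=
  (cheap_dotp (by decide) (by decide) (by decide)).seq <|
    (cheap_dotp (by decide) (by decide) (by decide)).seq <|
    (cheap_dotp (by decide) (by decide) (by decide)).seq <|
    (cheap_assign (by decide) (by simp [SE.depth]) fun n ρ _ _ => by
      simp [SE.Within, IExp.eval]).seq <|
    (cheap_assign (by decide) (by simp [SE.depth]) fun n ρ _ _ => by
      simp [SE.Within, IExp.eval]).seq <|
    cheap_assign (by decide) (by simp [SE.depth]) fun n ρ _ _ => by
      simp [SE.Within, IExp.eval]

/-- The vectors of one step of the recurrence. -/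
def advance : Prog :=
  .seq (comb 25 25 36 17) (.seq (comb 37 21 34 17) (.seq (comb 37 37 35 19) (.seq (copy 19 17)
    (.seq (copy 17 37) (.seq (comb 37 27 34 21) (.seq (comb 37 37 35 23) (.seq (copy 23 21)
    (.seq (copy 21 37) (assign 32 (.const 0) (sc 29))))))))))

/-- The new direction and its image are built in turn in the temporary vector 37. Each current
vector is saved as the previous one only after the old previous vector has been used, and before it
is itself overwritten. -/
theorem advance_spec {ρ : ℕ → ℕ} (h0 : ρ 0 = n) (h1 : ρ 1 = m) {M : Mem}
    {f t : Fin m ⊕ VIdx n r → ℝ} {s : DirState (Fin m ⊕ VIdx n r)} {B : Matrix _ _ ℝ}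
    (h : Holds hr P w C f s M) (ht : Rep hr M 27 t) (htB : t = B *ᵥ s.q)
    (a1 : M 29 0 = s.q ⬝ᵥ s.q) (a2 : M 34 0 = t ⬝ᵥ s.q / (s.q ⬝ᵥ s.q))
    (a3 : M 35 0 = s.q ⬝ᵥ s.q / s.ν) (a4 : M 36 0 = -(f ⬝ᵥ s.q / (s.q ⬝ᵥ s.q))) :
    Holds hr P w C f (dirStep B f s) (advance.run Θ ρ M).mem := by
  subst htB
  simp only [advance, run_seq]
  obtain ⟨t1, v1⟩ := comb_spec Θ (d := 25) (a := 25) (s := 36) (b := 17) (by decide) h0 h1 h.z h.p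
  generalize ((comb 25 25 36 17).run Θ ρ M).mem = M₁ at *
  obtain ⟨t2, v2⟩ := comb_spec Θ (d := 37) (a := 21) (s := 34) (b := 17) (by decide) h0 h1
    (h.q.touch t1 (by decide)) (h.p.touch t1 (by decide))
  generalize ((comb 37 21 34 17).run Θ ρ M₁).mem = M₂ at *
  have T2 := t1.trans t2
  obtain ⟨t3, v3⟩ := comb_spec Θ (d := 37) (a := 37) (s := 35) (b := 19) (by decide) h0 h1
    v2 (h.p'.touch T2 (by decide))
  generalize ((comb 37 37 35 19).run Θ ρ M₂).mem = M₃ at *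
  have T3 := T2.trans t3
  obtain ⟨t4, v4⟩ := copy_spec Θ (d := 19) (a := 17) (by decide) h0 h1
    (h.p.touch T3 (by decide))
  generalize ((copy 19 17).run Θ ρ M₃).mem = M₄ at *
  have T4 := T3.trans t4
  obtain ⟨t5, v5⟩ := copy_spec Θ (d := 17) (a := 37) (by decide) h0 h1 (v3.touch t4 (by decide))
  generalize ((copy 17 37).run Θ ρ M₄).mem = M₅ at *
  have T5 := T4.trans t5
  obtain ⟨t6, v6⟩ := comb_spec Θ (d := 37) (a := 27) (s := 34) (b := 21) (by decide) h0 h1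
    (ht.touch T5 (by decide)) (h.q.touch T5 (by decide))
  generalize ((comb 37 27 34 21).run Θ ρ M₅).mem = M₆ at *
  have T6 := T5.trans t6
  obtain ⟨t7, v7⟩ := comb_spec Θ (d := 37) (a := 37) (s := 35) (b := 23) (by decide) h0 h1
    v6 (h.q'.touch T6 (by decide))
  generalize ((comb 37 37 35 23).run Θ ρ M₆).mem = M₇ at *
  have T7 := T6.trans t7
  obtain ⟨t8, v8⟩ := copy_spec Θ (d := 23) (a := 21) (by decide) h0 h1
    (h.q.touch T7 (by decide))
  generalize ((copy 23 21).run Θ ρ M₇).mem = M₈ at *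
  have T8 := T7.trans t8
  obtain ⟨t9, v9⟩ := copy_spec Θ (d := 21) (a := 37) (by decide) h0 h1 (v7.touch t8 (by decide))
  generalize ((copy 21 37).run Θ ρ M₈).mem = M₉ at *
  have T9 := T8.trans t9
  obtain ⟨t10, v10⟩ := scalar_spec Θ (s := 32) (e := sc 29) (by decide) (by simp [SE.Clean]) ρ M₉
  generalize ((assign 32 _ _).run Θ ρ M₉).mem = M' at *
  have T10 := T9.trans t10
  rw [a4, neg_smul, sub_neg_eq_add] at v1
  rw [t1 34 (by decide), a2] at v2 v3 v5
  rw [T2 35 (by decide), a3] at v3 v5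
  rw [T5 34 (by decide), a2] at v6 v7 v9
  rw [T6 35 (by decide), a3] at v7 v9
  have U8 := t9.trans t10
  have U6 := t7.trans (t8.trans U8)
  have U5 := t6.trans U6
  have U4 := t5.trans U5
  exact {
    env := h.env.touch T10 (by decide)
    f := h.f.touch T10 (by decide)
    p := v5.touch U5 (by decide)
    p' := v4.touch U4 (by decide)
    q := v9.touch t10 (by decide)
    q' := v8.touch U8 (by decide)
    z := v1.touch (t2.trans (t3.trans (t4.trans U4))) (by decide)
    ν := by rw [v10]; simp only [SE.eval, IExp.eval]; rw [T9 29 (by decide), a1]; rfl }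

theorem cheap_advance : Cheap advance :=
  (cheap_comb (by decide)).seq <| (cheap_comb (by decide)).seq <| (cheap_comb (by decide)).seq <|
    (cheap_copy (by decide)).seq <| (cheap_copy (by decide)).seq <|
    (cheap_comb (by decide)).seq <| (cheap_comb (by decide)).seq <|
    (cheap_copy (by decide)).seq <| (cheap_copy (by decide)).seq <|
    cheap_assign (by decide) (by simp [SE.depth]) fun n ρ _ _ => by
      simp [SE.Within, IExp.eval]

/-- One step of the recurrence. -/
def iter : Prog := .seq matvec (.seq coeffs advance)

theorem iter_spec (hpos : ∀ i, 0 < w i) (hw : Antitone w) {ρ : ℕ → ℕ} (h0 : ρ 0 = n)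
    (h1 : ρ 1 = m) {M : Mem} {f : Fin m ⊕ VIdx n r → ℝ} {s : DirState (Fin m ⊕ VIdx n r)}
    (h : Holds hr P w C f s M) :
    Holds hr P w C f (dirStep (augMat hr P w Θ.A) f s) (iter.run Θ ρ M).mem := by
  simp only [iter, run_seq]
  obtain ⟨t1, v1⟩ := matvec_spec Θ hpos hw h0 h.env h.q
  generalize (matvec.run Θ ρ M).mem = M₁ at *
  obtain ⟨t2, c1, c2, c3, c4⟩ := coeffs_spec Θ h0 h1 (h.f.touch t1 (by decide))
    (h.q.touch t1 (by decide)) v1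
  generalize (coeffs.run Θ ρ M₁).mem = M₂ at *
  have T := t1.trans t2
  refine advance_spec Θ h0 h1 ⟨h.env.touch T (by decide), h.f.touch T (by decide),
    h.p.touch T (by decide), h.p'.touch T (by decide), h.q.touch T (by decide),
    h.q'.touch T (by decide), h.z.touch T (by decide), (congrFun (T 32 (by decide)) 0).trans h.ν⟩
    (v1.touch t2 (by decide)) rfl c1 c2 ?_ c4
  rw [c3, t1 32 (by decide), h.ν]

theorem cheap_iter : Cheap iter := cheap_matvec.seq (cheap_coeffs.seq cheap_advance)

end Solver

/-! ### Setup, recovery, and the complete program -/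

section Complete

variable {m n r : ℕ} (Θ : Subroutines m n)

/-- The spectral data of the splitting. -/
def spectral : Prog :=
  .seq (.callEig 0 5 6) (.seq (assign 8 (.const 0) (.op .mul (.rat (1 / 2)) (.ref 6 (.var 2))))
    (.seq (assign 9 (.const 0) (.op .mul (sc 8) (sc 8))) (.seq (vmap (.var 0) 7 (el 6))
    (.seq (vmap (.var 2) 7 (sc 8))
    (.seq (fill 10 (.op .mul (.ref 7 (.var 4)) (.ref 7 (.var 5))))
    (.seq (fill 11 (.op .sub (.op .mul (.ref 6 (.var 4)) (.ref 6 (.var 5)))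
      (.op .mul (.ref 7 (.var 4)) (.ref 7 (.var 5))))) (conjT 2 14)))))))

/-- Array 7 receives all eigenvalues, and its first r cells are then overwritten by τ, which gives
g; arrays 10 and 11 hold the products g i * g j and the weights. Symmetry of C is what makes it the
decoding of its own `svec`. -/
theorem spectral_spec (hr : r < n) {ρ : ℕ → ℕ} (h0 : ρ 0 = n) (h2 : ρ 2 = r) {M : Mem}
    {W C : Matrix (Fin n) (Fin n) ℝ} (hW : M.getMat n 0 = W) (hC : M.getMat n 2 = C)
    (hCs : C.IsSymm) : Touch [5, 6, 7, 8, 9, 10, 11, 13, 14] M (spectral.run Θ ρ M).mem ∧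
      Env hr (Θ.eig W).1 (Θ.eig W).2 C (spectral.run Θ ρ M).mem := by
  simp only [spectral, run_seq]
  obtain ⟨t1, p1, v1⟩ := callEig_spec Θ (s := 0) (d := 5) (d' := 6) (by decide) ρ M
  generalize ((Prog.callEig 0 5 6).run Θ ρ M).mem = M₁ at *
  rw [hW] at p1 v1
  set P := (Θ.eig W).1
  set w := (Θ.eig W).2
  obtain ⟨t2, v2⟩ := scalar_spec Θ (s := 8) (e := .op .mul (.rat (1 / 2)) (.ref 6 (.var 2)))
    (by decide) (by simp [SE.Clean]) ρ M₁
  generalize ((assign 8 _ _).run Θ ρ M₁).mem = M₂ at *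
  obtain ⟨t3, v3⟩ := scalar_spec Θ (s := 9) (e := .op .mul (sc 8) (sc 8))
    (by decide) (by simp [SE.Clean]) ρ M₂
  generalize ((assign 9 _ _).run Θ ρ M₂).mem = M₃ at *
  have f4 := vmap_filled Θ (.var 0) (d := 7) (e := el 6) (by decide) (by simp [SE.Local]) ρ M₃
  generalize ((vmap (.var 0) _ _).run Θ ρ M₃).mem = M₄ at *
  have f5 := vmap_filled Θ (.var 2) (d := 7) (e := sc 8) (by decide) (by simp [SE.Local]) ρ M₄
  generalize ((vmap (.var 2) _ _).run Θ ρ M₄).mem = M₅ at *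
  have t4 := f4.touch
  have t5 := f5.touch
  obtain ⟨t6, v6⟩ := fill_spec Θ (d := 10) (e := .op .mul (.ref 7 (.var 4)) (.ref 7 (.var 5)))
    (by decide) (by simp [SE.Clean]) h0 M₅ (fun i j => M₅ 7 i * M₅ 7 j) fun i j M' t => by
      simp [SE.eval, BinOp.eval, IExp.eval, t 7 (by decide)]
  generalize ((fill 10 _).run Θ ρ M₅).mem = M₆ at *
  obtain ⟨t7, v7⟩ := fill_spec Θ (d := 11) (e := .op .sub
      (.op .mul (.ref 6 (.var 4)) (.ref 6 (.var 5))) (.op .mul (.ref 7 (.var 4)) (.ref 7 (.var 5))))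
    (by decide) (by simp [SE.Clean]) h0 M₆
    (fun i j => M₆ 6 i * M₆ 6 j - M₆ 7 i * M₆ 7 j) fun i j M' t => by
      simp [SE.eval, BinOp.eval, IExp.eval, t 7 (by decide), t 6 (by decide)]
  generalize ((fill 11 _).run Θ ρ M₆).mem = M₇ at *
  have T7 := t1.trans (t2.trans (t3.trans (t4.trans (t5.trans (t6.trans t7)))))
  have q7 : M₇.getMat n 5 = P :=
    ((t2.trans (t3.trans (t4.trans (t5.trans (t6.trans t7))))).getMat (by decide)).trans p1
  have c7 : M₇.getMat n 2 = smat (svec C) := by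
    rw [T7.getMat (by decide), hC, smat_svec_of_isSymm hCs]
  obtain ⟨t8, v8⟩ := conjT_spec Θ (s := 2) (d := 14) (by decide) (by decide) h0 q7 c7
  generalize ((conjT 2 14).run Θ ρ M₇).mem = M₈ at *
  have w1 : ∀ i : Fin n, M₁ 6 i = w i := fun i => by rw [← v1]; rfl
  have hτ : M₂ 8 0 = tau hr w := by
    rw [v2]
    simp only [SE.eval, BinOp.eval, IExp.eval, h2]
    rw [w1 ⟨r, hr⟩, tau]; norm_num
  have hg : ∀ i : Fin n, M₅ 7 i = gval hr w i := fun i => by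
    have e1 := f5.2 i
    have e2 := f4.2 i
    simp only [SE.eval, IExp.eval, h0, h2, Function.update_self] at e1 e2
    rw [e1, gval, e2, if_pos i.2, t4 8 (by decide), t3 8 (by decide), hτ, t3 6 (by decide),
      t2 6 (by decide), w1]
  refine ⟨(T7.trans t8).mono (by decide), ?_, ?_, ?_, ?_, v8⟩
  · rw [t8.getMat (by decide), q7]
  · rw [(t4.trans (t5.trans (t6.trans (t7.trans t8)))) 9 (by decide), v3]
    simp only [SE.eval, BinOp.eval, IExp.eval]
    rw [hτ, sq]
  · rw [(t7.trans t8).getMat (by decide), v6]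
    ext i j
    simp only [Matrix.of_apply, hg]
  · rw [t8.getMat (by decide), v7]
    ext i j
    simp only [Matrix.of_apply, t6 7 (by decide), hg]
    have := (t2.trans (t3.trans (t4.trans (t5.trans t6)))) 6 (by decide)
    simp only [this, w1, swt]

theorem cheap_spectral : Cheap spectral :=
  (cheap_callEig (by decide) (by decide) (by decide)).seq <|
    (cheap_assign (by decide) (by simp [SE.depth]) fun n ρ _ h => by
      have := Nat.le_mul_self n
      simp only [SE.Within, IExp.eval, true_and]; omega).seq <|
    (cheap_assign (by decide) (by simp [SE.depth]) fun n ρ _ _ => by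
      simp [SE.Within, IExp.eval]).seq <|
    (cheap_vmap (by decide) (by simp [SE.depth])
      (fun m n ρ h0 _ _ _ => by simp only [IExp.eval, h0]; exact Nat.le_mul_self n)
      fun n ρ h4 _ => by simp only [SE.Within, IExp.eval]; omega).seq <|
    (cheap_vmap (N := .var 2) (by decide) (by simp [SE.depth])
      (fun m n ρ h0 _ h2 _ => h2.le.trans (Nat.le_mul_self n))
      fun n ρ h4 _ => by simp only [SE.Within, IExp.eval]; omega).seq <|
    (cheap_fill (by decide) (by simp [SE.depth]) fun n ρ h4 h5 => by
      have := Nat.le_mul_self n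
      simp only [SE.Within, IExp.eval]; omega).seq <|
    (cheap_fill (by decide) (by simp [SE.depth]) fun n ρ h4 h5 => by
      have := Nat.le_mul_self n
      simp only [SE.Within, IExp.eval]; omega).seq <|
    cheap_conjT (by decide)

/-- The right-hand side and the initial state. -/
def initial : Prog :=
  .seq (vmap nn 13 (.op .div (.op .mul (el 10) (el 14)) (sc 9))) (.seq (conj 13)
    (.seq (.callA 13 37) (.seq (vmap (.var 1) 15 (.op .add (el 1) (.op .mul (sc 9) (el 37))))
    (.seq (vmap nn 16 (.op .mul (sc 9) (.op .div (.op .mul (el 11) (el 14)) (el 11))))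
    (.seq (copy 17 15) (.seq (copy 21 15) (.seq matvec (copy 21 27))))))))

/-- The zero vectors and the zero scalar of the initial state are never written: the arrays
concerned are still blank. -/
theorem initial_spec {hr : r < n} {P C : Matrix (Fin n) (Fin n) ℝ} {w : Fin n → ℝ}
    (hpos : ∀ i, 0 < w i) (hw : Antitone w) {ρ : ℕ → ℕ} (h0 : ρ 0 = n)
    (h1 : ρ 1 = m) {M : Mem} (hE : Env hr P w C M) {b : Fin m → ℝ} (hb : M.getVec m 1 = b)
    (hz : ∀ a ∈ [19, 20, 23, 24, 25, 26, 32], ∀ o, M a o = 0) :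
    Holds hr P w C (augRhs hr P w Θ.A b C)
      (dirState (augMat hr P w Θ.A) (augRhs hr P w Θ.A b C) 0) (initial.run Θ ρ M).mem := by
  simp only [initial, run_seq]
  obtain ⟨t1, v1⟩ := matmap_spec Θ (d := 13) (e := .op .div (.op .mul (el 10) (el 14)) (sc 9))
    (by decide) (by simp [SE.Local]) h0 M
  generalize ((vmap nn 13 _).run Θ ρ M).mem = M₁ at *
  set y := (symKron P P)ᵀ *ᵥ svec C with hy
  have w1 : M₁.getMat n 13 = smat (eeDiag hr w * y) := by
    rw [v1]
    ext i j
    simp only [SE.eval, BinOp.eval, IExp.eval, Function.update_self, Matrix.of_apply]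
    rw [getMat_entry hE.gg, getMat_entry hE.rhs, hE.tt, smat_eeDiag_mul]
    rfl
  obtain ⟨t2, v2⟩ := conj_spec Θ (d := 13) (by decide) h0
    ((t1.getMat (by decide)).trans hE.vecs) w1
  generalize ((conj 13).run Θ ρ M₁).mem = M₂ at *
  obtain ⟨t3, v3⟩ := callA_spec Θ 13 37 ρ M₂
  generalize ((Prog.callA 13 37).run Θ ρ M₂).mem = M₃ at *
  have T3 := t1.trans (t2.trans t3)
  have E3 := hE.touch T3 (by decide)
  obtain ⟨t4, v4⟩ := vecmap_spec Θ (d := 15) (e := .op .add (el 1) (.op .mul (sc 9) (el 37)))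
    (by decide) (by simp [SE.Local]) h1 M₃
  generalize ((vmap (.var 1) 15 _).run Θ ρ M₃).mem = M₄ at *
  have E4 := E3.touch t4 (by decide)
  obtain ⟨t5, v5⟩ := matmap_spec Θ (d := 16)
    (e := .op .mul (sc 9) (.op .div (.op .mul (el 11) (el 14)) (el 11)))
    (by decide) (by simp [SE.Local]) h0 M₄
  generalize ((vmap nn 16 _).run Θ ρ M₄).mem = M₅ at *
  have E5 := E4.touch t5 (by decide)
  have T5 := T3.trans (t4.trans t5)
  have r5 : Rep hr M₅ 15 (augRhs hr P w Θ.A b C) := by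
    rw [augRhs_eq hr hpos, ← hy]
    refine ⟨?_, ?_⟩
    · rw [t5.getVec (by decide), v4]
      ext i
      simp only [SE.eval, BinOp.eval, IExp.eval, Function.update_self]
      have e1 : M₃ 1 i = b i := by rw [T3 1 (by decide), ← hb]; rfl
      have e2 : M₃ 37 i = M₃.getVec m 37 i := rfl
      rw [e1, e2, v3, v2, svec_smat, E3.tt]; rfl
    · rw [v5]
      ext i j
      simp only [SE.eval, BinOp.eval, IExp.eval, Function.update_self, Matrix.of_apply]
      have e1 : tau hr w ^ 2 • (y ∘ vemb hr) = (tau hr w ^ 2 • y) ∘ vemb hr := rfl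
      rw [getMat_entry E4.wt, getMat_entry E4.rhs, E4.tt, Sum.elim_comp_inr, e1,
        smat_vext_comp hr hpos hw, smat_smul, Matrix.smul_apply, smul_eq_mul, Matrix.of_apply]
      ring
  obtain ⟨t6, v6⟩ := copy_spec Θ (d := 17) (a := 15) (by decide) h0 h1 r5
  generalize ((copy 17 15).run Θ ρ M₅).mem = M₆ at *
  obtain ⟨t7, v7⟩ := copy_spec Θ (d := 21) (a := 15) (by decide) h0 h1 (r5.touch t6 (by decide))
  generalize ((copy 21 15).run Θ ρ M₆).mem = M₇ at *
  obtain ⟨t8, v8⟩ := matvec_spec Θ hpos hw h0 (E5.touch (t6.trans t7) (by decide)) v7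
  generalize (matvec.run Θ ρ M₇).mem = M₈ at *
  obtain ⟨t9, v9⟩ := copy_spec Θ (d := 21) (a := 27) (by decide) h0 h1 v8
  generalize ((copy 21 27).run Θ ρ M₈).mem = M₉ at *
  have T9 := t6.trans (t7.trans (t8.trans t9))
  have T := T5.trans T9
  have zero : ∀ a, (∀ o, M a o = 0) → (∀ o, M (a + 1) o = 0) →
      Rep hr M a (0 : Fin m ⊕ VIdx n r → ℝ) := fun a h h' => by
    refine ⟨?_, ?_⟩
    · ext i; exact h i
    · have : vext hr ((0 : Fin m ⊕ VIdx n r → ℝ) ∘ Sum.inr) = (0 : ℝ) • (0 : SIdx n → ℝ) := by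
        ext p
        by_cases hp : p ∈ Set.range (vemb hr)
        · obtain ⟨q, rfl⟩ := hp
          rw [vext_vemb]; simp
        · rw [vext_of_notMem_range hr _ hp]; simp
      rw [this, smat_smul, zero_smul]
      ext i j
      exact h' _
  exact {
    env := E5.touch T9 (by decide)
    f := r5.touch T9 (by decide)
    p := v6.touch (t7.trans (t8.trans t9)) (by decide)
    p' := (zero 19 (hz 19 (by decide)) (hz 20 (by decide))).touch T (by decide)
    q := v9
    q' := (zero 23 (hz 23 (by decide)) (hz 24 (by decide))).touch T (by decide)
    z := (zero 25 (hz 25 (by decide)) (hz 26 (by decide))).touch T (by decide)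
    ν := by rw [T 32 (by decide), hz 32 (by decide)]; rfl }

theorem cheap_initial : Cheap initial :=
  (cheap_matmap (by decide) (by simp [SE.depth]) fun n ρ h4 _ => by
      simp only [SE.Within, IExp.eval]; omega).seq <|
    (cheap_conj (by decide)).seq <| (cheap_callA (by decide) (by decide)).seq <|
    (cheap_vecmap (by decide) (by simp [SE.depth]) fun n ρ h4 _ => by
      simp only [SE.Within, IExp.eval]; omega).seq <|
    (cheap_matmap (by decide) (by simp [SE.depth]) fun n ρ h4 _ => by
      simp only [SE.Within, IExp.eval]; omega).seq <|
    (cheap_copy (by decide)).seq <| (cheap_copy (by decide)).seq <|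
    cheap_matvec.seq (cheap_copy (by decide))

/-- Recovery of the search direction from the vector `25`. -/
def recover : Prog :=
  .seq (.callAT 25 12) (.seq (conjT 12 12)
    (.seq (vmap nn 13 (.op .add (.op .div (.op .mul (el 10)
      (.op .sub (el 12) (.op .mul (sc 9) (el 14)))) (sc 9)) (el 26)))
    (.seq (conj 3) (vmap (.var 1) 4 (.op .div (el 25) (sc 9))))))

theorem recover_spec {hr : r < n} {P C : Matrix (Fin n) (Fin n) ℝ} {w : Fin n → ℝ}
    (hpos : ∀ i, 0 < w i) {ρ : ℕ → ℕ} (h0 : ρ 0 = n) (h1 : ρ 1 = m) {M : Mem}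
    (hE : Env hr P w C M) {z : Fin m ⊕ VIdx n r → ℝ} (hz : Rep hr M 25 z) :
    (recover.run Θ ρ M).mem.getMat n 3 = recoverX hr P w Θ.A C z ∧
      (recover.run Θ ρ M).mem.getVec m 4 = recoverY hr w z := by
  simp only [recover, run_seq]
  obtain ⟨t1, v1⟩ := callAT_spec Θ 25 12 ρ M
  generalize ((Prog.callAT 25 12).run Θ ρ M).mem = M₁ at *
  rw [hz.1] at v1
  obtain ⟨t2, v2⟩ := conjT_spec Θ (s := 12) (d := 12) (by decide) (by decide) h0
    ((t1.getMat (by decide)).trans hE.vecs) v1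
  generalize ((conjT 12 12).run Θ ρ M₁).mem = M₂ at *
  have T2 := t1.trans t2
  have E2 := hE.touch T2 (by decide)
  have X2 := hz.touch T2 (by decide)
  obtain ⟨t3, v3⟩ := matmap_spec Θ (d := 13)
    (e := .op .add (.op .div (.op .mul (el 10)
      (.op .sub (el 12) (.op .mul (sc 9) (el 14)))) (sc 9)) (el 26)) (by decide)
    (by simp [SE.Local]) h0 M₂
  generalize ((vmap nn 13 _).run Θ ρ M₂).mem = M₃ at *
  have T3 := T2.trans t3
  have w3 : M₃.getMat n 13 = smat (eeDiag hr w * ((symKron P P)ᵀ *ᵥ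
      (Θ.Aᵀ *ᵥ (z ∘ Sum.inl) - tau hr w ^ 2 • svec C)) + vext hr (z ∘ Sum.inr)) := by
    rw [v3]
    ext i j
    simp only [SE.eval, BinOp.eval, IExp.eval, Function.update_self, Matrix.of_apply]
    rw [getMat_entry E2.gg, getMat_entry v2, E2.tt, getMat_entry E2.rhs, getMat_entry X2.2,
      smat_add, Matrix.add_apply, smat_eeDiag_mul, Matrix.mulVec_sub, Matrix.mulVec_smul,
      smat_sub, smat_smul]
    rfl
  obtain ⟨t4, v4⟩ := conj_spec Θ (d := 3) (by decide) h0
    ((t3.getMat (by decide)).trans E2.vecs) w3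
  generalize ((conj 3).run Θ ρ M₃).mem = M₄ at *
  have T4 := T3.trans t4
  obtain ⟨t5, v5⟩ := vecmap_spec Θ (d := 4) (e := .op .div (el 25) (sc 9)) (by decide)
    (by simp [SE.Local]) h1 M₄
  generalize ((vmap (.var 1) 4 _).run Θ ρ M₄).mem = M₅ at *
  refine ⟨?_, ?_⟩
  · rw [t5.getMat (by decide), v4, ← svec_recoverX hr hpos, Sum.elim_comp_inl_inr, recoverX,
      svec_smat]
  · rw [v5]
    ext i
    simp only [SE.eval, BinOp.eval, IExp.eval, Function.update_self]
    have e1 : M 25 i = z (Sum.inl i) := by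
      have := congrFun hz.1 i
      exact this
    rw [T4 25 (by decide), T4 9 (by decide), e1, hE.tt, recoverY, Pi.smul_apply, smul_eq_mul,
      div_eq_inv_mul]
    rfl

theorem cheap_recover : Cheap recover :=
  (cheap_callAT (by decide) (by decide)).seq <| (cheap_conjT (by decide)).seq <|
    (cheap_matmap (by decide) (by simp [SE.depth]) fun n ρ h4 _ => by
      simp only [SE.Within, IExp.eval]; omega).seq <|
    (cheap_conj (by decide)).seq <|
    cheap_vecmap (by decide) (by simp [SE.depth]) fun n ρ h4 _ => by
      simp only [SE.Within, IExp.eval]; omega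

/-- The complete program. -/
def solver : Prog := .seq (.seq spectral initial) (.seq (.loop 7 (.var 3) iter) recover)

theorem isSymm_of_posDef {W : Matrix (Fin n) (Fin n) ℝ} (hW : W.PosDef) : W.IsSymm := by
  have := hW.1
  rwa [Matrix.IsHermitian, Matrix.conjTranspose_eq_transpose_of_trivial] at this

theorem solver_spec (hr : r < n) (k : ℕ) {W C : Matrix (Fin n) (Fin n) ℝ} (hW : W.PosDef)
    (hC : C.IsSymm) (b : Fin m → ℝ) :
    (solver.run Θ (inputIdx n m r k) (inputMem W b C)).mem.getMat n 3 =
        recoverX hr (Θ.eig W).1 (Θ.eig W).2 Θ.A C (dirState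
          (augMat hr (Θ.eig W).1 (Θ.eig W).2 Θ.A)
          (augRhs hr (Θ.eig W).1 (Θ.eig W).2 Θ.A b C) k).z ∧
      (solver.run Θ (inputIdx n m r k) (inputMem W b C)).mem.getVec m 4 =
        recoverY hr (Θ.eig W).2 (dirState (augMat hr (Θ.eig W).1 (Θ.eig W).2 Θ.A)
          (augRhs hr (Θ.eig W).1 (Θ.eig W).2 Θ.A b C) k).z := by
  have he := Θ.eig_spec W (isSymm_of_posDef hW)
  have hpos := he.pos hW
  set M := inputMem W b C with hM
  set ρ := inputIdx n m r k
  have m2 : M.getMat n 2 = C := Mem.getMat_setMat _ _ _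
  have m1 : M.getVec m 1 = b := by
    ext i
    simp [hM, inputMem, Mem.getVec, Mem.setMat, Mem.setVec]
  have m0 : M.getMat n 0 = W := by
    have : M 0 = (Mem.setMat (fun _ _ => 0) 0 W) 0 := by
      rw [hM, inputMem, Mem.setMat, Mem.setVec_of_ne _ (by decide), Mem.setVec_of_ne _ (by decide)]
    rw [Mem.getMat, this]
    exact Mem.getMat_setMat _ 0 W
  have mz : ∀ a, 3 ≤ a → ∀ o, M a o = 0 := fun a ha o => by
    rw [hM, inputMem, Mem.setMat, Mem.setVec_of_ne _ (by omega), Mem.setVec_of_ne _ (by omega),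
      Mem.setMat, Mem.setVec_of_ne _ (by omega)]
  simp only [solver, run_seq]
  obtain ⟨t1, E1⟩ := spectral_spec Θ hr (ρ := ρ) rfl rfl m0 m2 hC
  generalize (spectral.run Θ ρ M).mem = M₁ at *
  have H2 := initial_spec Θ hpos he.antitone (ρ := ρ) rfl rfl E1
    ((t1.getVec (by decide)).trans m1) fun a ha o => by
      have h3 : 3 ≤ a ∧ a ∉ scr :: [5, 6, 7, 8, 9, 10, 11, 13, 14] := by
        revert a; decide
      rw [t1 a h3.2, mz a h3.1]
  generalize (initial.run Θ ρ M₁).mem = M₂ at *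
  have H3 := loop_inv Θ 7 (.var 3) iter ρ M₂
    (fun i M' => Holds hr (Θ.eig W).1 (Θ.eig W).2 C (augRhs hr (Θ.eig W).1 (Θ.eig W).2 Θ.A b C)
      (dirState (augMat hr (Θ.eig W).1 (Θ.eig W).2 Θ.A)
        (augRhs hr (Θ.eig W).1 (Θ.eig W).2 Θ.A b C) i) M') H2
    fun i _ M' h => iter_spec Θ hpos he.antitone rfl rfl h
  exact recover_spec Θ hpos (ρ := ρ) rfl rfl H3.env H3.z

/-- 40 arrays of n² + 8 cells, and 8 ≤ 8n². -/
theorem card_pool_le {n : ℕ} (hn : 0 < n) : (pool n).card ≤ 360 * n ^ 2 := by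
  have : 1 ≤ n ^ 2 := Nat.one_le_pow _ _ hn
  simp only [pool, Finset.card_product, Finset.card_range]
  rw [← sq]; omega

/-- Setup and recovery cost O(n³) each and are absorbed into n³k because k > 0. All runs stay in the
same pool, so storage does not grow with k. -/
theorem solver_res (c : ℕ) : ∃ K : ℕ, ∀ (m n r k : ℕ) (_ : r < n) (Θ : Subroutines m n), 0 < k →
    m ≤ n * n → Θ.timeA ≤ c * n ^ 3 → Θ.timeAT ≤ c * n ^ 3 → Θ.timeEig ≤ c * n ^ 3 →
    Θ.scratch ≤ c * n ^ 2 → ∀ M : Mem,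
      (solver.run Θ (inputIdx n m r k) M).time ≤ K * n ^ 3 * k ∧
        storage Θ (solver.run Θ (inputIdx n m r k) M) ≤ K * n ^ 2 := by
  obtain ⟨K₁, h₁⟩ := cheap_spectral.seq cheap_initial c
  obtain ⟨K₂, h₂⟩ := cheap_iter c
  obtain ⟨K₃, h₃⟩ := cheap_recover c
  refine ⟨K₁ + K₂ + K₃ + 2 + 360 + c, fun m n r k hr Θ hk hm hA hAT hE hs M => ?_⟩
  have hf : Fits c Θ (inputIdx n m r k) := ⟨rfl, rfl, hr, hm, hA, hAT, hE⟩
  have hn := hf.pos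
  set ρ := inputIdx n m r k
  obtain ⟨a1, a2⟩ := h₁ m n Θ ρ hf M
  set M₁ := ((Prog.seq spectral initial).run Θ ρ M).mem
  obtain ⟨b1, b2⟩ := loop_res Θ 7 (.var 3) iter ρ M₁ (K₂ * n ^ 3) (pool n)
    fun i _ M' => h₂ m n Θ _ (hf.update (by norm_num) i) M'
  obtain ⟨d1, d2⟩ := h₃ m n Θ ρ hf ((Prog.loop 7 (.var 3) iter).run Θ ρ M₁).mem
  have e3 : (IExp.var 3).eval ρ = k := rfl
  rw [e3] at b1
  constructor
  · have h6 : 1 ≤ n ^ 3 := Nat.one_le_pow _ _ hn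
    have h7 : n ^ 3 ≤ n ^ 3 * k := Nat.le_mul_of_pos_right _ hk
    calc (solver.run Θ ρ M).time
        ≤ K₁ * n ^ 3 + (k * (K₂ * n ^ 3 + 1) + 1 + K₃ * n ^ 3) :=
          Nat.add_le_add a1 (Nat.add_le_add b1 d1)
      _ ≤ K₁ * (n ^ 3 * k) + (k * (K₂ * n ^ 3 + n ^ 3) + n ^ 3 * k + K₃ * (n ^ 3 * k)) := by
          gcongr; omega
      _ = (K₁ + K₂ + K₃ + 2) * (n ^ 3 * k) := by ring
      _ ≤ (K₁ + K₂ + K₃ + 2 + 360 + c) * (n ^ 3 * k) := Nat.mul_le_mul_right _ (by omega)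
      _ = _ := by ring
  · have hu : (solver.run Θ ρ M).used ⊆ pool n :=
      Finset.union_subset a2 (Finset.union_subset b2 d2)
    calc storage Θ (solver.run Θ ρ M) ≤ 360 * n ^ 2 + c * n ^ 2 :=
          Nat.add_le_add ((Finset.card_le_card hu).trans (card_pool_le hn)) hs
      _ = (360 + c) * n ^ 2 := by ring
      _ ≤ _ := Nat.mul_le_mul_right _ (by omega)

/-- Independent rows number at most n(n+1)/2, so vectors of length m fit into the arrays of the
pool. -/
theorem le_of_linearIndependent_row {A : Matrix (Fin m) (SIdx n) ℝ}
    (hA : LinearIndependent ℝ A.row) : m ≤ n * n := by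
  have h1 := hA.fintype_card_le_finrank
  rw [Fintype.card_fin, Module.finrank_fintype_fun_eq_card] at h1
  refine h1.trans ((Fintype.card_subtype_le _).trans ?_)
  simp

end Complete

end NewtonKKT

end

open NewtonKKT in
theorem mainTheorem2 :
    -- iteration bound
    (∃ K : ℝ, 0 < K ∧
      ∀ (m n r : ℕ) (hr : r < n) (A : Matrix (Fin m) (SIdx n) ℝ)
        (W X S Xs Ss P : Matrix (Fin n) (Fin n) ℝ) (w : Fin n → ℝ)
        (b : Fin m → ℝ) (C : Matrix (Fin n) (Fin n) ℝ) (μ L δ χ₁ χ₂ ε : ℝ),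
        0 < m → LinearIndependent ℝ A.row → C.IsSymm →
        0 < μ → μ ≤ 1 → 1 ≤ L → 0 ≤ δ → δ < 1 → 0 < χ₁ → 0 < ε →
        CenteredScaling W X S Xs Ss μ L δ χ₁ →
        TangentInjective A Xs χ₂ →
        Xs.rank ≤ r →
        IsEigendecomp W P w →
        (∀ k : ℕ, ∃! z, IsMinres (augMat hr P w A) (augRhs hr P w A b C) k z) ∧
        ∀ k : ℕ,
          K * max 1 (max ‖A * Aᵀ‖⁻¹ ‖(A * Aᵀ)⁻¹‖⁻¹) * cond (A * Aᵀ) *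
              L ^ 20 * ((1 - δ) ^ 19)⁻¹ * χ₁ ^ 2 * χ₂ ^ 6 *
              Real.log (2 + L ^ 4 * vnorm (augRhs hr P w A b C) / (μ * ε * (1 - δ) ^ 4)) ≤ k →
          ∀ z, IsMinres (augMat hr P w A) (augRhs hr P w A b C) k z →
            newtResidual W A b C (recoverX hr P w A C z) (recoverY hr w z) ≤ ε) ∧
    -- time and storage
    (∃ p : Prog, ∀ c : ℕ, ∃ K : ℕ,
      ∀ (m n r k : ℕ) (hr : r < n) (Θ : Subroutines m n)
        (W C : Matrix (Fin n) (Fin n) ℝ) (b : Fin m → ℝ),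
        0 < k → LinearIndependent ℝ Θ.A.row → W.PosDef → C.IsSymm →
        Θ.timeA ≤ c * n ^ 3 → Θ.timeAT ≤ c * n ^ 3 → Θ.timeEig ≤ c * n ^ 3 →
        Θ.scratch ≤ c * n ^ 2 →
        (∃ z, IsMinres (augMat hr (Θ.eig W).1 (Θ.eig W).2 Θ.A)
            (augRhs hr (Θ.eig W).1 (Θ.eig W).2 Θ.A b C) k z ∧
          (p.run Θ (inputIdx n m r k) (inputMem W b C)).mem.getMat n 3 =
            recoverX hr (Θ.eig W).1 (Θ.eig W).2 Θ.A C z ∧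
          (p.run Θ (inputIdx n m r k) (inputMem W b C)).mem.getVec m 4 =
            recoverY hr (Θ.eig W).2 z) ∧
        (p.run Θ (inputIdx n m r k) (inputMem W b C)).time ≤ K * n ^ 3 * k ∧
        storage Θ (p.run Θ (inputIdx n m r k) (inputMem W b C)) ≤ K * n ^ 2) := by
  -- 204800 = 20 * 10240: the factor 20 comes from `exp_bound`, the other from `kappa_bound`.
  refine ⟨⟨204800, by norm_num, ?_⟩, ?_⟩
  · intro m n r hr A W X S Xs Ss P w b C μ L δ χ₁ χ₂ ε hm hA _ hμ hμ1 hL hδ0 hδ hχ₁ hε h ht hrank he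
    exact iteration_bound hr A W X S Xs Ss P w b C μ L δ χ₁ χ₂ ε hm hA hμ hμ1 hL hδ0 hδ hχ₁ hε h ht
      hrank he
  · refine ⟨solver, fun c => ?_⟩
    obtain ⟨K, hK⟩ := solver_res c
    refine ⟨K, fun m n r k hr Θ W C b hk hA hW hC h1 h2 h3 h4 => ?_⟩
    have he := Θ.eig_spec W (isSymm_of_posDef hW)
    exact ⟨⟨_, isMinres_dirState _ _ (augMat_isSymm hr (he.pos hW) he.antitone _) k,
      solver_spec Θ hr k hW hC b⟩,
      hK m n r k hr Θ hk (le_of_linearIndependent_row hA) h1 h2 h3 h4 _⟩
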